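/- **Theorem (privacy guarantee).** *Circuit.* Consider a variational quantum circuit (VQC) on $n$ qubits with parameters $\boldsymbol\theta\in\mathbb R^d$: an input $\boldsymbol x\in\mathbb R^n$ is encoded as $\bigotimes_{i=1}^n(\cos\frac{x_i}{2}|0\rangle+\sin\frac{x_i}{2}|1\rangle)$, the state is evolved by a finite sequence of single-qubit Pauli rotations (by angles that are components of $\boldsymbol\theta$) and CNOT gates, and the prediction $\hat{\boldsymbol y}(\boldsymbol\theta,\boldsymbol x)\in\mathbb R^m$ consists of the expectation values of $m$ Hermitian observables in the final state. *Data.* A dataset $D$ consists of $N$ samples $(\boldsymbol x_i,\boldsymbol y_i^*)$, where $\boldsymbol x_i\in\mathbb R^n$ lists wind generation, solar generation and loads, and $\boldsymbol y_i^*\in\mathbb R^m$ is the target solution of the optimal power flow problem. Let $\mu\in\mathbb R$. Two datasets $D,D'$ are *adjacent* if there is a sample $i$ such that they agree in all samples other than $i$, have the same wind and solar generation in sample $i$, and the loads of sample $i$ agree except for one entry, which differs by at most $\mu$ (the target $\boldsymbol y_i^*$ may change with the load). *Training.* Fix a batch size $1\le B\le N$, a learning rate $\eta>0$, a clipping norm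 $C>0$, a noise multiplier $\sigma$, initial parameters $\boldsymbol\theta_0\in\mathbb R^d$, a number of rounds $T\ge 0$, and a loss $\mathcal L(\boldsymbol\theta,\hat{\boldsymbol y},\boldsymbol y^*)$ that is differentiable in $(\boldsymbol\theta,\hat{\boldsymbol y})$. In round $t=1,\dots,T$, with fresh randomness independent of the past, draw a batch $S_t$ uniformly among the $B$-element subsets of $\{1,\dots,N\}$ and, independently, $Z_t\sim\mathcal N(0,\sigma^2C^2I)$, and set $$\boldsymbol\theta_t=\boldsymbol\theta_{t-1}-\frac{\eta}{B}\Bigl(\sum_{i\in S_t}\boldsymbol g_i\min\bigl(1,\tfrac{C}{\|\boldsymbol g_i\|_2}\bigr)+Z_t\Bigr),\qquad \boldsymbol g_i=\nabla_{\boldsymbol\theta}\mathcal L(\boldsymbol\theta,\hat{\boldsymbol y}(\boldsymbol\theta,\boldsymbol x_i),\boldsymbol y_i^*)\big|_{\boldsymbol\theta=\boldsymbol\theta_{t-1}},$$ where a zero gradient is left unchanged by clipping. *Claim.* A randomized algorithm $\mathcal M$ is $(\varepsilon,\delta)$-differentially private if $\mathbb P[\mathcal M(D)\in A]\le e^{\varepsilon}\,\mathbb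 P[\mathcal M(D')\in A]+\delta$ for all adjacent $D,D'$ and all measurable $A$. Let $\varepsilon,\delta\in(0,1)$, $\delta'>0$ and $$\sigma\ \ge\ \frac{\sqrt{2\log(1.25)/\delta}}{\varepsilon}.$$ Then the training algorithm with output $\boldsymbol\theta_T$, and also the algorithm that releases all iterates $(\boldsymbol\theta_0,\dots,\boldsymbol\theta_T)$, is $\bigl(\varepsilon',\frac{TB}{N}\delta+\delta'\bigr)$-differentially private, where $$\varepsilon'=\sqrt{2T\ln(1/\delta')}\cdot\frac{B\varepsilon}{N}+\frac{TB\varepsilon}{N}\bigl(e^{B\varepsilon/N}-1\bigr)$$ (for $\delta'>1$ the square root is read as $0$). -/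

import Mathlib

open MeasureTheory ProbabilityTheory
open scoped Matrix

noncomputable section

namespace PrivateVQC

/-! ### Variational quantum circuits -/

/-- Computational basis labels of an `n`-qubit register. -/
abbrev Basis (n : ℕ) := Fin n → Fin 2

/-- Pure states of an `n`-qubit register, as amplitude vectors in the computational basis. -/
abbrev QState (n : ℕ) := Basis n → ℂ

/-- The parameter space of a circuit with `d` learnable parameters, with its `ℓ₂` norm. -/
abbrev Params (d : ℕ) := EuclideanSpace ℝ (Fin d)

/-- The space of OPF solutions (targets and predictions) with `m` components. -/
abbrev Output (m : ℕ) := EuclideanSpace ℝ (Fin m)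

/-- The three rotation axes of a single-qubit rotation gate. -/
inductive Axis
  | X
  | Y
  | Z

/-- The Pauli matrices. -/
def Axis.pauli : Axis → Matrix (Fin 2) (Fin 2) ℂ
  | .X => !![0, 1; 1, 0]
  | .Y => !![0, -Complex.I; Complex.I, 0]
  | .Z => !![1, 0; 0, -1]

/-- The rotation `exp (-i (t / 2) P) = cos (t / 2) - i sin (t / 2) P` about the axis `P`. -/
def rotation (a : Axis) (t : ℝ) : Matrix (Fin 2) (Fin 2) ℂ :=
  (Real.cos (t / 2) : ℂ) • (1 : Matrix (Fin 2) (Fin 2) ℂ)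
    - (Complex.I * (Real.sin (t / 2) : ℂ)) • a.pauli

/-- The gates of the variational layers on `n` qubits with `d` learnable parameters: a rotation of
one qubit by the angle `θ k`, or a controlled-NOT with distinct control and target qubits. -/
inductive Gate (n d : ℕ)
  | rot (axis : Axis) (qubit : Fin n) (k : Fin d)
  | cnot (control target : Fin n) (h : control ≠ target)

/-- The action of a gate on a state, for the parameter vector `θ`. In the second case the amplitude
of `b` is read off at the label in which the target bit has been replaced by its sum modulo two
with the control bit. -/
def Gate.apply {n d : ℕ} (θ : Params d) : Gate n d → QState n → QState n
  | .rot a q k, ψ => fun b =>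
      ∑ s : Fin 2, rotation a (θ k) (b q) s * ψ (Function.update b q s)
  | .cnot c t _, ψ => fun b => ψ (Function.update b t (b t + b c))

/-- Angle encoding: `⨂ i, (cos (x i / 2) |0⟩ + sin (x i / 2) |1⟩)`. -/
def angleEncoding {n : ℕ} (x : Fin n → ℝ) : QState n := fun b =>
  ∏ i, (if b i = 0 then (Real.cos (x i / 2) : ℂ) else (Real.sin (x i / 2) : ℂ))

/-- A variational quantum circuit on `n` qubits with `d` learnable parameters and `m` outputs: the
gates of the variational layers in order of application, and one observable for each output. -/
structure VQC (n d m : ℕ) where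
  gates : List (Gate n d)
  observable : Fin m → Matrix (Basis n) (Basis n) ℂ
  isHermitian : ∀ k, (observable k).IsHermitian

/-- The final state of the circuit: the encoded input evolved through all gates. -/
def VQC.finalState {n d m : ℕ} (V : VQC n d m) (θ : Params d) (x : Fin n → ℝ) : QState n :=
  V.gates.foldl (fun ψ g => g.apply θ ψ) (angleEncoding x)

/-- The predicted OPF solution: the expectation values `⟨ψ| O k |ψ⟩` in the final state. -/
def VQC.predict {n d m : ℕ} (V : VQC n d m) (θ : Params d) (x : Fin n → ℝ) : Output m :=
  WithLp.toLp 2 fun k =>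
    (star (V.finalState θ x) ⬝ᵥ (V.observable k *ᵥ V.finalState θ x)).re

/-! ### Datasets and differential privacy -/

/-- Two families of loads are `μ`-adjacent if they agree except at one index, where they differ by
at most `μ`. -/
def LoadAdjacent {ι : Type*} (μ : ℝ) (p p' : ι → ℝ) : Prop :=
  ∃ i, |p i - p' i| ≤ μ ∧ ∀ j, j ≠ i → p j = p' j

/-- A dataset of `N` OPF samples. Sample `i` has the input `(wind i, solar i, load i)`, with
`w` wind, `s` solar and `l` load components, and the OPF solution `target i`. -/
structure OPFDataset (N w s l m : ℕ) where
  wind : Fin N → Fin w → ℝ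
  solar : Fin N → Fin s → ℝ
  load : Fin N → Fin l → ℝ
  target : Fin N → Output m

/-- The input vector of sample `i`. -/
def OPFDataset.input {N w s l m : ℕ} (D : OPFDataset N w s l m) (i : Fin N) :
    Fin (w + s + l) → ℝ :=
  Fin.append (Fin.append (D.wind i) (D.solar i)) (D.load i)

/-- Adjacency of datasets: same wind and solar generation, and loads that differ, in one entry of
one sample `i`, by at most `μ`. The OPF solution of that sample depends on its load, so it may
change too; all other samples are equal. -/
def OPFDataset.Adjacent {N w s l m : ℕ} (μ : ℝ) (D D' : OPFDataset N w s l m) : Prop :=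
  D.wind = D'.wind ∧ D.solar = D'.solar ∧
    ∃ i, LoadAdjacent μ (D.load i) (D'.load i) ∧
      ∀ j, j ≠ i → D.load j = D'.load j ∧ D.target j = D'.target j

/-- `(ε, δ)`-differential privacy, with respect to the relation `adj`, of the randomized algorithm
whose output on the dataset `D` has the law `M D`. -/
def IsDifferentiallyPrivate {𝒟 𝒮 : Type*} [MeasurableSpace 𝒮] (adj : 𝒟 → 𝒟 → Prop)
    (M : 𝒟 → Measure 𝒮) (ε δ : ℝ) : Prop :=
  ∀ D D', adj D D' → ∀ A : Set 𝒮, MeasurableSet A →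
    (M D).real A ≤ Real.exp ε * (M D').real A + δ

/-! ### The training algorithm -/

/-- Clipping `g · min (1, C / ‖g‖)`; the zero gradient is left unchanged. -/
def clip {d : ℕ} (C : ℝ) (g : Params d) : Params d := min 1 (C / ‖g‖) • g

/-- The data of the algorithm other than the dataset: circuit, loss `loss θ ŷ y`, initial
parameters, batch size, learning rate, clipping norm and noise multiplier. -/
structure Config (n d m : ℕ) where
  circuit : VQC n d m
  loss : Params d → Output m → Output m → ℝ
  θ₀ : Params d
  batchSize : ℕ
  η : ℝ
  C : ℝ
  σ : ℝ

section

variable {N w s l d m : ℕ}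

/-- The gradient in `θ` of the loss of sample `i`. -/
def sampleGradient (A : Config (w + s + l) d m) (D : OPFDataset N w s l m) (i : Fin N)
    (θ : Params d) : Params d :=
  gradient (fun θ => A.loss θ (A.circuit.predict θ (D.input i)) (D.target i)) θ

/-- One round, with the batch `S` and the noise `z`:
`θ - η · (1 / B) (∑ i ∈ S, clip g_i + z)`. -/
def update (A : Config (w + s + l) d m) (D : OPFDataset N w s l m) (θ : Params d)
    (S : Finset (Fin N)) (z : Params d) : Params d :=
  θ - A.η • ((1 / (A.batchSize : ℝ)) • (∑ i ∈ S, clip A.C (sampleGradient A D i θ) + z))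

/-- The noise law `𝒩(0, σ² C² I)`. -/
def noiseLaw (A : Config (w + s + l) d m) : Measure (Params d) :=
  (stdGaussian (Params d)).map (fun z => (A.σ * A.C) • z)

/-- A batch drawn uniformly from the `B`-element subsets of the `N` samples. -/
def batchLaw (N B : ℕ) : Measure (Finset (Fin N)) :=
  uniformOn {S | S.card = B}

/-- The law of the iterates `θ_0, …, θ_T` of `T` rounds, each with a fresh batch and fresh noise,
independent of each other and of the past. -/
def trajectoryLaw (A : Config (w + s + l) d m) (D : OPFDataset N w s l m) :
    (T : ℕ) → Measure (Fin (T + 1) → Params d)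
  | 0 => Measure.dirac fun _ => A.θ₀
  | T + 1 =>
      ((trajectoryLaw A D T).prod ((batchLaw N A.batchSize).prod (noiseLaw A))).map
        fun p => Fin.snoc p.1 (update A D (p.1 (Fin.last T)) p.2.1 p.2.2)

/-- The law of the trained parameters `θ_T`. -/
def trainedLaw (A : Config (w + s + l) d m) (D : OPFDataset N w s l m) (T : ℕ) :
    Measure (Params d) :=
  (trajectoryLaw A D T).map fun h => h (Fin.last T)

/-! The pushforwards above are along measurable maps, so that all laws are probability measures. -/

theorem measurable_clip (C : ℝ) : Measurable (clip C : Params d → Params d) := by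
  unfold clip
  fun_prop

theorem measurable_sampleGradient (A : Config (w + s + l) d m) (D : OPFDataset N w s l m)
    (i : Fin N) : Measurable (sampleGradient A D i) := by
  unfold sampleGradient gradient
  exact (InnerProductSpace.toDual ℝ (Params d)).symm.continuous.measurable.comp
    (measurable_fderiv ℝ _)

theorem measurable_update (A : Config (w + s + l) d m) (D : OPFDataset N w s l m) :
    Measurable fun p : Params d × Finset (Fin N) × Params d => update A D p.1 p.2.1 p.2.2 := by
  have h : Measurable fun q : (Params d × Params d) × Finset (Fin N) =>
      update A D q.1.1 q.2 q.1.2 := by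
    refine measurable_from_prod_countable_left fun S => ?_
    have hg : ∀ i, Measurable fun q : Params d × Params d =>
        clip A.C (sampleGradient A D i q.1) := fun i =>
      (measurable_clip A.C).comp ((measurable_sampleGradient A D i).comp measurable_fst)
    have hs : Measurable fun q : Params d × Params d =>
        ∑ i ∈ S, clip A.C (sampleGradient A D i q.1) := Finset.measurable_sum S fun i _ => hg i
    have hz : Measurable fun q : Params d × Params d => q.2 := measurable_snd
    have h1 : Measurable fun q : Params d × Params d => A.η • ((1 / (A.batchSize : ℝ)) •
        (∑ i ∈ S, clip A.C (sampleGradient A D i q.1) + q.2)) :=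
      ((hs.add hz).const_smul (1 / (A.batchSize : ℝ))).const_smul A.η
    exact measurable_fst.sub h1
  exact h.comp ((measurable_fst.prodMk measurable_snd.snd).prodMk measurable_snd.fst)

instance isProbabilityMeasure_noiseLaw (A : Config (w + s + l) d m) :
    IsProbabilityMeasure (noiseLaw A) :=
  Measure.isProbabilityMeasure_map (by fun_prop)

theorem isProbabilityMeasure_batchLaw {B : ℕ} (hB : B ≤ N) :
    IsProbabilityMeasure (batchLaw N B) := by
  refine isProbabilityMeasure_uniformOn (Set.toFinite _) ?_
  obtain ⟨S, -, hS⟩ := Finset.exists_subset_card_eq (s := (Finset.univ : Finset (Fin N)))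
    (n := B) (by simpa using hB)
  exact ⟨S, hS⟩

theorem isProbabilityMeasure_trajectoryLaw (A : Config (w + s + l) d m)
    (D : OPFDataset N w s l m) (hB : A.batchSize ≤ N) (T : ℕ) :
    IsProbabilityMeasure (trajectoryLaw A D T) := by
  induction T with
  | zero => unfold trajectoryLaw; infer_instance
  | succ T ih =>
    have := isProbabilityMeasure_batchLaw hB
    unfold trajectoryLaw
    refine Measure.isProbabilityMeasure_map (Measurable.aemeasurable ?_)
    refine measurable_pi_lambda _ fun j => ?_
    refine Fin.lastCases ?_ (fun j => ?_) j
    · simp only [Fin.snoc_last]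
      have h1 : Measurable fun p : (Fin (T + 1) → Params d) × Finset (Fin N) × Params d =>
          (p.1 (Fin.last T), p.2) :=
        ((measurable_pi_apply (Fin.last T)).comp measurable_fst).prodMk measurable_snd
      exact (measurable_update A D).comp h1
    · simp only [Fin.snoc_castSucc]
      exact (measurable_pi_apply j).comp measurable_fst

end

end PrivateVQC

end

noncomputable section

namespace PrivateVQC

/-! ### Composition -/

section Composition

variable {X Y W : Type*} [MeasurableSpace X] [MeasurableSpace Y] [MeasurableSpace W]

/-! Put q = B/N and g = qε. Let P and Q be the trajectory laws for two adjacent datasets, σ' = √(2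
ln(1/δ')/T) and S = σ' + e^g - 1. The claim follows from P(A) ≤ e^(TgS) Q(A) + Tgδ + e^(-Tσ'²/2);
about S, only S ≥ σ' + g + g²/2 is used (`trajectory_real_le`). The law of θ_T is an image of the
trajectory law.

One round: each batch containing the changed sample is paired with a batch in which that sample has
been exchanged for another one (`exists_swap_mixture`). Up to a common map, both round laws become
mixtures of Gaussians shifted by vectors a, b, c at mutual distance at most 2/σ: a against b with
weight q, and c on both sides with weight 1 - q (`exists_round_mixture`). The noise hypothesis gives
2/σ ≤ εr with δ = 0.11157 r². Two comparisons result. `round_hockey` bounds the round at every level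
1 + gt with error g times `hockeyMajorant`, a bound uniform in ε. `round_chi` bounds its χ²
divergence.

Composition: hockey-stick bounds at several levels say that the likelihood ratio of a round is
dominated by a finite law of atoms plus an additive error. Such laws multiply along the rounds
(`HockeyBound.step`), and so do second moments (`ChiBound.step`).

If the additive budget Tgδ + e^(-Tσ'²/2) exceeds one, there is nothing to prove; otherwise σ' is
bounded below (`sq_ge_of_exp_neg_lt`). Three regimes remain. For r ≤ 0.85 the χ² comparison
suffices. For larger r and T ≥ 16, five atoms dominate the ratio, and the second moment of their
product is used. For larger r and T < 16, three atoms suffice, and the hockey-stick value of their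
product is bounded by a finite computation over cells of (g, σ'). Both second-moment regimes end in
the scalar inequality `chi_bound_le`. -/

theorem measureReal_map_prod (P : Measure X) [IsProbabilityMeasure P] (ν : Measure W)
    [IsProbabilityMeasure ν] {G : X × W → Y} (hG : Measurable G) {A : Set Y}
    (hA : MeasurableSet A) :
    ((P.prod ν).map G).real A = ∫ x, ν.real ((fun w => G (x, w)) ⁻¹' A) ∂P := by
  rw [map_measureReal_apply hG hA, measureReal_def, Measure.prod_apply (hG hA), ← integral_toReal]
  · rfl
  · exact (measurable_measure_prodMk_left (hG hA)).aemeasurable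
  · exact Filter.Eventually.of_forall fun x => measure_lt_top _ _

theorem measurable_section_measureReal (ν : Measure W) [IsProbabilityMeasure ν] {G : X × W → Y}
    (hG : Measurable G) {A : Set Y} (hA : MeasurableSet A) :
    Measurable fun x => ν.real ((fun w => G (x, w)) ⁻¹' A) :=
  (measurable_measure_prodMk_left (ν := ν) (hG hA)).ennreal_toReal

/-- `z P(A) - K Q(A) ≤ F z` for all events `A` and all `z ≥ 0`. -/
def HockeyBound (K : ℝ) (P Q : Measure X) (F : ℝ → ℝ) : Prop :=
  ∀ z, 0 ≤ z → ∀ A, MeasurableSet A → z * P.real A - K * Q.real A ≤ F z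

/-- The positive part is attained on the event where z dP/dμ ≥ K dQ/dμ, and the bound is applied to
that event. -/
theorem integral_max_le_of_hockeyBound {K z : ℝ} {P Q μ : Measure X} {F : ℝ → ℝ}
    [IsProbabilityMeasure P] [IsProbabilityMeasure Q] [IsFiniteMeasure μ]
    (hP : P ≪ μ) (hQ : Q ≪ μ) (h : HockeyBound K P Q F) (hz : 0 ≤ z) :
    ∫ x, max (z * (P.rnDeriv μ x).toReal - K * (Q.rnDeriv μ x).toReal) 0 ∂μ ≤ F z := by
  set p := fun x => (P.rnDeriv μ x).toReal with hp
  set q := fun x => (Q.rnDeriv μ x).toReal with hq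
  have mp : Measurable p := (Measure.measurable_rnDeriv P μ).ennreal_toReal
  have mq : Measurable q := (Measure.measurable_rnDeriv Q μ).ennreal_toReal
  have ip : Integrable p μ := Measure.integrable_toReal_rnDeriv
  have iq : Integrable q μ := Measure.integrable_toReal_rnDeriv
  have mS : MeasurableSet {x | 0 ≤ z * p x - K * q x} :=
    measurableSet_le measurable_const ((mp.const_mul z).sub (mq.const_mul K))
  have e : (fun x => max (z * p x - K * q x) 0)
      = Set.indicator {x | 0 ≤ z * p x - K * q x} (fun x => z * p x - K * q x) := by
    funext x
    by_cases hx : 0 ≤ z * p x - K * q x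
    · rw [Set.indicator_of_mem (by exact hx), max_eq_left hx]
    · rw [Set.indicator_of_notMem (by exact hx), max_eq_right (not_le.1 hx).le]
  change ∫ x, max (z * p x - K * q x) 0 ∂μ ≤ F z
  rw [e, integral_indicator mS, integral_sub (ip.const_mul z).integrableOn
    (iq.const_mul K).integrableOn, integral_const_mul, integral_const_mul,
    Measure.setIntegral_toReal_rnDeriv hP, Measure.setIntegral_toReal_rnDeriv hQ]
  exact h z hz _ mS

/-- The pair (p, w) acts as the law under the second measure of a likelihood ratio dominating that
of the new round, and c as an extra additive error. Conditionally on the past, the level y may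
depend on the point, so the current density ratio can be absorbed into it. -/
theorem HockeyBound.step {K c : ℝ} (hK : 0 ≤ K) {ι : Type*} [Fintype ι]
    (p w : ι → ℝ) (hp : ∀ j, 0 ≤ p j) (hw : ∀ j, 0 ≤ w j)
    {P Q : Measure X} [IsProbabilityMeasure P] [IsProbabilityMeasure Q] {F : ℝ → ℝ}
    (h : HockeyBound K P Q F) (ν : Measure W) [IsProbabilityMeasure ν] {G G' : X × W → Y}
    (hG : Measurable G) (hG' : Measurable G')
    (hstep : ∀ x, ∀ A, MeasurableSet A → ∀ y, 0 ≤ y →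
      ν.real ((fun w => G (x, w)) ⁻¹' A) ≤ y * ν.real ((fun w => G' (x, w)) ⁻¹' A)
        + (∑ j, p j * max (w j - y) 0 + c)) :
    HockeyBound K ((P.prod ν).map G) ((Q.prod ν).map G')
      (fun z => ∑ j, p j * F (z * w j) + c * z) := by
  intro z hz A hA
  rw [measureReal_map_prod P ν hG hA, measureReal_map_prod Q ν hG' hA]
  set a := fun x => ν.real ((fun w => G (x, w)) ⁻¹' A) with ha
  set b := fun x => ν.real ((fun w => G' (x, w)) ⁻¹' A) with hb
  have ma : Measurable a := measurable_section_measureReal ν hG hA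
  have mb : Measurable b := measurable_section_measureReal ν hG' hA
  have hP : P ≪ P + Q := Measure.AbsolutelyContinuous.rfl.add_right Q
  have hQ : Q ≪ P + Q := by
    rw [add_comm]; exact Measure.AbsolutelyContinuous.rfl.add_right P
  set μ := P + Q with hμ
  set f := fun x => (P.rnDeriv μ x).toReal with hf
  set g := fun x => (Q.rnDeriv μ x).toReal with hg
  have f0 : ∀ x, 0 ≤ f x := fun x => ENNReal.toReal_nonneg
  have g0 : ∀ x, 0 ≤ g x := fun x => ENNReal.toReal_nonneg
  have i_f : Integrable f μ := Measure.integrable_toReal_rnDeriv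
  have i_g : Integrable g μ := Measure.integrable_toReal_rnDeriv
  have a1 : ∀ x, ‖a x‖ ≤ 1 := fun x => by
    rw [Real.norm_of_nonneg measureReal_nonneg]; exact measureReal_le_one
  have b1 : ∀ x, ‖b x‖ ≤ 1 := fun x => by
    rw [Real.norm_of_nonneg measureReal_nonneg]; exact measureReal_le_one
  have i_fa : Integrable (fun x => f x * a x) μ :=
    i_f.mul_bdd (c := 1) ma.aestronglyMeasurable (Filter.Eventually.of_forall a1)
  have i_gb : Integrable (fun x => g x * b x) μ :=
    i_g.mul_bdd (c := 1) mb.aestronglyMeasurable (Filter.Eventually.of_forall b1)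
  have eP : ∫ x, a x ∂P = ∫ x, f x * a x ∂μ := (integral_rnDeriv_smul hP).symm
  have eQ : ∫ x, b x ∂Q = ∫ x, g x * b x ∂μ := (integral_rnDeriv_smul hQ).symm
  have e1 : ∫ x, f x ∂μ = 1 := by
    rw [hf, Measure.integral_toReal_rnDeriv hP]; simp
  rw [eP, eQ, ← integral_const_mul, ← integral_const_mul, ← integral_sub (i_fa.const_mul z)
    (i_gb.const_mul K)]
  have i_max : ∀ j, Integrable (fun x => p j * max (z * w j * f x - K * g x) 0) μ := fun j =>
    ((((i_f.const_mul (z * w j)).sub (i_g.const_mul K)).sup (integrable_zero _ _ _))).const_mul _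
  calc ∫ x, (z * (f x * a x) - K * (g x * b x)) ∂μ
      ≤ ∫ x, (∑ j, p j * max (z * w j * f x - K * g x) 0 + c * z * f x) ∂μ := by
        refine integral_mono ((i_fa.const_mul z).sub (i_gb.const_mul K))
          ((integrable_finsetSum _ fun j _ => i_max j).add (i_f.const_mul _)) fun x => ?_
        have b0 : 0 ≤ b x := measureReal_nonneg
        rcases (mul_nonneg hz (f0 x)).eq_or_lt with h0 | h0
        · have hr : 0 ≤ ∑ j, p j * max (z * w j * f x - K * g x) 0 :=
            Finset.sum_nonneg fun j _ => mul_nonneg (hp j) (le_max_right _ _)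
          have e0 : z * (f x * a x) = 0 := by rw [← mul_assoc, ← h0, zero_mul]
          have e2 : c * z * f x = 0 := by rw [mul_assoc, ← h0, mul_zero]
          have : 0 ≤ K * (g x * b x) := mul_nonneg hK (mul_nonneg (g0 x) b0)
          simp only [e0, e2]; linarith
        -- At this level, multiplication by z f turns y into K g and each (w_j - y)₊ into (z w_j f -
        -- K g)₊, an integrand to which the bound for the past applies with z w_j in place of z.
        · have hy := hstep x A hA (K * g x / (z * f x))
            (div_nonneg (mul_nonneg hK (g0 x)) h0.le)
          have := mul_le_mul_of_nonneg_left hy h0.le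
          have e3 : z * f x * (K * g x / (z * f x) * b x + (∑ j, p j * max (w j -
              K * g x / (z * f x)) 0 + c)) = K * (g x * b x)
              + ∑ j, p j * max (z * w j * f x - K * g x) 0 + c * z * f x := by
            have e4 : ∀ j, z * f x * (p j * max (w j - K * g x / (z * f x)) 0)
                = p j * max (z * w j * f x - K * g x) 0 := fun j => by
              rw [mul_left_comm, mul_max_of_nonneg _ _ h0.le, mul_zero, mul_sub,
                mul_div_cancel₀ _ h0.ne']
              ring_nf
            rw [mul_add, mul_add, Finset.mul_sum, Finset.sum_congr rfl fun j _ => e4 j,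
              ← mul_assoc, mul_div_cancel₀ _ h0.ne']
            ring
          have e5 : z * (f x * a x) = z * f x * a x := by ring
          change z * f x * a x ≤ _ at this
          simp only [e5]
          linarith
    _ = ∑ j, p j * ∫ x, max (z * w j * f x - K * g x) 0 ∂μ + c * z := by
        rw [integral_add (integrable_finsetSum _ fun j _ => i_max j) (i_f.const_mul _),
          integral_finsetSum _ fun j _ => i_max j, integral_const_mul, e1, mul_one]
        simp only [integral_const_mul]
    _ ≤ ∑ j, p j * F (z * w j) + c * z := by
        gcongr with j
        · exact hp j
        · exact integral_max_le_of_hockeyBound hP hQ h (mul_nonneg hz (hw j))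

/-- `χ²`-type comparison in dual form: `(∫ f dP)² ≤ M ∫ f² dQ` for bounded measurable `f`. -/
def ChiBound (P Q : Measure X) (M : ℝ) : Prop :=
  ∀ f : X → ℝ, Measurable f → (∃ b, ∀ x, |f x| ≤ b) → (∫ x, f x ∂P) ^ 2 ≤ M * ∫ x, f x ^ 2 ∂Q

/-- The dual form tensorizes by Fubini alone: the conditional mean of f is itself a bounded test
function for the past, and its square is bounded pointwise by the one-round inequality. -/
theorem ChiBound.step {M M₁ : ℝ} (hM : 0 ≤ M) {P Q : Measure X}
    [IsProbabilityMeasure P] [IsProbabilityMeasure Q] (h : ChiBound P Q M)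
    (ν : Measure W) [IsProbabilityMeasure ν] {G G' : X × W → Y}
    (hG : Measurable G) (hG' : Measurable G')
    (hstep : ∀ x, ∀ f : Y → ℝ, Measurable f → (∃ b, ∀ y, |f y| ≤ b) →
      (∫ w, f (G (x, w)) ∂ν) ^ 2 ≤ M₁ * ∫ w, f (G' (x, w)) ^ 2 ∂ν) :
    ChiBound ((P.prod ν).map G) ((Q.prod ν).map G') (M * M₁) := by
  rintro f hf ⟨b, hb⟩
  have hb2 : ∀ y, |f y ^ 2| ≤ b ^ 2 := fun y => by
    rw [abs_pow]; exact pow_le_pow_left₀ (abs_nonneg _) (hb y) 2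
  have i1 : Integrable (fun p => f (G p)) (P.prod ν) :=
    Integrable.of_bound (hf.comp hG).aestronglyMeasurable b
      (Filter.Eventually.of_forall fun x => hb _)
  have i2 : Integrable (fun p => f (G' p) ^ 2) (Q.prod ν) :=
    Integrable.of_bound ((hf.comp hG').pow_const 2).aestronglyMeasurable (b ^ 2)
      (Filter.Eventually.of_forall fun x => hb2 _)
  rw [integral_map hG.aemeasurable hf.aestronglyMeasurable,
    integral_map hG'.aemeasurable (hf.pow_const 2).aestronglyMeasurable,
    integral_prod _ i1, integral_prod _ i2]
  have m1 : Measurable fun x => ∫ w, f (G (x, w)) ∂ν :=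
    ((hf.comp hG).stronglyMeasurable.integral_prod_right' (ν := ν)).measurable
  have bd : ∀ x, |∫ w, f (G (x, w)) ∂ν| ≤ b := fun x => by
    have := norm_integral_le_of_norm_le_const (μ := ν) (f := fun w => f (G (x, w)))
      (Filter.Eventually.of_forall fun w => hb _)
    simpa using this
  refine (h _ m1 ⟨b, bd⟩).trans ?_
  rw [mul_assoc]
  refine mul_le_mul_of_nonneg_left ?_ hM
  rw [← integral_const_mul]
  refine integral_mono ?_ (i2.integral_prod_left.const_mul _) fun x => hstep x f hf ⟨b, hb⟩
  exact Integrable.of_bound (m1.pow_const 2).aestronglyMeasurable (b ^ 2)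
    (Filter.Eventually.of_forall fun x => by
      rw [Real.norm_eq_abs, abs_pow]; exact pow_le_pow_left₀ (abs_nonneg _) (bd x) 2)

/-- Testing with the indicator minus a constant t and letting t vary, the discriminant yields (p -
q)² ≤ (M - 1) q. Then p - Kq ≤ √((M - 1) q) - (K - 1) q, whose maximum over q is the error term. -/
theorem ChiBound.measureReal_le {M K : ℝ} (hM : 1 ≤ M) (hK : 1 < K) {P Q : Measure X}
    [IsProbabilityMeasure P] [IsProbabilityMeasure Q] (h : ChiBound P Q M) {A : Set X}
    (hA : MeasurableSet A) : P.real A ≤ K * Q.real A + (M - 1) / (4 * (K - 1)) := by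
  set p := P.real A
  set q := Q.real A
  have key : ∀ t : ℝ, (p - t) ^ 2 ≤ M * (q - 2 * t * q + t ^ 2) := fun t => by
    have i : ∀ (R : Measure X) [IsProbabilityMeasure R],
        Integrable (A.indicator (fun _ => (1 : ℝ))) R := fun R _ =>
      (integrable_const (1 : ℝ)).indicator hA
    have := h (fun x => A.indicator (fun _ => (1 : ℝ)) x - t)
      ((measurable_const.indicator hA).sub_const t) ⟨1 + |t|, fun x => by
        refine (abs_sub _ _).trans ?_
        gcongr
        by_cases hx : x ∈ A <;> simp [hx]⟩
    have e : ∀ x, (A.indicator (fun _ => (1 : ℝ)) x - t) ^ 2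
        = (1 - 2 * t) * A.indicator (fun _ => (1 : ℝ)) x + t ^ 2 := fun x => by
      by_cases hx : x ∈ A
      · simp [hx]; ring
      · simp [hx]
    simp only [e] at this
    have iA : ∀ (κ : Measure X) [IsProbabilityMeasure κ],
        (∫ x, (A.indicator (fun _ => (1 : ℝ)) x) ∂κ) = κ.real A := fun κ _ => integral_indicator_one
            hA
    rw [integral_sub (i P) (integrable_const t), integral_add ((i Q).const_mul _)
      (integrable_const _), integral_const_mul, iA, iA] at this
    simp only [integral_const, probReal_univ, smul_eq_mul, one_mul] at this
    calc (p - t) ^ 2 ≤ _ := this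
      _ = _ := by ring
  have q0 : 0 ≤ q := measureReal_nonneg
  have d := discrim_le_zero (a := M - 1) (b := -2 * (M * q - p)) (c := M * q - p ^ 2)
    fun t => by nlinarith [key t]
  have k0 : 0 < K - 1 := by linarith
  have M1 : 0 ≤ M - 1 := by linarith
  rw [discrim] at d
  have hM0 : 0 < M := by linarith
  have d2 : (p - q) ^ 2 ≤ (M - 1) * q := by
    have d3 : M * (p - q) ^ 2 ≤ M * ((M - 1) * q) := by nlinarith [mul_nonneg M1 (sq_nonneg q)]
    exact le_of_mul_le_mul_left d3 hM0
  have : 4 * (K - 1) * (p - K * q) ≤ M - 1 := by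
    rcases q0.eq_or_lt with h0 | h0
    · rw [← h0] at d2 ⊢
      have : p - 0 = 0 := by nlinarith [sq_nonneg (p - 0)]
      simp only [sub_zero] at this
      rw [this]; simpa using M1
    · refine le_of_mul_le_mul_left ?_ h0
      nlinarith [sq_nonneg ((p - q) - 2 * (K - 1) * q)]
  have h4 : p - K * q ≤ (M - 1) / (4 * (K - 1)) := by
    rw [le_div_iff₀ (by positivity)]; linarith
  linarith

end Composition

/-! ### Shifts of the standard Gaussian measure -/

section GaussianShift

open scoped RealInnerProductSpace

variable {E : Type*} [NormedAddCommGroup E] [InnerProductSpace ℝ E]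

/-- The density of the standard Gaussian shifted by `u`, relative to the unshifted one. -/
def shiftDensity (u z : E) : ℝ := Real.exp (⟪z, u⟫ - ‖u‖ ^ 2 / 2)

theorem continuous_shiftDensity (u : E) : Continuous (shiftDensity u) := by
  unfold shiftDensity; fun_prop

theorem shiftDensity_mul (u v z : E) :
    shiftDensity u z * shiftDensity v z = Real.exp ⟪u, v⟫ * shiftDensity (u + v) z := by
  simp only [shiftDensity]
  rw [← Real.exp_add, ← Real.exp_add, norm_add_sq_real, inner_add_right]
  congr 1
  ring

variable [FiniteDimensional ℝ E] [MeasurableSpace E] [BorelSpace E]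

/-- Both sides are finite measures with the same characteristic function. The normalizing constant
is left implicit since it cancels in `integral_comp_add_stdGaussian`. -/
theorem stdGaussian_eq_withDensity :
    ∃ c : ℝ, 0 < c ∧ stdGaussian E
      = volume.withDensity fun x : E => ENNReal.ofReal (c * Real.exp (-(1 / 2) * ‖x‖ ^ 2)) := by
  have hI := GaussianFourier.integral_rexp_neg_mul_sq_norm (V := E) (b := 1 / 2) (by norm_num)
  set I : ℝ := ∫ v : E, Real.exp (-(1 / 2) * ‖v‖ ^ 2) with hI'
  have hI0 : 0 < I := by rw [hI]; positivity
  have hc : 0 < I⁻¹ := inv_pos.2 hI0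
  have hint : Integrable fun v : E => Real.exp (-(1 / 2) * ‖v‖ ^ 2) := by
    by_contra h
    exact hI0.ne' (integral_undef h)
  have hm : Measurable fun x : E => ENNReal.ofReal (I⁻¹ * Real.exp (-(1 / 2) * ‖x‖ ^ 2)) := by
    fun_prop
  refine ⟨I⁻¹, hc, ?_⟩
  have : IsFiniteMeasure ((volume : Measure E).withDensity
      fun x : E => ENNReal.ofReal (I⁻¹ * Real.exp (-(1 / 2) * ‖x‖ ^ 2))) :=
    isFiniteMeasure_withDensity_ofReal (hint.const_mul _).2
  refine Measure.ext_of_charFun ?_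
  funext t
  rw [charFun_stdGaussian, charFun_apply, integral_withDensity_eq_integral_toReal_smul hm
    (Filter.Eventually.of_forall fun x => ENNReal.ofReal_lt_top)]
  have h1 := GaussianFourier.integral_cexp_neg_mul_sq_norm_add (V := E) (b := 1 / 2)
    (by norm_num) Complex.I t
  have h2 : ((I : ℝ) : ℂ) = (Real.pi / (1 / 2 : ℂ)) ^ (Module.finrank ℝ E / 2 : ℂ) := by
    rw [hI, Complex.ofReal_cpow (by positivity)]
    push_cast
    rfl
  rw [← h2] at h1
  have h3 : ∀ x : E, (ENNReal.ofReal (I⁻¹ * Real.exp (-(1 / 2) * ‖x‖ ^ 2))).toReal •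
      Complex.exp (⟪x, t⟫ * Complex.I)
      = (I : ℂ)⁻¹ * Complex.exp (-(1 / 2) * ‖x‖ ^ 2 + Complex.I * ⟪t, x⟫) := fun x => by
    rw [ENNReal.toReal_ofReal (by positivity), Complex.real_smul, Complex.exp_add,
      real_inner_comm]
    push_cast
    ring_nf
  simp_rw [h3]
  rw [integral_const_mul, h1, ← mul_assoc, inv_mul_cancel₀ (by exact_mod_cast hI0.ne'), one_mul]
  congr 1
  rw [Complex.I_sq]; ring

theorem integral_comp_add_stdGaussian (f : E → ℝ) (u : E) :
    ∫ z, f (z + u) ∂stdGaussian E = ∫ z, shiftDensity u z * f z ∂stdGaussian E := by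
  obtain ⟨c, hc, h⟩ := stdGaussian_eq_withDensity (E := E)
  have hm : Measurable fun x : E => ENNReal.ofReal (c * Real.exp (-(1 / 2) * ‖x‖ ^ 2)) := by
    fun_prop
  rw [h, integral_withDensity_eq_integral_toReal_smul hm
    (Filter.Eventually.of_forall fun x => ENNReal.ofReal_lt_top),
    integral_withDensity_eq_integral_toReal_smul hm
    (Filter.Eventually.of_forall fun x => ENNReal.ofReal_lt_top),
    ← integral_add_right_eq_self (μ := volume) (fun x => (ENNReal.ofReal (c * Real.exp
    (-(1 / 2) * ‖x‖ ^ 2))).toReal • (shiftDensity u x * f x)) u]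
  refine integral_congr_ae (Filter.Eventually.of_forall fun x => ?_)
  simp only [smul_eq_mul, shiftDensity]
  rw [ENNReal.toReal_ofReal (by positivity), ENNReal.toReal_ofReal (by positivity), ← mul_assoc,
    mul_assoc c (Real.exp _) (Real.exp _), ← Real.exp_add]
  congr 3
  rw [norm_add_sq_real, inner_add_left, real_inner_self_eq_norm_sq]
  ring

theorem integral_shiftDensity (u : E) : ∫ z, shiftDensity u z ∂stdGaussian E = 1 := by
  have := integral_comp_add_stdGaussian (fun _ : E => (1 : ℝ)) u
  simpa using this.symm

theorem integrable_shiftDensity (u : E) : Integrable (shiftDensity u) (stdGaussian E) := by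
  by_contra h
  have := integral_shiftDensity u
  rw [integral_undef h] at this
  exact zero_ne_one this

theorem integrable_shiftDensity_mul (u v : E) :
    Integrable (fun z => shiftDensity u z * shiftDensity v z) (stdGaussian E) := by
  simp_rw [shiftDensity_mul]
  exact (integrable_shiftDensity _).const_mul _

theorem integral_shiftDensity_mul (u v : E) :
    ∫ z, shiftDensity u z * shiftDensity v z ∂stdGaussian E = Real.exp ⟪u, v⟫ := by
  simp_rw [shiftDensity_mul]
  rw [integral_const_mul, integral_shiftDensity, mul_one]

theorem sq_integral_mul_le {X : Type*} [MeasurableSpace X] {μ : Measure X} {f g : X → ℝ}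
    (hf : Integrable (fun x => f x ^ 2) μ) (hg : Integrable (fun x => g x ^ 2) μ)
    (hfg : Integrable (fun x => f x * g x) μ) :
    (∫ x, f x * g x ∂μ) ^ 2 ≤ (∫ x, f x ^ 2 ∂μ) * ∫ x, g x ^ 2 ∂μ := by
  have h : ∀ t : ℝ, 0 ≤ (∫ x, f x ^ 2 ∂μ) * (t * t) + (2 * ∫ x, f x * g x ∂μ) * t
      + ∫ x, g x ^ 2 ∂μ := fun t => by
    have : 0 ≤ ∫ x, (t * f x + g x) ^ 2 ∂μ := integral_nonneg fun x => sq_nonneg _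
    have e : ∀ x, (t * f x + g x) ^ 2 = t * t * f x ^ 2 + 2 * t * (f x * g x) + g x ^ 2 :=
      fun x => by ring
    simp_rw [e] at this
    have i1 : Integrable (fun x => t * t * f x ^ 2 + 2 * t * (f x * g x)) μ :=
      (hf.const_mul _).add (hfg.const_mul _)
    rw [integral_add i1 hg, integral_add (hf.const_mul _) (hfg.const_mul _), integral_const_mul,
      integral_const_mul] at this
    linarith
  have := discrim_le_zero h
  rw [discrim] at this
  linarith

/-- Squared difference of two shifted Gaussian means, against the mean at a third shift. -/
theorem sq_integral_shift_sub_le {f : E → ℝ} (hf : Measurable f) (hb : ∃ C, ∀ x, |f x| ≤ C)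
    (a b c : E) :
    ((∫ z, f (a + z) ∂stdGaussian E) - ∫ z, f (b + z) ∂stdGaussian E) ^ 2
      ≤ (Real.exp (‖a - c‖ ^ 2) + Real.exp (‖b - c‖ ^ 2) - 2 * Real.exp ⟪a - c, b - c⟫)
        * ∫ z, f (c + z) ^ 2 ∂stdGaussian E := by
  obtain ⟨C, hC⟩ := hb
  have e : ∀ u : E, ∫ z, f (u + z) ∂stdGaussian E
      = ∫ z, shiftDensity (u - c) z * f (c + z) ∂stdGaussian E := fun u => by
    rw [← integral_comp_add_stdGaussian (fun z => f (c + z))]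
    refine integral_congr_ae (Filter.Eventually.of_forall fun x => ?_)
    simp only
    congr 1
    abel
  have mf : Measurable fun z => f (c + z) := hf.comp (measurable_const_add c)
  have i1 : ∀ u : E, Integrable (fun z => shiftDensity u z * f (c + z)) (stdGaussian E) :=
    fun u => (integrable_shiftDensity u).mul_bdd (c := C) mf.aestronglyMeasurable
      (Filter.Eventually.of_forall fun x => hC _)
  have e2 : ∀ z, (shiftDensity (a - c) z - shiftDensity (b - c) z) ^ 2
      = shiftDensity (a - c) z * shiftDensity (a - c) z
        + shiftDensity (b - c) z * shiftDensity (b - c) z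
        - 2 * (shiftDensity (a - c) z * shiftDensity (b - c) z) := fun z => by ring
  have i4 : Integrable (fun z => shiftDensity (a - c) z * shiftDensity (a - c) z
      + shiftDensity (b - c) z * shiftDensity (b - c) z) (stdGaussian E) :=
    (integrable_shiftDensity_mul (a - c) (a - c)).add
      (integrable_shiftDensity_mul (b - c) (b - c))
  have i2 := ((integrable_shiftDensity_mul (a - c) (a - c)).add
    (integrable_shiftDensity_mul (b - c) (b - c))).sub
    ((integrable_shiftDensity_mul (a - c) (b - c)).const_mul 2)
  have i3 : Integrable (fun z => f (c + z) ^ 2) (stdGaussian E) :=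
    Integrable.of_bound (mf.pow_const 2).aestronglyMeasurable (C ^ 2)
      (Filter.Eventually.of_forall fun x => by
        rw [Real.norm_eq_abs, abs_pow]; exact pow_le_pow_left₀ (abs_nonneg _) (hC _) 2)
  have := sq_integral_mul_le (μ := stdGaussian E)
    (f := fun z => shiftDensity (a - c) z - shiftDensity (b - c) z) (g := fun z => f (c + z))
    (by simp_rw [e2]; exact i2) i3 (by simp only [sub_mul]; exact (i1 (a - c)).sub (i1 (b - c)))
  simp only [sub_mul] at this
  rw [integral_sub (i1 _) (i1 _), ← e, ← e] at this
  refine this.trans (le_of_eq ?_)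
  congr 1
  simp_rw [e2]
  rw [integral_sub i4
    ((integrable_shiftDensity_mul (a - c) (b - c)).const_mul 2), integral_add
    (integrable_shiftDensity_mul (a - c) (a - c)) (integrable_shiftDensity_mul (b - c) (b - c)),
    integral_const_mul, integral_shiftDensity_mul, integral_shiftDensity_mul,
    integral_shiftDensity_mul, real_inner_self_eq_norm_sq, real_inner_self_eq_norm_sq]

/-! ### Tails -/

/-- The density of the standard normal distribution. -/
def normalDensity (x : ℝ) : ℝ := (Real.sqrt (2 * Real.pi))⁻¹ * Real.exp (-(x ^ 2) / 2)

theorem continuous_normalDensity : Continuous normalDensity := by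
  unfold normalDensity; fun_prop

theorem normalDensity_pos (x : ℝ) : 0 < normalDensity x := by
  unfold normalDensity; positivity

theorem normalDensity_eq (x : ℝ) : normalDensity x = gaussianPDFReal 0 1 x := by
  simp [normalDensity, gaussianPDFReal]

/-- The odd primitive of the density of the standard normal distribution. -/
def normalIntegral (x : ℝ) : ℝ := ∫ t in (0 : ℝ)..x, normalDensity t

theorem hasDerivAt_normalIntegral (x : ℝ) : HasDerivAt normalIntegral (normalDensity x) x :=
  intervalIntegral.integral_hasDerivAt_right (continuous_normalDensity.intervalIntegrable _ _)
    (continuous_normalDensity.stronglyMeasurableAtFilter _ _) continuous_normalDensity.continuousAt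

theorem gaussianReal_real_Ioi (x : ℝ) :
    (gaussianReal 0 1).real (Set.Ioi x) = 1 / 2 - normalIntegral x := by
  have hi : Integrable normalDensity := by
    simp_rw [funext normalDensity_eq]; exact integrable_gaussianPDFReal 0 1
  have h0 : ∫ t in Set.Ioi (0 : ℝ), normalDensity t = 1 / 2 := by
    have := integral_gaussian_Ioi (1 / 2)
    unfold normalDensity
    rw [integral_const_mul]
    have e : ∀ t : ℝ, Real.exp (-(t ^ 2) / 2) = Real.exp (-(1 / 2) * t ^ 2) := fun t => by
      congr 1; ring
    simp_rw [e]
    rw [this]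
    have : Real.sqrt (Real.pi / (1 / 2)) = Real.sqrt (2 * Real.pi) := by congr 1; ring
    rw [this]
    have : Real.sqrt (2 * Real.pi) ≠ 0 := by positivity
    field_simp
  have h1 : (gaussianReal 0 1).real (Set.Ioi x) = ∫ t in Set.Ioi x, normalDensity t := by
    rw [measureReal_def, gaussianReal_apply_eq_integral _ (by norm_num),
      ENNReal.toReal_ofReal (integral_nonneg fun t => gaussianPDFReal_nonneg _ _ _)]
    simp_rw [normalDensity_eq]
  rw [h1, ← h0, normalIntegral, ← intervalIntegral.integral_Ioi_sub_Ioi' hi.integrableOn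
    hi.integrableOn]
  ring

theorem stdGaussian_real_inner_gt {v : E} (hv : v ≠ 0) (c : ℝ) :
    (stdGaussian E).real {z | c < ⟪z, v⟫} = 1 / 2 - normalIntegral (c / ‖v‖) := by
  have hn : 0 < ‖v‖ := norm_pos_iff.2 hv
  set L : StrongDual ℝ E := innerSL ℝ (‖v‖⁻¹ • v) with hL
  have h := IsGaussian.map_eq_gaussianReal (μ := stdGaussian E) L
  have hLn : ‖L‖ = 1 := by
    rw [hL, innerSL_apply_norm, norm_smul, norm_inv, norm_norm, inv_mul_cancel₀ hn.ne']
  rw [integral_strongDual_stdGaussian, variance_dual_stdGaussian, hLn] at h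
  simp only [one_pow, Real.toNNReal_one] at h
  rw [← gaussianReal_real_Ioi, ← h, map_measureReal_apply L.continuous.measurable
    measurableSet_Ioi]
  congr 1
  ext z
  simp only [Set.mem_ofPred_eq, Set.mem_preimage, Set.mem_Ioi, hL, innerSL_apply_apply,
    real_inner_smul_left]
  rw [real_inner_comm, div_lt_iff₀ hn, mul_comm, ← mul_assoc, mul_inv_cancel₀ hn.ne', one_mul]

/-- The maximum of `P(A) - e^L Q(A)` for normal distributions `P`, `Q` at distance `ρ`. -/
def gaussianHockey (L ρ : ℝ) : ℝ :=
  1 / 2 - normalIntegral (L / ρ - ρ / 2) - Real.exp L * (1 / 2 - normalIntegral (L / ρ + ρ / 2))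

/-- Neyman–Pearson: after translation by b, the difference is the integral over an event of the
shift density minus e^L. It is largest on the half-space where the integrand is positive, and
half-spaces have explicit normal probabilities. -/
theorem stdGaussian_shift_le {a b : E} (hab : a ≠ b) (L : ℝ) {A : Set E} (hA : MeasurableSet A) :
    (stdGaussian E).real {z | a + z ∈ A} ≤ Real.exp L * (stdGaussian E).real {z | b + z ∈ A}
      + gaussianHockey L ‖a - b‖ := by
  set v := a - b with hv
  have hv0 : v ≠ 0 := sub_ne_zero.2 hab
  have hn : 0 < ‖v‖ := norm_pos_iff.2 hv0
  set γ := stdGaussian E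
  have key : ∀ S : Set E, MeasurableSet S →
      γ.real {z | z + v ∈ S} - Real.exp L * γ.real S
        = ∫ z, S.indicator (fun z => shiftDensity v z - Real.exp L) z ∂γ := fun S hS => by
    have mS : MeasurableSet {z | z + v ∈ S} := (measurable_add_const v) hS
    rw [← integral_indicator_one mS, ← integral_indicator_one hS]
    have e1 : ∫ z, Set.indicator {z | z + v ∈ S} 1 z ∂γ
        = ∫ z, (S.indicator 1 (z + v) : ℝ) ∂γ := by
      refine integral_congr_ae (Filter.Eventually.of_forall fun x => ?_)
      by_cases hx : x + v ∈ S <;> simp [hx]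
    rw [e1, integral_comp_add_stdGaussian (fun z => (S.indicator 1 z : ℝ)) v,
      ← integral_const_mul, ← integral_sub]
    · refine integral_congr_ae (Filter.Eventually.of_forall fun x => ?_)
      by_cases hx : x ∈ S <;> simp [hx]
    · refine ((integrable_shiftDensity v).indicator hS).congr
        (Filter.Eventually.of_forall fun x => ?_)
      by_cases hx : x ∈ S <;> simp [hx]
    · exact ((integrable_const (1 : ℝ)).indicator hS).const_mul _
  have mA : MeasurableSet {z | b + z ∈ A} := (measurable_const_add b) hA
  have hS : {z : E | ‖v‖ ^ 2 / 2 + L < ⟪z, v⟫} = {z | Real.exp L < shiftDensity v z} := by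
    ext z
    simp only [Set.mem_ofPred_eq, shiftDensity, Real.exp_lt_exp]
    constructor <;> intro h <;> linarith
  have mS : MeasurableSet {z | Real.exp L < shiftDensity v z} :=
    measurableSet_lt measurable_const (continuous_shiftDensity v).measurable
  have k1 := key _ mA
  have k2 := key _ mS
  have hle : ∫ z, {z | b + z ∈ A}.indicator (fun z => shiftDensity v z - Real.exp L) z ∂γ
      ≤ ∫ z, {z | Real.exp L < shiftDensity v z}.indicator
        (fun z => shiftDensity v z - Real.exp L) z ∂γ := by
    have i := (integrable_shiftDensity v).sub (integrable_const (μ := γ) (Real.exp L))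
    refine integral_mono (i.indicator mA) (i.indicator mS) fun z => ?_
    by_cases h1 : Real.exp L < shiftDensity v z
    · rw [Set.indicator_of_mem (s := {z | Real.exp L < shiftDensity v z}) (by exact h1)]
      by_cases h2 : z ∈ {z | b + z ∈ A}
      · rw [Set.indicator_of_mem h2]
      · rw [Set.indicator_of_notMem h2]; exact sub_nonneg.2 h1.le
    · rw [Set.indicator_of_notMem (s := {z | Real.exp L < shiftDensity v z}) (by exact h1)]
      by_cases h2 : z ∈ {z | b + z ∈ A}
      · rw [Set.indicator_of_mem h2]; exact sub_nonpos.2 (not_lt.1 h1)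
      · rw [Set.indicator_of_notMem h2]
  rw [← k1, ← k2, ← hS] at hle
  have e3 : {z | z + v ∈ {z | b + z ∈ A}} = {z | a + z ∈ A} := by
    ext z
    simp only [Set.mem_ofPred_eq, hv]
    rw [show b + (z + (a - b)) = a + z by abel]
  have e4 : {z | z + v ∈ {z : E | ‖v‖ ^ 2 / 2 + L < ⟪z, v⟫}} = {z | L - ‖v‖ ^ 2 / 2 < ⟪z, v⟫} := by
    ext z
    simp only [Set.mem_ofPred_eq, inner_add_left, real_inner_self_eq_norm_sq]
    constructor <;> intro h <;> linarith
  rw [e3, e4, stdGaussian_real_inner_gt hv0, stdGaussian_real_inner_gt hv0] at hle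
  have e5 : (L - ‖v‖ ^ 2 / 2) / ‖v‖ = L / ‖v‖ - ‖v‖ / 2 := by field_simp
  have e6 : (‖v‖ ^ 2 / 2 + L) / ‖v‖ = L / ‖v‖ + ‖v‖ / 2 := by field_simp; ring
  rw [e5, e6] at hle
  rw [gaussianHockey]
  linarith

end GaussianShift

/-! ### A convex majorant of the Gaussian hockey-stick divergence, uniform in ε -/

section HockeyMajorant

theorem normalDensity_le_of_sq_le {x y : ℝ} (h : y ^ 2 ≤ x ^ 2) :
    normalDensity x ≤ normalDensity y := by
  unfold normalDensity
  gcongr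

theorem normalDensity_le_zero (x : ℝ) : normalDensity x ≤ normalDensity 0 :=
  normalDensity_le_of_sq_le (by nlinarith [sq_nonneg x])

theorem normalDensity_mono_min {x y : ℝ} (h : x ≤ y) :
    normalDensity x ≤ normalDensity (min y 0) := by
  rcases le_total y 0 with hy | hy
  · rw [min_eq_left hy]
    exact normalDensity_le_of_sq_le (by nlinarith)
  · rw [min_eq_right hy]
    exact normalDensity_le_zero x

theorem normalIntegral_le_half (x : ℝ) : normalIntegral x ≤ 1 / 2 := by
  have := gaussianReal_real_Ioi x
  have h0 : 0 ≤ (gaussianReal 0 1).real (Set.Ioi x) := measureReal_nonneg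
  linarith

theorem normalIntegral_sub_le {x y : ℝ} (h : x ≤ y) :
    normalIntegral y - normalIntegral x ≤ (y - x) * normalDensity 0 := by
  have i : ∀ a b, IntervalIntegrable normalDensity volume a b :=
    fun a b => continuous_normalDensity.intervalIntegrable a b
  unfold normalIntegral
  rw [intervalIntegral.integral_interval_sub_left (i _ _) (i _ _)]
  calc ∫ t in x..y, normalDensity t ≤ ∫ _ in x..y, normalDensity 0 :=
        intervalIntegral.integral_mono_on h (i _ _) (by simp) fun t _ => normalDensity_le_zero t
    _ = _ := by simp

/-- The integrand of `hockeyMajorant`. -/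
def hockeySlope (ℓ u : ℝ) : ℝ := normalDensity (min (u / 2 - ℓ / u) 0)

/-- A majorant of `gaussianHockey ℓ`, exact up to `√(2 ℓ)` and affine from there on. -/
def hockeyMajorant (ℓ r : ℝ) : ℝ := ∫ u in (0 : ℝ)..r, hockeySlope ℓ u

theorem hockeySlope_pos (ℓ u : ℝ) : 0 < hockeySlope ℓ u := normalDensity_pos _

theorem hockeySlope_le (ℓ u : ℝ) : hockeySlope ℓ u ≤ normalDensity 0 := normalDensity_le_zero _

theorem measurable_hockeySlope (ℓ : ℝ) : Measurable (hockeySlope ℓ) :=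
  continuous_normalDensity.measurable.comp (by fun_prop)

theorem intervalIntegrable_hockeySlope (ℓ a b : ℝ) :
    IntervalIntegrable (hockeySlope ℓ) volume a b := by
  refine (intervalIntegrable_const (c := normalDensity 0)).mono_fun
    (measurable_hockeySlope ℓ).aestronglyMeasurable (Filter.Eventually.of_forall fun u => ?_)
  simp only [Real.norm_of_nonneg (hockeySlope_pos ℓ u).le, Real.norm_of_nonneg
    (normalDensity_pos 0).le]
  exact hockeySlope_le ℓ u

/-- Truncation of the argument at 0 is what makes the slope monotone: u/2 - ℓ/u increases, but the
normal density increases only up to 0. Convexity of the majorant, used through chords, rests on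
this. -/
theorem hockeySlope_mono {ℓ u v : ℝ} (hℓ : 0 ≤ ℓ) (hu : 0 < u) (h : u ≤ v) :
    hockeySlope ℓ u ≤ hockeySlope ℓ v := by
  have h1 : ℓ / v ≤ ℓ / u := div_le_div_of_nonneg_left hℓ hu h
  have h2 : u / 2 - ℓ / u ≤ v / 2 - ℓ / v := by linarith
  refine normalDensity_le_of_sq_le ?_
  have := min_le_min_right 0 h2
  have h3 : min (v / 2 - ℓ / v) 0 ≤ 0 := min_le_right _ _
  nlinarith

theorem hockeyMajorant_sub (ℓ a b : ℝ) :
    hockeyMajorant ℓ b - hockeyMajorant ℓ a = ∫ u in a..b, hockeySlope ℓ u :=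
  intervalIntegral.integral_interval_sub_left (intervalIntegrable_hockeySlope _ _ _)
    (intervalIntegrable_hockeySlope _ _ _)

theorem hockeyMajorant_mono {ℓ a b : ℝ} (h : a ≤ b) :
    hockeyMajorant ℓ a ≤ hockeyMajorant ℓ b := by
  rw [← sub_nonneg, hockeyMajorant_sub]
  exact intervalIntegral.integral_nonneg h fun u _ => (hockeySlope_pos ℓ u).le

theorem hockeyMajorant_nonneg {ℓ r : ℝ} (h : 0 ≤ r) : 0 ≤ hockeyMajorant ℓ r := by
  have := hockeyMajorant_mono (ℓ := ℓ) h
  rwa [hockeyMajorant, intervalIntegral.integral_same] at this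

theorem hockeyMajorant_le_add {ℓ a b : ℝ} (h : a ≤ b) :
    hockeyMajorant ℓ b ≤ hockeyMajorant ℓ a + (b - a) * normalDensity 0 := by
  rw [← sub_le_iff_le_add', hockeyMajorant_sub]
  calc ∫ u in a..b, hockeySlope ℓ u ≤ ∫ _ in a..b, normalDensity 0 :=
        intervalIntegral.integral_mono_on h (intervalIntegrable_hockeySlope _ _ _) (by simp)
          fun u _ => hockeySlope_le ℓ u
    _ = _ := by simp

theorem hockeyMajorant_le_mul {ℓ r : ℝ} (hr : 0 ≤ r) :
    hockeyMajorant ℓ r ≤ r * normalDensity 0 := by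
  have := hockeyMajorant_le_add (ℓ := ℓ) hr
  have h0 : hockeyMajorant ℓ 0 = 0 := intervalIntegral.integral_same
  rwa [h0, zero_add, sub_zero] at this

/-- Convexity: the chord is above the graph. -/
theorem hockeyMajorant_le_chord {ℓ a b r : ℝ} (hℓ : 0 ≤ ℓ) (ha : 0 < a) (har : a ≤ r)
    (hrb : r ≤ b) : (b - a) * hockeyMajorant ℓ r
      ≤ (b - r) * hockeyMajorant ℓ a + (r - a) * hockeyMajorant ℓ b := by
  have h1 : hockeyMajorant ℓ r - hockeyMajorant ℓ a ≤ (r - a) * hockeySlope ℓ r := by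
    rw [hockeyMajorant_sub]
    calc ∫ u in a..r, hockeySlope ℓ u ≤ ∫ _ in a..r, hockeySlope ℓ r :=
          intervalIntegral.integral_mono_on har (intervalIntegrable_hockeySlope _ _ _) (by simp)
            fun u hu => hockeySlope_mono hℓ (ha.trans_le hu.1) hu.2
      _ = _ := by simp
  have h2 : (b - r) * hockeySlope ℓ r ≤ hockeyMajorant ℓ b - hockeyMajorant ℓ r := by
    rw [hockeyMajorant_sub]
    calc (b - r) * hockeySlope ℓ r = ∫ _ in r..b, hockeySlope ℓ r := by simp
      _ ≤ ∫ u in r..b, hockeySlope ℓ u :=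
          intervalIntegral.integral_mono_on hrb (by simp) (intervalIntegrable_hockeySlope _ _ _)
            fun u hu => hockeySlope_mono hℓ (ha.trans_le har) hu.1
  nlinarith [mul_le_mul_of_nonneg_left h1 (sub_nonneg.2 hrb),
    mul_le_mul_of_nonneg_left h2 (sub_nonneg.2 har)]

theorem hasDerivAt_hockeyMajorant (ℓ : ℝ) {r : ℝ} (hr : 0 < r) :
    HasDerivAt (hockeyMajorant ℓ) (hockeySlope ℓ r) r := by
  refine intervalIntegral.integral_hasDerivAt_right (intervalIntegrable_hockeySlope _ _ _)
    (measurable_hockeySlope ℓ).stronglyMeasurable.stronglyMeasurableAtFilter ?_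
  refine continuous_normalDensity.continuousAt.comp ?_
  have : ContinuousAt (fun u : ℝ => u / 2 - ℓ / u) r :=
    (continuousAt_id.div_const 2).sub (continuousAt_const.div continuousAt_id hr.ne')
  exact this.min continuousAt_const

/-- The identity e^L φ(L/ρ + ρ/2) = φ(L/ρ - ρ/2) cancels the L/ρ² contributions of the two terms. -/
theorem hasDerivAt_gaussianHockey (L : ℝ) {ρ : ℝ} (hρ : 0 < ρ) :
    HasDerivAt (gaussianHockey L) (normalDensity (ρ / 2 - L / ρ)) ρ := by
  have d0 : HasDerivAt (fun x : ℝ => L / x) (-(L / ρ ^ 2)) ρ := by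
    have := (hasDerivAt_inv hρ.ne').const_mul L
    simpa [div_eq_mul_inv] using this
  have d1 : HasDerivAt (fun x : ℝ => L / x - x / 2) (-(L / ρ ^ 2) - 1 / 2) ρ :=
    d0.sub ((hasDerivAt_id ρ).div_const 2)
  have d2 : HasDerivAt (fun x : ℝ => L / x + x / 2) (-(L / ρ ^ 2) + 1 / 2) ρ :=
    d0.add ((hasDerivAt_id ρ).div_const 2)
  have e1 := (hasDerivAt_normalIntegral _).comp ρ d1
  have e2 := (hasDerivAt_normalIntegral _).comp ρ d2
  have := (e1.const_sub (1 / 2)).sub ((e2.const_sub (1 / 2)).const_mul (Real.exp L))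
  refine this.congr_deriv ?_
  have f1 : normalDensity (L / ρ - ρ / 2) = normalDensity (ρ / 2 - L / ρ) := by
    unfold normalDensity; congr 3; ring
  have f2 : Real.exp L * normalDensity (L / ρ + ρ / 2) = normalDensity (ρ / 2 - L / ρ) := by
    unfold normalDensity
    rw [mul_left_comm, ← Real.exp_add]
    congr 2
    field_simp
    ring
  rw [f1, mul_neg, ← mul_assoc, mul_comm, f2] 
  ring

theorem gaussianHockey_le {L ρ : ℝ} (hL : 0 ≤ L) (hρ : 0 ≤ ρ) :
    gaussianHockey L ρ ≤ ρ * normalDensity 0 := by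
  have h1 := normalIntegral_le_half (L / ρ + ρ / 2)
  have h2 := normalIntegral_sub_le (x := L / ρ - ρ / 2) (y := L / ρ + ρ / 2) (by linarith)
  have h3 := Real.one_le_exp hL
  unfold gaussianHockey
  nlinarith

theorem gaussianHockey_nonneg (L : ℝ) {ρ : ℝ} (hρ : 0 < ρ) : 0 ≤ gaussianHockey L ρ := by
  have := stdGaussian_shift_le (E := ℝ) (a := ρ) (b := 0) hρ.ne' L MeasurableSet.empty
  simpa [abs_of_pos hρ] using this

theorem mul_log_one_add_le {ε t : ℝ} (hε : 0 ≤ ε) (hε1 : ε ≤ 1) (ht : 0 ≤ t) :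
    ε * Real.log (1 + t) ≤ Real.log (1 + ε * t) := by
  rw [← Real.log_rpow (by linarith)]
  exact Real.log_le_log (by positivity) (rpow_one_add_le_one_add_mul_self (by linarith) hε hε1)

/-- Derivatives in r are compared. By Bernoulli, ε log(1 + t) ≤ log(1 + εt), so the argument of φ on
the left is at most r/2 - ℓ/r, and φ there is at most φ at the truncated argument. This removes ε
from all later numerical work. -/
theorem gaussianHockey_le_mul_hockeyMajorant {ε t r : ℝ} (hε : 0 < ε) (hε1 : ε ≤ 1) (ht : 0 ≤ t)
    (hr : 0 < r) : gaussianHockey (Real.log (1 + ε * t)) (ε * r)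
      ≤ ε * hockeyMajorant (Real.log (1 + t)) r := by
  set ℓ := Real.log (1 + t)
  set L := Real.log (1 + ε * t)
  have hL : 0 ≤ L := Real.log_nonneg (by nlinarith)
  have hd : ∀ x : ℝ, 0 < x → HasDerivAt
      (fun x => ε * hockeyMajorant ℓ x - gaussianHockey L (ε * x))
      (ε * hockeySlope ℓ x - normalDensity (ε * x / 2 - L / (ε * x)) * ε) x := fun x hx =>
    ((hasDerivAt_hockeyMajorant ℓ hx).const_mul ε).sub
      ((hasDerivAt_gaussianHockey L (mul_pos hε hx)).comp x
        (by simpa using (hasDerivAt_id x).const_mul ε))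
  have hmono : MonotoneOn (fun x => ε * hockeyMajorant ℓ x - gaussianHockey L (ε * x))
      (Set.Ioi 0) := by
    refine monotoneOn_of_hasDerivWithinAt_nonneg (convex_Ioi 0)
      (fun x hx => (hd x hx).continuousAt.continuousWithinAt)
      (fun x hx => (hd x (by simpa using hx)).hasDerivWithinAt) fun x hx => ?_
    have hx : 0 < x := by simpa using hx
    have h1 : ε * x / 2 ≤ x / 2 := by nlinarith
    have h2 : ℓ / x ≤ L / (ε * x) := by
      rw [div_le_div_iff₀ hx (mul_pos hε hx)]
      nlinarith [mul_log_one_add_le hε.le hε1 ht]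
    have := normalDensity_mono_min (x := ε * x / 2 - L / (ε * x)) (y := x / 2 - ℓ / x)
      (by linarith)
    rw [hockeySlope]
    nlinarith
  by_contra! hcon
  set D := gaussianHockey L (ε * r) - ε * hockeyMajorant ℓ r with hD
  have hD0 : 0 < D := sub_pos.2 hcon
  have hφ := normalDensity_pos 0
  -- Division by zero spoils `gaussianHockey` at 0, so the starting value of the monotone difference
  -- is replaced by a small x₀ where the left side is at most D/2.
  set x₀ := min r (D / (2 * ε * normalDensity 0)) with hx0
  have x0 : 0 < x₀ := lt_min hr (by positivity)
  have h1 := hmono (Set.mem_Ioi.2 x0) (Set.mem_Ioi.2 hr) (min_le_left _ _)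
  have h2 := gaussianHockey_le hL (mul_pos hε x0).le
  have h3 := hockeyMajorant_nonneg (ℓ := ℓ) x0.le
  have h4 : x₀ * (2 * ε * normalDensity 0) ≤ D := by
    rw [← le_div_iff₀ (by positivity)]; exact min_le_right _ _
  simp only at h1
  nlinarith [mul_nonneg hε.le h3]

/-- For r² ≤ 2ℓ the truncation in the slope is inactive, so both functions have the same derivative;
near 0 both are small. -/
theorem hockeyMajorant_le_gaussianHockey {ℓ r : ℝ} (hr : 0 < r) (h : r ^ 2 ≤ 2 * ℓ) :
    hockeyMajorant ℓ r ≤ gaussianHockey ℓ r := by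
  have hmono : MonotoneOn (fun x => gaussianHockey ℓ x - hockeyMajorant ℓ x) (Set.Ioc 0 r) := by
    refine monotoneOn_of_hasDerivWithinAt_nonneg (convex_Ioc 0 r)
      (fun x hx => ((hasDerivAt_gaussianHockey ℓ hx.1).sub
        (hasDerivAt_hockeyMajorant ℓ hx.1)).continuousAt.continuousWithinAt)
      (fun x hx => ((hasDerivAt_gaussianHockey ℓ (interior_subset hx).1).sub
        (hasDerivAt_hockeyMajorant ℓ (interior_subset hx).1)).hasDerivWithinAt) fun x hx => ?_
    have hx := interior_subset hx
    rw [hockeySlope, min_eq_left, sub_self]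
    rw [sub_nonpos, div_le_div_iff₀ two_pos hx.1]
    nlinarith [hx.1, hx.2]
  by_contra! hcon
  set D := hockeyMajorant ℓ r - gaussianHockey ℓ r with hD
  have hD0 : 0 < D := sub_pos.2 hcon
  have hφ := normalDensity_pos 0
  set x₀ := min r (D / (2 * normalDensity 0)) with hx0
  have x0 : 0 < x₀ := lt_min hr (by positivity)
  have h1 := hmono ⟨x0, min_le_left _ _⟩ ⟨hr, le_rfl⟩ (min_le_left _ _)
  have h2 := gaussianHockey_nonneg ℓ x0
  have h3 := hockeyMajorant_le_add (ℓ := ℓ) x0.le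
  have h4 : x₀ * (2 * normalDensity 0) ≤ D := by
    rw [← le_div_iff₀ (by positivity)]; exact min_le_right _ _
  have h5 : hockeyMajorant ℓ 0 = 0 := intervalIntegral.integral_same
  simp only at h1
  nlinarith

open scoped RealInnerProductSpace

variable {E : Type*} [NormedAddCommGroup E] [InnerProductSpace ℝ E] [FiniteDimensional ℝ E]
  [MeasurableSpace E] [BorelSpace E]

theorem stdGaussian_shift_le_hockeyMajorant {ε t r : ℝ} (hε : 0 < ε) (hε1 : ε ≤ 1) (ht : 0 ≤ t)
    (hr : 0 < r) {a b : E} (hab : ‖a - b‖ ≤ ε * r) {A : Set E} (hA : MeasurableSet A) :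
    (stdGaussian E).real {z | a + z ∈ A}
      ≤ (1 + ε * t) * (stdGaussian E).real {z | b + z ∈ A}
        + ε * hockeyMajorant (Real.log (1 + t)) r := by
  have hnn : 0 ≤ hockeyMajorant (Real.log (1 + t)) r := hockeyMajorant_nonneg hr.le
  have h0 : 0 ≤ (stdGaussian E).real {z | b + z ∈ A} := measureReal_nonneg
  rcases eq_or_ne a b with rfl | hne
  · nlinarith [mul_nonneg hε.le hnn, mul_nonneg (mul_nonneg hε.le ht) h0]
  · have hn : 0 < ‖a - b‖ := norm_pos_iff.2 (sub_ne_zero.2 hne)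
    have h1 := stdGaussian_shift_le hne (Real.log (1 + ε * t)) hA
    rw [Real.exp_log (by positivity)] at h1
    have h2 := gaussianHockey_le_mul_hockeyMajorant hε hε1 ht (div_pos hn hε)
    rw [mul_div_cancel₀ _ hε.ne'] at h2
    have h3 : hockeyMajorant (Real.log (1 + t)) (‖a - b‖ / ε)
        ≤ hockeyMajorant (Real.log (1 + t)) r :=
      hockeyMajorant_mono (by rw [div_le_iff₀ hε]; linarith)
    nlinarith

end HockeyMajorant

/-! ### Uniform batches -/

section Batches

variable {N B : ℕ}

/-- Exchanging i for j is a bijection from pairs (S, j) with i in S and j outside S to pairs (S', j)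
with j in S' and i outside S'; each S' has B choices of j. -/
theorem sum_swap (i : Fin N) (G : Finset (Fin N) → ℝ) :
    ∑ S ∈ (Finset.powersetCard B Finset.univ).filter (i ∈ ·), ∑ j ∈ Sᶜ,
        G (insert j (S.erase i))
      = B * ∑ S ∈ (Finset.powersetCard B Finset.univ).filter (i ∉ ·), G S := by
  have h : ∀ S ∈ (Finset.powersetCard B Finset.univ).filter (i ∉ ·), ∑ _j ∈ S, G S = B * G S := by
    intro S hS
    rw [Finset.sum_const, (Finset.mem_powersetCard.1 (Finset.mem_filter.1 hS).1).2, nsmul_eq_mul]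
  rw [Finset.mul_sum, ← Finset.sum_congr rfl h, Finset.sum_sigma', Finset.sum_sigma']
  refine Finset.sum_bij' (fun p _ => ⟨insert p.2 (p.1.erase i), p.2⟩)
    (fun p _ => ⟨insert i (p.1.erase p.2), p.2⟩) ?_ ?_ ?_ ?_ ?_
  · rintro ⟨S, j⟩ h
    simp only [Finset.mem_sigma, Finset.mem_filter, Finset.mem_powersetCard, Finset.subset_univ,
      true_and, Finset.mem_compl, Finset.mem_insert, Finset.mem_erase] at h ⊢
    obtain ⟨⟨hB, hi⟩, hj⟩ := h
    have : j ∉ S.erase i := fun h => hj (Finset.mem_of_mem_erase h)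
    have hp : 0 < S.card := Finset.card_pos.2 ⟨i, hi⟩
    have hij : i ≠ j := fun h => hj (h ▸ hi)
    refine ⟨⟨?_, ?_⟩, ?_⟩
    · rw [Finset.card_insert_of_notMem this, Finset.card_erase_of_mem hi]; omega
    · simp [hij]
    · simp
  · rintro ⟨S, j⟩ h
    simp only [Finset.mem_sigma, Finset.mem_filter, Finset.mem_powersetCard, Finset.subset_univ,
      true_and, Finset.mem_compl, Finset.mem_insert, Finset.mem_erase] at h ⊢
    obtain ⟨⟨hB, hi⟩, hj⟩ := h
    have : i ∉ S.erase j := fun h => hi (Finset.mem_of_mem_erase h)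
    have hp : 0 < S.card := Finset.card_pos.2 ⟨j, hj⟩
    have hij : j ≠ i := fun h => hi (h ▸ hj)
    refine ⟨⟨?_, ?_⟩, ?_⟩
    · rw [Finset.card_insert_of_notMem this, Finset.card_erase_of_mem hj]; omega
    · simp
    · simp [hij]
  · rintro ⟨S, j⟩ h
    simp only [Finset.mem_sigma, Finset.mem_filter, Finset.mem_compl] at h
    obtain ⟨⟨-, hi⟩, hj⟩ := h
    have : j ∉ S.erase i := fun h => hj (Finset.mem_of_mem_erase h)
    simp [Finset.erase_insert this, Finset.insert_erase hi]
  · rintro ⟨S, j⟩ h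
    simp only [Finset.mem_sigma, Finset.mem_filter] at h
    obtain ⟨⟨-, hi⟩, hj⟩ := h
    have : i ∉ S.erase j := fun h => hi (Finset.mem_of_mem_erase h)
    simp [Finset.erase_insert this, Finset.insert_erase hj]
  · rintro ⟨S, j⟩ h
    rfl

/-- A uniform batch is, on average over pairs `(S, S')` of batches that differ by the exchange of
`i`, equal to `S` with probability `B / N` and to `S'` otherwise. -/
theorem exists_swap_mixture (hB : 1 ≤ B) (hBN : B ≤ N) (i : Fin N) :
    ∃ (κ : Type) (_ : Fintype κ) (W : κ → ℝ) (S S' : κ → Finset (Fin N)),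
      (∀ k, 0 ≤ W k) ∧ ∑ k, W k = 1 ∧ (∀ k, i ∈ S k) ∧
      (∀ k, S' k = (S k).erase i ∨ ∃ j, j ∉ S k ∧ S' k = insert j ((S k).erase i)) ∧
      ∀ G : Finset (Fin N) → ℝ,
        (∑ T ∈ Finset.powersetCard B Finset.univ, G T) / (N.choose B : ℝ)
          = ∑ k, W k * ((B / N : ℝ) * G (S k) + (1 - B / N : ℝ) * G (S' k)) := by
  have hN0 : (N : ℝ) ≠ 0 := by
    have : 0 < N := by omega
    positivity
  rcases hBN.eq_or_lt with rfl | hlt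
  -- A full batch leaves nothing to exchange with; the second batch has weight 1 - B/N = 0, so its
  -- choice does not affect the mixture.
  · refine ⟨Unit, inferInstance, fun _ => 1, fun _ => Finset.univ, fun _ => Finset.univ.erase i,
      fun _ => zero_le_one, by simp, fun _ => Finset.mem_univ i, fun _ => Or.inl rfl, fun G => ?_⟩
    have : Finset.powersetCard B (Finset.univ : Finset (Fin B)) = {Finset.univ} := by
      have := Finset.powersetCard_self (Finset.univ : Finset (Fin B))
      rwa [Finset.card_univ, Fintype.card_fin] at this
    rw [this]
    simp [div_self hN0]
  · set F := Finset.powersetCard B (Finset.univ : Finset (Fin N)) with hF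
    set F₁ := F.filter (i ∈ ·) with hF₁
    set F₀ := F.filter (i ∉ ·) with hF₀
    have hsplit : ∀ G : Finset (Fin N) → ℝ, ∑ T ∈ F, G T = ∑ T ∈ F₁, G T + ∑ T ∈ F₀, G T :=
      fun G => (Finset.sum_filter_add_sum_filter_not F (i ∈ ·) G).symm
    have hin : ∀ G : Finset (Fin N) → ℝ, ∑ S ∈ F₁, ∑ _j ∈ Sᶜ, G S
        = ((N : ℝ) - B) * ∑ S ∈ F₁, G S := fun G => by
      rw [Finset.mul_sum]
      refine Finset.sum_congr rfl fun S hS => ?_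
      rw [Finset.sum_const, Finset.card_compl, Fintype.card_fin,
        (Finset.mem_powersetCard.1 (Finset.mem_filter.1 hS).1).2, nsmul_eq_mul,
        Nat.cast_sub hBN]
    have hcount : (N : ℝ) * (F₁.card : ℝ) = B * (N.choose B : ℝ) := by
      have h1 := sum_swap (B := B) i (fun _ => (1 : ℝ))
      have h2 := hin fun _ => 1
      have h3 := hsplit fun _ => 1
      have h4 : F.card = N.choose B := by simp [hF]
      simp only [← hF, ← hF₁, ← hF₀] at h1
      rw [h2] at h1
      simp only [Finset.sum_const, nsmul_eq_mul, mul_one, h4] at h1 h3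
      nlinarith
    have hNB : (0 : ℝ) < (N : ℝ) - B := by
      have : (B : ℝ) < N := by exact_mod_cast hlt
      linarith
    have hc : (0 : ℝ) < N.choose B := by
      have := Nat.choose_pos hBN
      positivity
    have hB0 : (0 : ℝ) < B := by positivity
    have hF1 : (0 : ℝ) < F₁.card := by
      have : 0 < (N : ℝ) * F₁.card := by rw [hcount]; positivity
      have hN : (0 : ℝ) < N := by linarith
      exact pos_of_mul_pos_right this hN.le
    have hw : 0 < (F₁.card : ℝ) * ((N : ℝ) - B) := by positivity
    have hsum : ∀ H : (Σ _ : Finset (Fin N), Fin N) → ℝ,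
        ∑ k : ↥(F₁.sigma fun S => Sᶜ), H k = ∑ S ∈ F₁, ∑ j ∈ Sᶜ, H ⟨S, j⟩ := fun H => by
      rw [Finset.sum_coe_sort (F₁.sigma fun S => Sᶜ) H, Finset.sum_sigma]
    refine ⟨↥(F₁.sigma fun S => Sᶜ), inferInstance, fun _ => ((F₁.card : ℝ) * ((N : ℝ) - B))⁻¹,
      fun k => k.1.1, fun k => insert k.1.2 (k.1.1.erase i), fun _ => (inv_pos.2 hw).le, ?_, ?_, ?_,
      fun G => ?_⟩
    · rw [hsum fun _ => ((F₁.card : ℝ) * ((N : ℝ) - B))⁻¹, hin, Finset.sum_const, nsmul_eq_mul]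
      field_simp
    · rintro ⟨⟨S, j⟩, h⟩
      exact (Finset.mem_filter.1 (Finset.mem_sigma.1 h).1).2
    · rintro ⟨⟨S, j⟩, h⟩
      exact Or.inr ⟨j, Finset.mem_compl.1 (Finset.mem_sigma.1 h).2, rfl⟩
    · rw [hsum fun k => ((F₁.card : ℝ) * ((N : ℝ) - B))⁻¹
        * ((B / N : ℝ) * G k.1 + (1 - B / N : ℝ) * G (insert k.2 (k.1.erase i)))]
      have hmul : ∀ (x : ℝ) (f : Finset (Fin N) → Fin N → ℝ),
          ∑ S ∈ F₁, ∑ j ∈ Sᶜ, x * f S j = x * ∑ S ∈ F₁, ∑ j ∈ Sᶜ, f S j := fun x f => by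
        simp only [Finset.mul_sum]
      rw [hmul]
      have hadd : ∀ f g : Finset (Fin N) → Fin N → ℝ, ∑ S ∈ F₁, ∑ j ∈ Sᶜ, (f S j + g S j)
          = ∑ S ∈ F₁, ∑ j ∈ Sᶜ, f S j + ∑ S ∈ F₁, ∑ j ∈ Sᶜ, g S j := fun f g => by
        rw [← Finset.sum_add_distrib]
        exact Finset.sum_congr rfl fun S _ => Finset.sum_add_distrib
      rw [hadd, hmul (B / N) (fun S _ => G S), hmul (1 - B / N) (fun S j => G
          (insert j (S.erase i)))]
      have h1 := sum_swap (B := B) i G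
      simp only [← hF, ← hF₁, ← hF₀] at h1
      have h2 := hin G
      rw [h1, h2, hsplit]
      have hch : (N.choose B : ℝ) = N * F₁.card / B := by rw [hcount]; field_simp
      rw [hch, one_sub_div hN0]
      have alg : ∀ a₁ a₀ n b f : ℝ, n ≠ 0 → b ≠ 0 → f ≠ 0 → n - b ≠ 0 →
          (a₁ + a₀) / (n * f / b)
            = (f * (n - b))⁻¹ * (b / n * ((n - b) * a₁) + (n - b) / n * (b * a₀)) := by
        intro a₁ a₀ n b f hn hb hf hnb
        field_simp
      exact alg _ _ _ _ _ hN0 hB0.ne' hF1.ne' hNB.ne'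

theorem integral_batchLaw (hBN : B ≤ N) (G : Finset (Fin N) → ℝ) :
    ∫ S, G S ∂batchLaw N B
      = (∑ T ∈ Finset.powersetCard B Finset.univ, G T) / (N.choose B : ℝ) := by
  have := isProbabilityMeasure_batchLaw hBN
  have hs : {S : Finset (Fin N) | S.card = B} = ↑(Finset.powersetCard B
      (Finset.univ : Finset (Fin N))) := by
    ext S; simp
  rw [integral_fintype (Integrable.of_finite)]
  have h : ∀ S, (batchLaw N B).real {S}
      = if S ∈ Finset.powersetCard B (Finset.univ : Finset (Fin N)) then (N.choose B : ℝ)⁻¹ else 0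
          := by
    intro S
    rw [measureReal_def, batchLaw, hs, ← Finset.coe_singleton, uniformOn_apply_finset,
      Finset.card_powersetCard, Finset.card_univ, Fintype.card_fin]
    split_ifs with h
    · rw [Finset.inter_singleton_of_mem h]; simp
    · rw [Finset.inter_singleton_of_notMem h]; simp
  simp only [h, smul_eq_mul, ite_mul, zero_mul]
  rw [Finset.sum_ite_mem, Finset.univ_inter, ← Finset.mul_sum]
  ring

end Batches

/-! ### One round -/

section Round

variable {N w s l d m : ℕ}

theorem norm_clip_le {C : ℝ} (hC : 0 < C) (g : Params d) : ‖clip C g‖ ≤ C := by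
  unfold clip
  have h0 : 0 ≤ min 1 (C / ‖g‖) := le_min zero_le_one (by positivity)
  rw [norm_smul, Real.norm_of_nonneg h0]
  rcases (norm_nonneg g).eq_or_lt with h | h
  · rw [← h, mul_zero]; exact hC.le
  · calc min 1 (C / ‖g‖) * ‖g‖ ≤ C / ‖g‖ * ‖g‖ := by gcongr; exact min_le_right _ _
      _ = C := div_mul_cancel₀ _ h.ne'

theorem integral_round (A : Config (w + s + l) d m) (D : OPFDataset N w s l m)
    (hBN : A.batchSize ≤ N) (θ : Params d) {f : Params d → ℝ} (hf : Measurable f)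
    (hb : ∃ C, ∀ x, |f x| ≤ C) :
    ∫ p, f (update A D θ p.1 p.2) ∂(batchLaw N A.batchSize).prod (noiseLaw A)
      = (∑ S ∈ Finset.powersetCard A.batchSize Finset.univ,
          ∫ z, f (update A D θ S ((A.σ * A.C) • z)) ∂stdGaussian (Params d))
        / (N.choose A.batchSize : ℝ) := by
  have := isProbabilityMeasure_batchLaw hBN
  obtain ⟨C, hC⟩ := hb
  have hm : Measurable fun p : Finset (Fin N) × Params d => f (update A D θ p.1 p.2) :=
    hf.comp ((measurable_update A D).comp (measurable_const.prodMk measurable_id))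
  rw [integral_prod _ (Integrable.of_bound hm.aestronglyMeasurable C
    (Filter.Eventually.of_forall fun p => hC _)), integral_batchLaw hBN]
  congr 1
  refine Finset.sum_congr rfl fun S _ => ?_
  rw [noiseLaw, integral_map (by fun_prop)]
  exact (hm.comp measurable_prodMk_left).aestronglyMeasurable

/-- Laws of one round on adjacent datasets, from the same parameters, are mixtures of shifts of one
Gaussian law, with the same components except for a share `B / N`. -/
theorem exists_round_mixture (A : Config (w + s + l) d m) (hB : 1 ≤ A.batchSize)
    (hBN : A.batchSize ≤ N) (hC : 0 < A.C) (hσ : 0 < A.σ) {μ : ℝ} {D D' : OPFDataset N w s l m}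
    (hadj : OPFDataset.Adjacent μ D D') (θ : Params d) :
    ∃ (κ : Type) (_ : Fintype κ) (W : κ → ℝ) (a b c : κ → Params d) (ψ : Params d → Params d),
      Measurable ψ ∧ (∀ k, 0 ≤ W k) ∧ ∑ k, W k = 1 ∧
      (∀ k, ‖a k - b k‖ ≤ 2 / A.σ ∧ ‖a k - c k‖ ≤ 2 / A.σ ∧ ‖b k - c k‖ ≤ 2 / A.σ) ∧
      (∀ f : Params d → ℝ, Measurable f → (∃ C, ∀ x, |f x| ≤ C) →
        ∫ p, f (update A D θ p.1 p.2) ∂(batchLaw N A.batchSize).prod (noiseLaw A)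
          = ∑ k, W k * ((A.batchSize / N : ℝ) * ∫ z, f (ψ (a k + z)) ∂stdGaussian (Params d)
            + (1 - A.batchSize / N : ℝ) * ∫ z, f (ψ (c k + z)) ∂stdGaussian (Params d))) ∧
      (∀ f : Params d → ℝ, Measurable f → (∃ C, ∀ x, |f x| ≤ C) →
        ∫ p, f (update A D' θ p.1 p.2) ∂(batchLaw N A.batchSize).prod (noiseLaw A)
          = ∑ k, W k * ((A.batchSize / N : ℝ) * ∫ z, f (ψ (b k + z)) ∂stdGaussian (Params d)
            + (1 - A.batchSize / N : ℝ) * ∫ z, f (ψ (c k + z)) ∂stdGaussian (Params d))) := by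
  obtain ⟨hw, hs, i, -, hi⟩ := hadj
  obtain ⟨κ, hκ, W, S, S', hW0, hW1, hiS, hS', hG⟩ := exists_swap_mixture hB hBN i
  set g : OPFDataset N w s l m → Fin N → Params d := fun D j => clip A.C (sampleGradient A D j θ)
    with hg
  have hgn : ∀ D j, ‖g D j‖ ≤ A.C := fun D j => norm_clip_le hC _
  have hgj : ∀ j, j ≠ i → g D j = g D' j := fun j hj => by
    have h1 : D.input j = D'.input j := by
      rw [OPFDataset.input, OPFDataset.input, hw, hs, (hi j hj).1]
    simp only [hg, sampleGradient, h1, (hi j hj).2]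
  have hσC : 0 < A.σ * A.C := mul_pos hσ hC
  set u : OPFDataset N w s l m → Finset (Fin N) → Params d :=
    fun D T => (A.σ * A.C)⁻¹ • ∑ j ∈ T, g D j with hu
  have hψ : ∀ D T z, update A D θ T ((A.σ * A.C) • z)
      = θ - A.η • ((1 / (A.batchSize : ℝ)) • ((A.σ * A.C) • (u D T + z))) := fun D T z => by
    simp only [update, hu, hg, smul_add, smul_inv_smul₀ hσC.ne']
  have hscale : ∀ x : Params d, ‖x‖ ≤ 2 * A.C → ‖(A.σ * A.C)⁻¹ • x‖ ≤ 2 / A.σ := fun x hx => by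
    rw [norm_smul, Real.norm_of_nonneg (inv_pos.2 hσC).le]
    calc (A.σ * A.C)⁻¹ * ‖x‖ ≤ (A.σ * A.C)⁻¹ * (2 * A.C) := by gcongr
      _ = 2 / A.σ := by field_simp
  have htwo : ∀ x y : Params d, ‖x‖ ≤ A.C → ‖y‖ ≤ A.C → ‖x - y‖ ≤ 2 * A.C := fun x y hx hy =>
    (norm_sub_le x y).trans (by linarith)
  have hin : ∀ E T, i ∈ T → ∑ j ∈ T, g E j = g E i + ∑ j ∈ T.erase i, g E j := fun E T hT =>
    (Finset.add_sum_erase T (g E) hT).symm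
  have hout : ∀ T, i ∉ T → ∑ j ∈ T, g D j = ∑ j ∈ T, g D' j := fun T hT =>
    Finset.sum_congr rfl fun j hj => hgj j fun h => hT (h ▸ hj)
  have herase : ∀ T : Finset (Fin N), i ∉ T.erase i := fun T => Finset.notMem_erase i T
  have hiS' : ∀ k, i ∉ S' k := fun k => by
    rcases hS' k with h | ⟨j, hj, h⟩
    · rw [h]; exact herase _
    · rw [h, Finset.mem_insert, not_or]
      exact ⟨fun h => hj (h ▸ hiS k), herase _⟩
  have hdist : ∀ E : OPFDataset N w s l m, (∀ j, j ≠ i → g E j = g D j) → ∀ k,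
      ‖u E (S k) - u D (S' k)‖ ≤ 2 / A.σ := fun E hE k => by
    simp only [hu]
    rw [← smul_sub]
    refine hscale _ ?_
    have h1 : ∑ j ∈ (S k).erase i, g E j = ∑ j ∈ (S k).erase i, g D j :=
      Finset.sum_congr rfl fun j hj => hE j (Finset.ne_of_mem_erase hj)
    rw [hin E _ (hiS k), h1]
    rcases hS' k with h | ⟨j, hj, h⟩
    · rw [h, add_sub_cancel_right]
      linarith [hgn E i]
    · rw [h, Finset.sum_insert fun h => hj (Finset.mem_of_mem_erase h), add_sub_add_right_eq_sub]
      exact htwo _ _ (hgn _ _) (hgn _ _)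
  have hmain : ∀ E : OPFDataset N w s l m, (∀ k, u E (S' k) = u D (S' k)) →
      ∀ f : Params d → ℝ, Measurable f → (∃ C, ∀ x, |f x| ≤ C) →
        ∫ p, f (update A E θ p.1 p.2) ∂(batchLaw N A.batchSize).prod (noiseLaw A)
          = ∑ k, W k * ((A.batchSize / N : ℝ) * ∫ z, f (θ - A.η • ((1 / (A.batchSize : ℝ)) •
              ((A.σ * A.C) • (u E (S k) + z)))) ∂stdGaussian (Params d)
            + (1 - A.batchSize / N : ℝ) * ∫ z, f (θ - A.η • ((1 / (A.batchSize : ℝ)) •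
              ((A.σ * A.C) • (u D (S' k) + z)))) ∂stdGaussian (Params d)) :=
    fun E hE f hf hb => by
      rw [integral_round A E hBN θ hf hb, hG]
      simp only [hψ, hE]
  refine ⟨κ, hκ, W, fun k => u D (S k), fun k => u D' (S k), fun k => u D (S' k),
    fun y => θ - A.η • ((1 / (A.batchSize : ℝ)) • ((A.σ * A.C) • y)), by fun_prop, hW0, hW1,
    fun k => ⟨?_, hdist D (fun _ _ => rfl) k, hdist D' (fun j hj => (hgj j hj).symm) k⟩,
    hmain D fun _ => rfl, hmain D' fun k => ?_⟩
  · simp only [hu]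
    rw [← smul_sub]
    refine hscale _ ?_
    rw [hin D _ (hiS k), hin D' _ (hiS k), hout _ (herase _), add_sub_add_right_eq_sub]
    exact htwo _ _ (hgn _ _) (hgn _ _)
  · simp only [hu]
    rw [hout _ (hiS' k)]

theorem OPFDataset.Adjacent.symm {μ : ℝ} {D D' : OPFDataset N w s l m}
    (h : OPFDataset.Adjacent μ D D') : OPFDataset.Adjacent μ D' D := by
  obtain ⟨hw, hs, i, ⟨k, hk, hk'⟩, hi⟩ := h
  exact ⟨hw.symm, hs.symm, i, ⟨k, by rwa [abs_sub_comm], fun j hj => (hk' j hj).symm⟩,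
    fun j hj => ⟨(hi j hj).1.symm, (hi j hj).2.symm⟩⟩

/-- Amplification by subsampling. With τ = εt, the component a is compared with both b and c, and
the two bounds are averaged so that the excess factor 1 + τ on the component of weight q becomes 1 +
qτ on the whole mixture. -/
theorem round_hockey (A : Config (w + s + l) d m) (hB : 1 ≤ A.batchSize)
    (hBN : A.batchSize ≤ N) (hC : 0 < A.C) (hσ : 0 < A.σ) {μ : ℝ} {D D' : OPFDataset N w s l m}
    (hadj : OPFDataset.Adjacent μ D D') (θ : Params d) {ε r t : ℝ} (hε : 0 < ε) (hε1 : ε ≤ 1)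
    (ht : 0 ≤ t) (hr : 0 < r) (hr' : 2 / A.σ ≤ ε * r) {X : Set (Params d)}
    (hX : MeasurableSet X) :
    ((batchLaw N A.batchSize).prod (noiseLaw A)).real {p | update A D θ p.1 p.2 ∈ X}
      ≤ (1 + A.batchSize / N * ε * t)
          * ((batchLaw N A.batchSize).prod (noiseLaw A)).real {p | update A D' θ p.1 p.2 ∈ X}
        + A.batchSize / N * ε * hockeyMajorant (Real.log (1 + t)) r := by
  obtain ⟨κ, _, W, a, b, c, ψ, hψ, hW0, hW1, hd, hP, hQ⟩ :=
    exists_round_mixture A hB hBN hC hσ hadj θ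
  have hmeas : ∀ E : OPFDataset N w s l m, Measurable
      fun p : Finset (Fin N) × Params d => update A E θ p.1 p.2 := fun E =>
    (measurable_update A E).comp (measurable_const.prodMk measurable_id)
  have hbd : ∃ C, ∀ x, |X.indicator (1 : Params d → ℝ) x| ≤ C := ⟨1, fun x => by
    by_cases hx : x ∈ X <;> simp [hx]⟩
  have hreal : ∀ E : OPFDataset N w s l m, ((batchLaw N A.batchSize).prod (noiseLaw A)).real
      {p | update A E θ p.1 p.2 ∈ X} = ∫ p, X.indicator (1 : Params d → ℝ)
        (update A E θ p.1 p.2) ∂(batchLaw N A.batchSize).prod (noiseLaw A) := fun E =>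
    (integral_indicator_one (hmeas E hX)).symm
  have hγ : ∀ u : Params d, ∫ z, X.indicator (1 : Params d → ℝ) (ψ (u + z))
      ∂stdGaussian (Params d) = (stdGaussian (Params d)).real {z | u + z ∈ ψ ⁻¹' X} := fun u =>
    integral_indicator_one ((measurable_const_add u) (hψ hX))
  have hX1 : Measurable (X.indicator (1 : Params d → ℝ)) := measurable_one.indicator hX
  rw [hreal, hreal, hP _ hX1 hbd, hQ _ hX1 hbd]
  simp only [hγ]
  set q : ℝ := A.batchSize / N with hq
  have hq0 : 0 ≤ q := by positivity
  have hq1 : q ≤ 1 := div_le_one_of_le₀ (by exact_mod_cast hBN) (by positivity)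
  set h := hockeyMajorant (Real.log (1 + t)) r
  have hk : ∀ k, W k * (q * (stdGaussian (Params d)).real {z | a k + z ∈ ψ ⁻¹' X}
      + (1 - q) * (stdGaussian (Params d)).real {z | c k + z ∈ ψ ⁻¹' X})
      ≤ (1 + q * ε * t) * (W k * (q * (stdGaussian (Params d)).real {z | b k + z ∈ ψ ⁻¹' X}
      + (1 - q) * (stdGaussian (Params d)).real {z | c k + z ∈ ψ ⁻¹' X})) + W k * (q * ε * h) := by
    intro k
    have h1 := stdGaussian_shift_le_hockeyMajorant hε hε1 ht hr ((hd k).1.trans hr') (hψ hX)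
    have h2 := stdGaussian_shift_le_hockeyMajorant hε hε1 ht hr ((hd k).2.1.trans hr') (hψ hX)
    set pa := (stdGaussian (Params d)).real {z | a k + z ∈ ψ ⁻¹' X}
    set pb := (stdGaussian (Params d)).real {z | b k + z ∈ ψ ⁻¹' X}
    set pc := (stdGaussian (Params d)).real {z | c k + z ∈ ψ ⁻¹' X}
    have hτ : 0 ≤ ε * t := mul_nonneg hε.le ht
    have h3 := mul_le_mul_of_nonneg_left h2 (mul_nonneg hτ (sub_nonneg.2 hq1))
    have h4 := mul_le_mul_of_nonneg_left h1 (by positivity : 0 ≤ 1 + q * (ε * t))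
    -- The weights τ(1 - q) for the bound by c and 1 + qτ for the bound by b sum to 1 + τ, which
    -- then cancels.
    have h5 : (1 + ε * t) * (pa - (ε * t * (1 - q) * pc + (1 + q * (ε * t)) * pb) - ε * h) ≤ 0 := by
      nlinarith
    have h6 : pa - (ε * t * (1 - q) * pc + (1 + q * (ε * t)) * pb) - ε * h ≤ 0 := by
      by_contra! hc
      have : 0 < 1 + ε * t := by linarith
      nlinarith
    have h7 := mul_le_mul_of_nonneg_left h6 (mul_nonneg (hW0 k) hq0)
    nlinarith
  calc _ ≤ ∑ k, _ := Finset.sum_le_sum fun k _ => hk k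
    _ = _ := by rw [Finset.sum_add_distrib, ← Finset.mul_sum, ← Finset.sum_mul, hW1, one_mul]

-- The extreme case is an equilateral triangle of side √y: the inner product at c is half of |a -
-- c|² + |b - c|² - |a - b|², and for large |a - c| and |b - c| the squared norms dominate.
open scoped RealInnerProductSpace in
theorem chi_coefficient_le {E : Type*} [NormedAddCommGroup E] [InnerProductSpace ℝ E] {a b c : E}
    {y : ℝ} (hab : ‖a - b‖ ^ 2 ≤ y) (hac : ‖a - c‖ ^ 2 ≤ y) (hbc : ‖b - c‖ ^ 2 ≤ y) :
    Real.exp (‖a - c‖ ^ 2) + Real.exp (‖b - c‖ ^ 2) - 2 * Real.exp ⟪a - c, b - c⟫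
      ≤ 2 * Real.exp y - 2 * Real.exp (y / 2) := by
  have h1 : (‖a - c‖ ^ 2 + ‖b - c‖ ^ 2 - y) / 2 ≤ ⟪a - c, b - c⟫ := by
    have := norm_sub_sq_real (a - c) (b - c)
    rw [sub_sub_sub_cancel_right] at this
    linarith
  have h2 := Real.exp_le_exp.2 h1
  set X := ‖a - c‖ ^ 2
  set Z := ‖b - c‖ ^ 2
  have sq : ∀ x : ℝ, Real.exp x = Real.exp (x / 2) ^ 2 := fun x => by
    rw [← Real.exp_nat_mul]; congr 1; push_cast; ring
  have e1 : Real.exp ((X + Z - y) / 2) * Real.exp (y / 2)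
      = Real.exp (X / 2) * Real.exp (Z / 2) := by
    rw [← Real.exp_add, ← Real.exp_add]; congr 1; ring
  have y0 : 0 ≤ y := (sq_nonneg _).trans hab
  have hX : Real.exp (X / 2) ≤ Real.exp (y / 2) := Real.exp_le_exp.2 (by linarith)
  have hZ : Real.exp (Z / 2) ≤ Real.exp (y / 2) := Real.exp_le_exp.2 (by linarith)
  have X1 : 1 ≤ Real.exp (X / 2) := Real.one_le_exp (by positivity)
  have Z1 : 1 ≤ Real.exp (Z / 2) := Real.one_le_exp (by positivity)
  rw [sq X, sq Z, sq y]
  set x := Real.exp (X / 2)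
  set z := Real.exp (Z / 2)
  set p := Real.exp (y / 2)
  set e := Real.exp ((X + Z - y) / 2)
  have p0 : 0 < p := by linarith
  suffices h : p * (x ^ 2 + z ^ 2 - 2 * e) ≤ p * (2 * p ^ 2 - 2 * p) by
    have := le_of_mul_le_mul_left h p0
    linarith
  have e2 : p * (x ^ 2 + z ^ 2 - 2 * e) = p * x ^ 2 + p * z ^ 2 - 2 * (x * z) := by
    rw [← e1]; ring
  rw [e2]
  have k1 : 0 ≤ (p - x) * (p * (p + x) - 2 * z) := by
    refine mul_nonneg (sub_nonneg.2 hX) ?_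
    nlinarith
  have k2 : 0 ≤ p * ((p - z) * (p + z - 2)) := by
    refine mul_nonneg p0.le (mul_nonneg (sub_nonneg.2 hZ) ?_)
    linarith
  nlinarith

/-- Cauchy–Schwarz for the vectors (1, q√V) and (m, √X). -/
theorem sq_add_mul_le {m Δ X q V : ℝ} (hV : 0 ≤ V) (hX : 0 ≤ X)
    (h : Δ ^ 2 ≤ V * X) : (m + q * Δ) ^ 2 ≤ (1 + q ^ 2 * V) * (m ^ 2 + X) := by
  rcases hX.eq_or_lt with h0 | h0
  · rw [← h0, mul_zero] at h
    have : Δ = 0 := by nlinarith [sq_nonneg Δ]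
    rw [← h0, this]
    nlinarith [mul_nonneg (mul_nonneg (sq_nonneg q) hV) (sq_nonneg m)]
  · have h1 : X * (m + q * Δ) ^ 2 ≤ X * ((1 + q ^ 2 * V) * (m ^ 2 + X)) := by
      have h2 := mul_le_mul_of_nonneg_left h (mul_nonneg (sq_nonneg q) hX)
      have h3 := mul_le_mul_of_nonneg_left h (mul_nonneg (sq_nonneg q) (sq_nonneg m))
      nlinarith [sq_nonneg (X - q * Δ * m)]
    exact le_of_mul_le_mul_left h1 h0

theorem integral_sub_const_sq {X : Type*} [MeasurableSpace X] {P : Measure X}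
    [IsProbabilityMeasure P] {f : X → ℝ} (hf : Measurable f) {C : ℝ} (hb : ∀ x, |f x| ≤ C)
    (c : ℝ) :
    ∫ x, (f x - c) ^ 2 ∂P = ∫ x, f x ^ 2 ∂P - 2 * c * ∫ x, f x ∂P + c ^ 2 := by
  have i1 : Integrable f P := Integrable.of_bound hf.aestronglyMeasurable C
    (Filter.Eventually.of_forall hb)
  have i2 : Integrable (fun x => f x ^ 2) P :=
    Integrable.of_bound (hf.pow_const 2).aestronglyMeasurable (C ^ 2)
      (Filter.Eventually.of_forall fun x => by
        rw [Real.norm_eq_abs, abs_pow]; exact pow_le_pow_left₀ (abs_nonneg _) (hb x) 2)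
  have e : ∀ x, (f x - c) ^ 2 = f x ^ 2 - 2 * c * f x + c ^ 2 := fun x => by ring
  have i3 : Integrable (fun x => f x ^ 2 - 2 * c * f x) P := i2.sub (i1.const_mul _)
  simp_rw [e]
  rw [integral_add i3 (integrable_const _), integral_sub i2 (i1.const_mul _), integral_const_mul]
  simp

/-- In each component, m is the mean of f under the mixture of b and c, and the mean under the other
mixture is m + q(a-mean minus b-mean). That difference is bounded by the variance of f under the
mixture, so the χ² excess carries a factor q². Jensen handles the sum over components. -/
theorem round_chi (A : Config (w + s + l) d m) (hB : 1 ≤ A.batchSize)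
    (hBN : A.batchSize ≤ N) (hC : 0 < A.C) (hσ : 0 < A.σ) {μ : ℝ} {D D' : OPFDataset N w s l m}
    (hadj : OPFDataset.Adjacent μ D D') (θ : Params d) {y : ℝ} (hy : (2 / A.σ) ^ 2 ≤ y)
    {f : Params d → ℝ} (hf : Measurable f) (hb : ∃ C, ∀ x, |f x| ≤ C) :
    (∫ p, f (update A D θ p.1 p.2) ∂(batchLaw N A.batchSize).prod (noiseLaw A)) ^ 2
      ≤ (1 + (A.batchSize / N : ℝ) ^ 2 * (2 * Real.exp y - 2 * Real.exp (y / 2)))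
        * ∫ p, f (update A D' θ p.1 p.2) ^ 2 ∂(batchLaw N A.batchSize).prod (noiseLaw A) := by
  obtain ⟨κ, _, W, a, b, c, ψ, hψ, hW0, hW1, hd, hP, hQ⟩ :=
    exists_round_mixture A hB hBN hC hσ hadj θ
  have hb' := hb
  obtain ⟨C, hC'⟩ := hb
  have hb2 : ∃ C, ∀ x, |f x ^ 2| ≤ C := ⟨C ^ 2, fun x => by
    rw [abs_pow]; exact pow_le_pow_left₀ (abs_nonneg _) (hC' x) 2⟩
  rw [hP f hf hb', hQ (fun x => f x ^ 2) (hf.pow_const 2) hb2]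
  set q : ℝ := A.batchSize / N
  have hq0 : 0 ≤ q := by positivity
  have hq1 : q ≤ 1 := div_le_one_of_le₀ (by exact_mod_cast hBN) (by positivity)
  set V := 2 * Real.exp y - 2 * Real.exp (y / 2) with hV
  have hy0 : 0 ≤ y := (sq_nonneg _).trans hy
  have hV0 : 0 ≤ V := by
    have := Real.exp_le_exp.2 (by linarith : y / 2 ≤ y)
    linarith
  have hk : ∀ k, (q * ∫ z, f (ψ (a k + z)) ∂stdGaussian (Params d) + (1 - q) * ∫ z, f (ψ (c k + z))
      ∂stdGaussian (Params d)) ^ 2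
      ≤ (1 + q ^ 2 * V) * (q * ∫ z, f (ψ (b k + z)) ^ 2 ∂stdGaussian (Params d)
        + (1 - q) * ∫ z, f (ψ (c k + z)) ^ 2 ∂stdGaussian (Params d)) := by
    intro k
    have hsq : ∀ x : ℝ, 0 ≤ x → x ≤ 2 / A.σ → x ^ 2 ≤ y := fun x h0 hx =>
      (pow_le_pow_left₀ h0 hx 2).trans hy
    have dab := hsq _ (norm_nonneg _) (hd k).1
    have dac := hsq _ (norm_nonneg _) (hd k).2.1
    have dbc := hsq _ (norm_nonneg _) (hd k).2.2
    have mψ : ∀ u : Params d, Measurable fun z => f (ψ (u + z)) := fun u =>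
      hf.comp (hψ.comp (measurable_const_add u))
    set na := ∫ z, f (ψ (a k + z)) ∂stdGaussian (Params d) with hna
    set nb := ∫ z, f (ψ (b k + z)) ∂stdGaussian (Params d) with hnb
    set nc := ∫ z, f (ψ (c k + z)) ∂stdGaussian (Params d) with hnc
    set m := q * nb + (1 - q) * nc with hm
    have int : ∀ u : Params d, Integrable (fun z => f (ψ (u + z))) (stdGaussian (Params d)) := fun u
        =>
      Integrable.of_bound (mψ u).aestronglyMeasurable C (Filter.Eventually.of_forall fun x => hC' _)
    have hsub : ∀ u : Params d, ∫ z, (f (ψ (u + z)) - m) ∂stdGaussian (Params d) = ∫ z, f (ψ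
        (u + z)) ∂stdGaussian (Params d) - m :=
      fun u => by
      rw [integral_sub (int u) (integrable_const _)]; simp
    have mF : Measurable fun z => f (ψ z) - m := (hf.comp hψ).sub_const m
    have bF : ∃ C, ∀ x, |f (ψ x) - m| ≤ C := ⟨C + |m|, fun x =>
      (abs_sub _ _).trans (by linarith [hC' (ψ x)])⟩
    have s1 := sq_integral_shift_sub_le mF bF (a k) (b k) (c k)
    have s2 := sq_integral_shift_sub_le mF bF (a k) (b k) (b k)
    simp only [hsub] at s1 s2
    rw [integral_sub_const_sq (mψ _) (fun x => hC' _)] at s1 s2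
    have v1 := chi_coefficient_le dab dac dbc
    have v2 := chi_coefficient_le (c := b k) dab dab (by simpa using hy0)
    have p1 : 0 ≤ ∫ z, f (ψ (c k + z)) ^ 2 ∂stdGaussian (Params d) - 2 * m * nc + m ^ 2 := by
      rw [← integral_sub_const_sq (mψ _) (fun x => hC' _)]
      exact integral_nonneg fun x => sq_nonneg _
    have p2 : 0 ≤ ∫ z, f (ψ (b k + z)) ^ 2 ∂stdGaussian (Params d) - 2 * m * nb + m ^ 2 := by
      rw [← integral_sub_const_sq (mψ _) (fun x => hC' _)]
      exact integral_nonneg fun x => sq_nonneg _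
    have t1 := s1.trans (mul_le_mul_of_nonneg_right v1 p1)
    have t2 := s2.trans (mul_le_mul_of_nonneg_right v2 p2)
    rw [← hna, ← hnb, sub_sub_sub_cancel_right, ← hV] at t1 t2
    set Fb := ∫ z, f (ψ (b k + z)) ^ 2 ∂stdGaussian (Params d)
    set Fc := ∫ z, f (ψ (c k + z)) ^ 2 ∂stdGaussian (Params d)
    -- The same difference is bounded relative to c and relative to b; averaging with weights 1 - q
    -- and q produces the variance under the mixture itself.
    have t3 : (na - nb) ^ 2 ≤ V * (q * Fb + (1 - q) * Fc - m ^ 2) := by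
      have h1 := mul_le_mul_of_nonneg_left t1 (sub_nonneg.2 hq1)
      have h2 := mul_le_mul_of_nonneg_left t2 hq0
      have e : (1 - q) * (V * (Fc - 2 * m * nc + m ^ 2)) + q * (V * (Fb - 2 * m * nb + m ^ 2))
          = V * (q * Fb + (1 - q) * Fc - m ^ 2) := by rw [hm]; ring
      linarith
    have hX : 0 ≤ q * Fb + (1 - q) * Fc - m ^ 2 := by
      have h1 := mul_nonneg (sub_nonneg.2 hq1) p1
      have h2 := mul_nonneg hq0 p2
      have e : (1 - q) * (Fc - 2 * m * nc + m ^ 2) + q * (Fb - 2 * m * nb + m ^ 2)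
          = q * Fb + (1 - q) * Fc - m ^ 2 := by rw [hm]; ring
      linarith
    have := sq_add_mul_le (m := m) (q := q) hV0 hX t3
    calc (q * na + (1 - q) * nc) ^ 2 = (m + q * (na - nb)) ^ 2 := by rw [hm]; ring
      _ ≤ _ := this
      _ = _ := by ring
  calc _ ≤ ∑ k, W k * (q * ∫ z, f (ψ (a k + z)) ∂stdGaussian (Params d) + (1 - q) * ∫ z, f
      (ψ (c k + z)) ∂stdGaussian (Params d)) ^ 2 :=
        Real.pow_arith_mean_le_arith_mean_pow_of_even Finset.univ W _ (fun k _ => hW0 k) hW1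
            even_two
    _ ≤ ∑ k, W k * ((1 + q ^ 2 * V) * (q * ∫ z, f (ψ (b k + z)) ^ 2 ∂stdGaussian (Params d)
        + (1 - q) * ∫ z, f (ψ (c k + z)) ^ 2 ∂stdGaussian (Params d))) :=
        Finset.sum_le_sum fun k _ => mul_le_mul_of_nonneg_left (hk k) (hW0 k)
    _ = _ := by
        rw [Finset.mul_sum]
        exact Finset.sum_congr rfl fun k _ => by ring

end Round

/-! ### Composition along the trajectory -/

section Trajectory

variable {N w s l d m : ℕ}

theorem measurable_snoc_update (A : Config (w + s + l) d m) (D : OPFDataset N w s l m) (T : ℕ) :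
    Measurable fun p : (Fin (T + 1) → Params d) × Finset (Fin N) × Params d =>
      (Fin.snoc p.1 (update A D (p.1 (Fin.last T)) p.2.1 p.2.2) : Fin (T + 2) → Params d) := by
  refine measurable_pi_lambda _ fun j => ?_
  refine Fin.lastCases ?_ (fun j => ?_) j
  · simp only [Fin.snoc_last]
    have h : Measurable fun p : (Fin (T + 1) → Params d) × Finset (Fin N) × Params d =>
        (p.1 (Fin.last T), p.2) :=
      ((measurable_pi_apply (Fin.last T)).comp measurable_fst).prodMk measurable_snd
    exact (measurable_update A D).comp h
  · simp only [Fin.snoc_castSucc]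
    exact (measurable_pi_apply j).comp measurable_fst

theorem measurable_snoc {T : ℕ} (h : Fin (T + 1) → Params d) :
    Measurable fun v : Params d => (Fin.snoc h v : Fin (T + 2) → Params d) := by
  refine measurable_pi_lambda _ fun j => ?_
  refine Fin.lastCases ?_ (fun j => ?_) j
  · simp only [Fin.snoc_last]; exact measurable_id
  · simp only [Fin.snoc_castSucc]; exact measurable_const

/-- G t z stands for any upper bound of the expectation of (z times the product of t independent
atoms - K)₊. Mean at most one for the atoms keeps the additive errors to T c z. -/
theorem trajectory_hockeyBound (A : Config (w + s + l) d m) (hBN : A.batchSize ≤ N)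
    {D D' : OPFDataset N w s l m} {K c : ℝ} (hK : 0 ≤ K) {ι : Type*} [Fintype ι]
    (p v : ι → ℝ) (hp : ∀ j, 0 ≤ p j) (hv : ∀ j, 0 ≤ v j) (hc : 0 ≤ c)
    (hpv : ∑ j, p j * v j ≤ 1)
    (hstep : ∀ θ, ∀ X : Set (Params d), MeasurableSet X → ∀ y, 0 ≤ y →
      ((batchLaw N A.batchSize).prod (noiseLaw A)).real {p | update A D θ p.1 p.2 ∈ X}
        ≤ y * ((batchLaw N A.batchSize).prod (noiseLaw A)).real {p | update A D' θ p.1 p.2 ∈ X}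
          + (∑ j, p j * max (v j - y) 0 + c))
    (G : ℕ → ℝ → ℝ) (hG0 : ∀ z, 0 ≤ z → max (z - K) 0 ≤ G 0 z)
    (hG : ∀ t z, 0 ≤ z → ∑ j, p j * G t (z * v j) ≤ G (t + 1) z) (T : ℕ) :
    HockeyBound K (trajectoryLaw A D T) (trajectoryLaw A D' T) (fun z => G T z + T * c * z) := by
  have := isProbabilityMeasure_batchLaw hBN
  induction T with
  | zero =>
    intro z hz X hX
    have h1 := hG0 z hz
    have h2 := isProbabilityMeasure_trajectoryLaw A D hBN 0
    have h3 : trajectoryLaw A D' 0 = trajectoryLaw A D 0 := rfl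
    have h4 : (trajectoryLaw A D 0).real X ≤ 1 := measureReal_le_one
    have h5 : 0 ≤ (trajectoryLaw A D 0).real X := measureReal_nonneg
    simp only [h3, Nat.cast_zero, zero_mul, add_zero]
    rw [← sub_mul]
    refine le_trans ?_ h1
    rcases le_total (z - K) 0 with h | h
    · rw [max_eq_right h]; exact mul_nonpos_of_nonpos_of_nonneg h h5
    · rw [max_eq_left h]; exact mul_le_of_le_one_right h h4
  | succ T ih =>
    have := isProbabilityMeasure_trajectoryLaw A D hBN T
    have := isProbabilityMeasure_trajectoryLaw A D' hBN T
    have h := HockeyBound.step hK p v hp hv ih ((batchLaw N A.batchSize).prod (noiseLaw A))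
      (measurable_snoc_update A D T) (measurable_snoc_update A D' T)
      (fun x X hX y hy => hstep (x (Fin.last T)) _ (measurable_snoc x hX) y hy) (c := c)
    intro z hz X hX
    refine (h z hz X hX).trans ?_
    have e : ∑ j, p j * (G T (z * v j) + T * c * (z * v j))
        = ∑ j, p j * G T (z * v j) + T * c * z * ∑ j, p j * v j := by
      rw [Finset.mul_sum, ← Finset.sum_add_distrib]
      exact Finset.sum_congr rfl fun j _ => by ring
    simp only [e]
    have h1 := hG T z hz
    have h2 : (T : ℝ) * c * z * ∑ j, p j * v j ≤ T * c * z := by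
      refine mul_le_of_le_one_right ?_ hpv
      positivity
    push_cast
    linarith

/-- The round bound holds from every starting point θ, so it may be conditioned on the whole past,
and the second-moment factors multiply. -/
theorem trajectory_chiBound (A : Config (w + s + l) d m) (hBN : A.batchSize ≤ N)
    {D D' : OPFDataset N w s l m} {M : ℝ} (hM : 0 ≤ M)
    (hstep : ∀ θ, ∀ f : Params d → ℝ, Measurable f → (∃ C, ∀ x, |f x| ≤ C) →
      (∫ p, f (update A D θ p.1 p.2) ∂(batchLaw N A.batchSize).prod (noiseLaw A)) ^ 2
        ≤ M * ∫ p, f (update A D' θ p.1 p.2) ^ 2 ∂(batchLaw N A.batchSize).prod (noiseLaw A))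
    (T : ℕ) : ChiBound (trajectoryLaw A D T) (trajectoryLaw A D' T) (M ^ T) := by
  have := isProbabilityMeasure_batchLaw hBN
  induction T with
  | zero =>
    intro f hf ⟨b, hb⟩
    simp [trajectoryLaw]
  | succ T ih =>
    have := isProbabilityMeasure_trajectoryLaw A D hBN T
    have := isProbabilityMeasure_trajectoryLaw A D' hBN T
    rw [pow_succ]
    refine ChiBound.step (pow_nonneg hM T) ih ((batchLaw N A.batchSize).prod (noiseLaw A))
      (measurable_snoc_update A D T) (measurable_snoc_update A D' T) fun x f hf hb => ?_
    obtain ⟨b, hb⟩ := hb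
    exact hstep (x (Fin.last T)) (fun v => f (Fin.snoc x v)) (hf.comp (measurable_snoc x))
      ⟨b, fun y => hb _⟩

end Trajectory

/-! ### Piecewise affine domination -/

/-- P - yQ is affine in y, so domination by a piecewise affine function need only be checked at its
nodes. -/
theorem affine_le_of_nodes {P Q a b Ja Jb Jy y : ℝ} (hab : a < b) (hay : a ≤ y) (hyb : y ≤ b)
    (ha : P - a * Q ≤ Ja) (hb : P - b * Q ≤ Jb) (hJ : (b - a) * Jy = (b - y) * Ja + (y - a) * Jb) :
    P ≤ y * Q + Jy := by
  have h1 := mul_le_mul_of_nonneg_left ha (sub_nonneg.2 hyb)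
  have h2 := mul_le_mul_of_nonneg_left hb (sub_nonneg.2 hay)
  have h3 : (b - a) * (P - y * Q) ≤ (b - a) * Jy := by rw [hJ]; linarith
  have := le_of_mul_le_mul_left h3 (sub_pos.2 hab)
  linarith

/-- Domination by three atoms `0`, `1`, `1 + 5 g`. -/
theorem three_atoms_dominate {P Q g h₀ h₅ u : ℝ} (hg : 0 < g) (hQ0 : 0 ≤ Q) (hP1 : P ≤ 1)
    (hh₅ : 0 ≤ h₅) (h0u : h₀ ≤ h₅ + 5 * u) (b0 : P ≤ Q + g * h₀)
    (b5 : P ≤ (1 + 5 * g) * Q + g * h₅) {y : ℝ} (hy : 0 ≤ y) :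
    P ≤ y * Q + (5 * g * u * max (0 - y) 0 + (1 - u * (1 + 5 * g)) * max (1 - y) 0
      + u * max (1 + 5 * g - y) 0 + g * h₅) := by
  rw [max_eq_right (by linarith : 0 - y ≤ 0), mul_zero, zero_add]
  have hh : 0 ≤ g * h₅ := mul_nonneg hg.le hh₅
  rcases le_total y 1 with h1 | h1
  · rw [max_eq_left (by linarith : 0 ≤ 1 - y), max_eq_left (by linarith : 0 ≤ 1 + 5 * g - y)]
    refine affine_le_of_nodes (a := 0) (b := 1) (Ja := 1 + g * h₅) (Jb := 5 * g * u + g * h₅)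
      zero_lt_one hy h1 (by linarith) (by nlinarith) (by ring)
  · rw [max_eq_right (by linarith : 1 - y ≤ 0), mul_zero, zero_add]
    rcases le_total y (1 + 5 * g) with h2 | h2
    · rw [max_eq_left (by linarith : 0 ≤ 1 + 5 * g - y)]
      exact affine_le_of_nodes (a := 1) (b := 1 + 5 * g) (Ja := 5 * g * u + g * h₅)
        (Jb := g * h₅) (by linarith) h1 h2 (by nlinarith) (by linarith) (by ring)
    · rw [max_eq_right (by linarith : 1 + 5 * g - y ≤ 0)]
      nlinarith

/-- Domination by the five atoms `(1 + 5 g)^{±1}`, `(1 + 2 g)^{±1}`, `1`. -/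
theorem five_atoms_dominate {P Q g h₀ h₂ h₅ : ℝ} (hg : 0 < g) (hQ0 : 0 ≤ Q) (hP1 : P ≤ 1)
    (hh₅ : 0 ≤ h₅) (b0 : P ≤ Q + g * h₀)
    (b2 : P ≤ (1 + 2 * g) * Q + g * h₂) (b5 : P ≤ (1 + 5 * g) * Q + g * h₅)
    (d2 : (1 + 2 * g) * P ≤ Q + 2 * g + g * h₂) (d5 : (1 + 5 * g) * P ≤ Q + 5 * g + g * h₅)
    {y : ℝ} (hy : 0 ≤ y) :
    P ≤ y * Q + ((h₂ - h₅) / 3 * max (1 + 5 * g - y) 0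
      + ((h₀ - h₂) / 2 - (h₂ - h₅) / 3) * max (1 + 2 * g - y) 0
      + (1 - (h₀ - h₂) - g * h₀) * max (1 - y) 0
      + ((h₀ - h₂) / 2 + g * h₀ - ((1 + 5 * g) * h₂ - (1 + 2 * g) * h₅) / 3)
        * max ((1 + 2 * g)⁻¹ - y) 0
      + ((1 + 5 * g) * h₂ - (1 + 2 * g) * h₅) / 3 * max ((1 + 5 * g)⁻¹ - y) 0 + g * h₅) := by
  have hh : 0 ≤ g * h₅ := mul_nonneg hg.le hh₅
  have g2 : 0 < 1 + 2 * g := by linarith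
  have g5 : 0 < 1 + 5 * g := by linarith
  set y₂ := (1 + 2 * g)⁻¹ with hy2
  set y₅ := (1 + 5 * g)⁻¹ with hy5
  have e2 : y₂ * (1 + 2 * g) = 1 := inv_mul_cancel₀ g2.ne'
  have e5 : y₅ * (1 + 5 * g) = 1 := inv_mul_cancel₀ g5.ne'
  have y50 : 0 < y₅ := inv_pos.2 g5
  have y20 : 0 < y₂ := inv_pos.2 g2
  have y52 : y₅ < y₂ := inv_strictAnti₀ g2 (by linarith)
  have y21 : y₂ < 1 := inv_lt_one_of_one_lt₀ (by linarith)
  -- The weights make the dominating function interpolate the available bounds at its five nodes.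
  -- Those below 1 come from the reversed comparison on complements, divided by 1 + 2g or 1 + 5g.
  have n2 : P - y₂ * Q ≤ 1 - y₂ + g * h₂ * y₂ := by
    have := mul_le_mul_of_nonneg_left d2 y20.le
    have e : y₂ * ((1 + 2 * g) * P) = P := by rw [← mul_assoc, e2, one_mul]
    have e' : y₂ * (2 * g) = 1 - y₂ := by linarith
    nlinarith
  have n5 : P - y₅ * Q ≤ 1 - y₅ + g * h₅ * y₅ := by
    have := mul_le_mul_of_nonneg_left d5 y50.le
    have e : y₅ * ((1 + 5 * g) * P) = P := by rw [← mul_assoc, e5, one_mul]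
    have e' : y₅ * (5 * g) = 1 - y₅ := by linarith
    nlinarith
  have n0 : P - 1 * Q ≤ g * h₀ := by linarith
  rcases le_total y 1 with h1 | h1
  · rw [max_eq_left (by linarith : 0 ≤ 1 - y), max_eq_left (by linarith : 0 ≤ 1 + 5 * g - y),
      max_eq_left (by linarith : 0 ≤ 1 + 2 * g - y)]
    rcases le_total y y₂ with h2 | h2
    · rw [max_eq_left (by linarith : 0 ≤ y₂ - y)]
      rcases le_total y y₅ with h3 | h3
      · rw [max_eq_left (by linarith : 0 ≤ y₅ - y)]
        refine affine_le_of_nodes (a := 0) (b := y₅) (Ja := 1 + g * h₅ * y₅)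
          (Jb := 1 - y₅ + g * h₅ * y₅) y50 hy h3 (by nlinarith [mul_nonneg hh y50.le]) n5 ?_
        rw [hy2, hy5]; field_simp; ring
      · rw [max_eq_right (by linarith : y₅ - y ≤ 0)]
        refine affine_le_of_nodes y52 h3 h2 n5 n2 ?_
        rw [hy2, hy5]; field_simp; ring
    · rw [max_eq_right (by linarith : y₂ - y ≤ 0), max_eq_right (by linarith : y₅ - y ≤ 0)]
      refine affine_le_of_nodes y21 h2 h1 n2 n0 ?_
      rw [hy2]; field_simp; ring
  · rw [max_eq_right (by linarith : 1 - y ≤ 0), max_eq_right (by linarith : y₂ - y ≤ 0),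
      max_eq_right (by linarith : y₅ - y ≤ 0)]
    rcases le_total y (1 + 2 * g) with h2 | h2
    · rw [max_eq_left (by linarith : 0 ≤ 1 + 5 * g - y),
        max_eq_left (by linarith : 0 ≤ 1 + 2 * g - y)]
      exact affine_le_of_nodes (a := 1) (b := 1 + 2 * g) (Jb := g * h₂) (by linarith) h1 h2 n0
        (by linarith) (by ring)
    · rw [max_eq_right (by linarith : 1 + 2 * g - y ≤ 0)]
      rcases le_total y (1 + 5 * g) with h3 | h3
      · rw [max_eq_left (by linarith : 0 ≤ 1 + 5 * g - y)]
        exact affine_le_of_nodes (a := 1 + 2 * g) (b := 1 + 5 * g) (Ja := g * h₂) (Jb := g * h₅)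
          (by linarith) h2 h3 (by linarith) (by linarith) (by ring)
      · rw [max_eq_right (by linarith : 1 + 5 * g - y ≤ 0)]
        nlinarith

/-! ### Numerical bounds for the Gaussian majorants -/

section Numerics

/-- Taylor polynomials of `exp (-y)`. -/
def expNegTaylor (n : ℕ) (y : ℝ) : ℝ := ∑ k ∈ Finset.range n, (-y) ^ k / k.factorial

/-- The signed remainder of order n + 1 vanishes at 0 and has the signed remainder of order n as its
derivative. -/
theorem expNegTaylor_alternating (n : ℕ) {y : ℝ} (hy : 0 ≤ y) :
    0 ≤ (-1) ^ n * (Real.exp (-y) - expNegTaylor n y) := by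
  induction n generalizing y with
  | zero => simp [expNegTaylor, (Real.exp_pos _).le]
  | succ n ih =>
    have hd : ∀ x : ℝ, HasDerivAt (fun y => (-1) ^ (n + 1) *
        (Real.exp (-y) - expNegTaylor (n + 1) y))
        ((-1) ^ n * (Real.exp (-x) - expNegTaylor n x)) x := by
      intro x
      have h1 : HasDerivAt (fun y : ℝ => Real.exp (-y)) (-Real.exp (-x)) x := by
        simpa using (hasDerivAt_neg x).exp
      have h2 : HasDerivAt (expNegTaylor (n + 1)) (-expNegTaylor n x) x := by
        have : ∀ k ∈ Finset.range (n + 1), HasDerivAt (fun y : ℝ => (-y) ^ k / (k.factorial : ℝ))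
            ((k : ℝ) * (-x) ^ (k - 1) * (-1) / k.factorial) x := fun k _ =>
          (((hasDerivAt_neg x).pow k)).div_const _
        have h3 := HasDerivAt.fun_sum this
        refine h3.congr_deriv ?_
        rw [Finset.sum_range_succ', expNegTaylor, ← Finset.sum_neg_distrib]
        simp only [Nat.cast_zero, zero_mul, zero_div, add_zero]
        refine Finset.sum_congr rfl fun k _ => ?_
        rw [Nat.factorial_succ]
        have : ((k : ℝ) + 1) ≠ 0 := by positivity
        push_cast
        field_simp
      refine ((h1.sub h2).const_mul _).congr_deriv ?_
      rw [pow_succ]; ring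
    have hmono : MonotoneOn
        (fun y => (-1) ^ (n + 1) * (Real.exp (-y) - expNegTaylor (n + 1) y)) (Set.Ici 0) := by
      refine monotoneOn_of_hasDerivWithinAt_nonneg (convex_Ici 0)
        (fun x _ => (hd x).continuousAt.continuousWithinAt)
        (fun x _ => (hd x).hasDerivWithinAt) fun x hx => ?_
      rw [interior_Ici] at hx
      exact ih (le_of_lt hx)
    have := hmono (Set.mem_Ici.2 le_rfl) (Set.mem_Ici.2 hy) hy
    refine le_trans (le_of_eq ?_) this
    simp only [expNegTaylor]
    rw [Finset.sum_range_succ']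
    simp

/-- Taylor polynomials of `∫ t in 0..x, exp (-t ^ 2 / 2)`. -/
def gaussTaylor (n : ℕ) (x : ℝ) : ℝ :=
  ∑ k ∈ Finset.range n, (-1) ^ k * x ^ (2 * k + 1) / (2 ^ k * k.factorial * (2 * k + 1))

theorem normalIntegral_alternating (n : ℕ) {x : ℝ} (hx : 0 ≤ x) :
    0 ≤ (-1) ^ n * (normalIntegral x - (Real.sqrt (2 * Real.pi))⁻¹ * gaussTaylor n x) := by
  set c := (Real.sqrt (2 * Real.pi))⁻¹ with hc
  have hc0 : 0 ≤ c := by positivity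
  have hd : ∀ x : ℝ, HasDerivAt (fun x => (-1) ^ n * (normalIntegral x - c * gaussTaylor n x))
      (c * ((-1) ^ n * (Real.exp (-(x ^ 2 / 2)) - expNegTaylor n (x ^ 2 / 2)))) x := by
    intro x
    have h2 : HasDerivAt (gaussTaylor n) (expNegTaylor n (x ^ 2 / 2)) x := by
      have : ∀ k ∈ Finset.range n, HasDerivAt (fun x : ℝ => (-1) ^ k * x ^ (2 * k + 1)
          / (2 ^ k * (k.factorial : ℝ) * (2 * k + 1)))
          ((-(x ^ 2 / 2)) ^ k / (k.factorial : ℝ)) x := fun k _ => by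
        refine (((hasDerivAt_pow (2 * k + 1) x).const_mul ((-1) ^ k)).div_const _).congr_deriv ?_
        have : (2 * (k : ℝ) + 1) ≠ 0 := by positivity
        push_cast
        rw [neg_pow (x ^ 2 / 2), div_pow, ← pow_mul]
        field_simp
      exact HasDerivAt.fun_sum this
    refine (((hasDerivAt_normalIntegral x).sub (h2.const_mul c)).const_mul _).congr_deriv ?_
    rw [normalDensity, ← hc, show -(x ^ 2) / 2 = -(x ^ 2 / 2) by ring]; ring
  have hmono : MonotoneOn (fun x => (-1) ^ n * (normalIntegral x - c * gaussTaylor n x))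
      (Set.Ici 0) := by
    refine monotoneOn_of_hasDerivWithinAt_nonneg (convex_Ici 0)
      (fun x _ => (hd x).continuousAt.continuousWithinAt)
      (fun x _ => (hd x).hasDerivWithinAt) fun x _ => ?_
    exact mul_nonneg hc0 (expNegTaylor_alternating n (by positivity))
  have := hmono (Set.mem_Ici.2 le_rfl) (Set.mem_Ici.2 hx) hx
  refine le_trans (le_of_eq ?_) this
  have h0 : gaussTaylor n 0 = 0 := Finset.sum_eq_zero fun k _ => by simp
  simp only [h0]
  rw [normalIntegral, intervalIntegral.integral_same]
  ring

theorem inv_sqrt_two_pi_bounds :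
    0.398942 ≤ (Real.sqrt (2 * Real.pi))⁻¹ ∧ (Real.sqrt (2 * Real.pi))⁻¹ ≤ 0.398943 := by
  have h1 := Real.pi_gt_d6
  have h2 := Real.pi_lt_d6
  constructor
  · rw [le_inv_comm₀ (by norm_num) (by positivity), Real.sqrt_le_left (by norm_num)]
    norm_num at h1 h2 ⊢
    linarith
  · rw [inv_le_comm₀ (by positivity) (by norm_num)]
    apply Real.le_sqrt_of_sq_le
    norm_num at h1 h2 ⊢
    linarith

theorem normalIntegral_mono : Monotone normalIntegral :=
  monotone_of_hasDerivAt_nonneg hasDerivAt_normalIntegral fun x => (normalDensity_pos x).le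

/-- An even number of Taylor terms bounds the normal integral from below and an odd number from
above, matching the opposite signs with which it occurs. -/
theorem gaussianHockey_le_of_bounds {ℓ K r x₁ x₂ : ℝ} (hK : Real.exp ℓ = K) (hx₁ : 0 ≤ x₁)
    (hx₂ : 0 ≤ x₂) (h1 : x₁ ≤ ℓ / r - r / 2) (h2 : ℓ / r + r / 2 ≤ x₂)
    (h3 : 0 ≤ gaussTaylor 20 x₁) (h4 : 0 ≤ gaussTaylor 19 x₂) :
    gaussianHockey ℓ r ≤ 1 / 2 - 0.398942 * gaussTaylor 20 x₁
      - K * (1 / 2 - 0.398943 * gaussTaylor 19 x₂) := by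
  obtain ⟨c1, c2⟩ := inv_sqrt_two_pi_bounds
  have a1 := normalIntegral_alternating 20 hx₁
  have a2 := normalIntegral_alternating 19 hx₂
  have m1 := normalIntegral_mono h1
  have m2 := normalIntegral_mono h2
  have K0 : 0 < K := hK ▸ Real.exp_pos ℓ
  have b1 := mul_le_mul_of_nonneg_right c1 h3
  have b2 := mul_le_mul_of_nonneg_right c2 h4
  rw [show (-1 : ℝ) ^ 20 = 1 by norm_num, one_mul] at a1
  rw [show (-1 : ℝ) ^ 19 = -1 by norm_num] at a2
  rw [gaussianHockey, hK]
  have : K * normalIntegral (ℓ / r + r / 2) ≤ K * (0.398943 * gaussTaylor 19 x₂) := by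
    refine mul_le_mul_of_nonneg_left ?_ K0.le
    linarith
  linarith

theorem log_three_bounds : 1.09860 ≤ Real.log 3 ∧ Real.log 3 ≤ 1.09863 := by
  have h2 := Real.log_two_gt_d9
  have h3 := Real.log_two_lt_d9
  -- 3^12 is close to 2^19, so the remaining logarithm is small enough for first-order bounds.
  have e : 12 * Real.log 3 = 19 * Real.log 2 + Real.log (531441 / 524288) := by
    rw [Real.log_div (by norm_num) (by norm_num), show (531441 : ℝ) = 3 ^ 12 by norm_num,
      show (524288 : ℝ) = 2 ^ 19 by norm_num, Real.log_pow, Real.log_pow]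
    push_cast; ring
  have u := Real.log_le_sub_one_of_pos (x := 531441 / 524288) (by norm_num)
  have l := Real.one_sub_inv_le_log_of_pos (x := 531441 / 524288) (by norm_num)
  norm_num at u l h2 h3 ⊢
  constructor <;> linarith

theorem log_six_bounds : 1.79174 ≤ Real.log 6 ∧ Real.log 6 ≤ 1.79178 := by
  have h2 := Real.log_two_gt_d9
  have h3 := Real.log_two_lt_d9
  obtain ⟨h4, h5⟩ := log_three_bounds
  rw [show (6 : ℝ) = 2 * 3 by norm_num, Real.log_mul (by norm_num) (by norm_num)]
  norm_num at h2 h3 h4 h5 ⊢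
  constructor <;> linarith

theorem log_five_quarters_ge : 0.22314 ≤ Real.log 1.25 := by
  have h2 := Real.log_two_gt_d9
  have e : 28 * Real.log 1.25 = 9 * Real.log 2 + Real.log (1.25 ^ 28 / 512) := by
    rw [Real.log_div (by norm_num) (by norm_num), show (512 : ℝ) = 2 ^ 9 by norm_num, Real.log_pow,
      Real.log_pow]
    push_cast; ring
  have l := Real.one_sub_inv_le_log_of_pos (x := 1.25 ^ 28 / 512) (by norm_num)
  have l2 : (0.0096 : ℝ) ≤ 1 - (1.25 ^ 28 / 512)⁻¹ := by norm_num
  norm_num at h2 e l l2 ⊢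
  linarith

/-- Anchors for chords. The last radius lies just below √(2 log 6), where the majorant turns affine;
1.48 plays this role for log 3. -/
theorem hockeyMajorant_log_six_anchors :
    hockeyMajorant (Real.log 6) 0.85 ≤ 0.0123 ∧ hockeyMajorant (Real.log 6) 1 ≤ 0.0325 ∧
    hockeyMajorant (Real.log 6) 1.25 ≤ 0.0909 ∧ hockeyMajorant (Real.log 6) 1.48 ≤ 0.1657 ∧
    hockeyMajorant (Real.log 6) 1.7 ≤ 0.2485 ∧ hockeyMajorant (Real.log 6) 1.89 ≤ 0.3238 := by
  obtain ⟨h1, h2⟩ := log_six_bounds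
  have hK : Real.exp (Real.log 6) = 6 := Real.exp_log (by norm_num)
  have main : ∀ r x₁ x₂ v : ℝ, 0 < r → r ^ 2 ≤ 2 * 1.79174 → 0 ≤ x₁ → 0 ≤ x₂ →
      x₁ ≤ 1.79174 / r - r / 2 → 1.79178 / r + r / 2 ≤ x₂ → 0 ≤ gaussTaylor 20 x₁ →
      0 ≤ gaussTaylor 19 x₂ → 1 / 2 - 0.398942 * gaussTaylor 20 x₁
      - 6 * (1 / 2 - 0.398943 * gaussTaylor 19 x₂) ≤ v → hockeyMajorant (Real.log 6) r ≤ v := by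
    intro r x₁ x₂ v hr hr2 k1 k2 k3 k4 k5 k6 k7
    refine (hockeyMajorant_le_gaussianHockey hr (by linarith)).trans
      ((gaussianHockey_le_of_bounds hK k1 k2 ?_ ?_ k5 k6).trans k7)
    · have : 1.79174 / r ≤ Real.log 6 / r := by gcongr
      linarith
    · have : Real.log 6 / r ≤ 1.79178 / r := by gcongr
      linarith
  refine ⟨main _ 1.6829 2.533 _ ?_ ?_ ?_ ?_ ?_ ?_ ?_ ?_ ?_, main _ 1.2917 2.2918 _ ?_ ?_ ?_ ?_ ?_ ?_
      ?_ ?_ ?_,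
    main _ 0.8083 2.0585 _ ?_ ?_ ?_ ?_ ?_ ?_ ?_ ?_ ?_, main _ 0.4706 1.9507 _ ?_ ?_ ?_ ?_ ?_ ?_ ?_
        ?_ ?_,
    main _ 0.2039 1.904 _ ?_ ?_ ?_ ?_ ?_ ?_ ?_ ?_ ?_, main _ 0.003 1.8931 _ ?_ ?_ ?_ ?_ ?_ ?_ ?_ ?_
        ?_⟩
  all_goals norm_num [gaussTaylor, Finset.sum_range_succ, Nat.factorial]

theorem hockeyMajorant_log_three_anchors :
    hockeyMajorant (Real.log 3) 0.85 ≤ 0.0641 ∧ hockeyMajorant (Real.log 3) 1 ≤ 0.1099 ∧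
    hockeyMajorant (Real.log 3) 1.25 ≤ 0.201 ∧ hockeyMajorant (Real.log 3) 1.48 ≤ 0.2918 := by
  obtain ⟨h1, h2⟩ := log_three_bounds
  have hK : Real.exp (Real.log 3) = 3 := Real.exp_log (by norm_num)
  have main : ∀ r x₁ x₂ v : ℝ, 0 < r → r ^ 2 ≤ 2 * 1.0986 → 0 ≤ x₁ → 0 ≤ x₂ →
      x₁ ≤ 1.0986 / r - r / 2 → 1.09863 / r + r / 2 ≤ x₂ → 0 ≤ gaussTaylor 20 x₁ →
      0 ≤ gaussTaylor 19 x₂ → 1 / 2 - 0.398942 * gaussTaylor 20 x₁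
      - 3 * (1 / 2 - 0.398943 * gaussTaylor 19 x₂) ≤ v → hockeyMajorant (Real.log 3) r ≤ v := by
    intro r x₁ x₂ v hr hr2 k1 k2 k3 k4 k5 k6 k7
    refine (hockeyMajorant_le_gaussianHockey hr (by linarith)).trans
      ((gaussianHockey_le_of_bounds hK k1 k2 ?_ ?_ k5 k6).trans k7)
    · have : 1.0986 / r ≤ Real.log 3 / r := by gcongr; linarith
      linarith
    · have : Real.log 3 / r ≤ 1.09863 / r := by gcongr
      linarith
  refine ⟨main _ 0.8674 1.7176 _ ?_ ?_ ?_ ?_ ?_ ?_ ?_ ?_ ?_, main _ 0.5986 1.5987 _ ?_ ?_ ?_ ?_ ?_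
      ?_ ?_ ?_ ?_,
    main _ 0.2538 1.504 _ ?_ ?_ ?_ ?_ ?_ ?_ ?_ ?_ ?_, main _ 0.0022 1.4824 _ ?_ ?_ ?_ ?_ ?_ ?_ ?_ ?_
        ?_⟩
  all_goals norm_num [gaussTaylor, Finset.sum_range_succ, Nat.factorial]

end Numerics

/-! ### Bounds for the majorants at the levels `1`, `3` and `6` -/

section Profile

/-- Relations between `δ` and bounds `h₀`, `h₂`, `h₅` for the majorants at the levels `log 1`,
`log 3` and `log 6`; `ub` bounds the second moments of the likelihood ratios built from them. -/
structure HockeyProfile (δ h₀ h₂ h₅ ub : ℝ) : Prop where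
  nonneg : 0 ≤ h₅
  le : h₅ ≤ h₂
  slack : h₅ ≤ δ - 0.067
  diff_five : h₀ - h₅ ≤ 0.435
  convex : 5 * h₂ ≤ 3 * h₀ + 2 * h₅
  diff_two : h₀ - h₂ ≤ 0.31
  le_zero : h₀ * h₀ ≤ 1.43 * δ
  second_order : δ ≤ 0.39 → 7 * h₅ ≤ 5 * h₂
  ub₁ : 2 * h₀ + 5 * h₂ - 7 * h₅ ≤ ub
  ub₂ : 2 * h₀ + 5 * h₂ - 7 * h₅ + 0.625 * (2 * h₅ - h₂) ≤ ub
  ub₃ : 2 * h₀ + 5 * h₂ - 7 * h₅ + 0.625 * (2 * h₅ - h₂ + 0.17 * (7 * h₅ - 5 * h₂)) ≤ ub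
  small : δ ≤ 0.34 → ub ≤ 0.92 + 2.6 * δ
  large : 0.33 ≤ δ → 2 * ub ≤ 1 + 6.9 * δ
  ub_le : 2 * ub ≤ 52 * (δ - h₅)
  ub_le_two : ub ≤ 2.02
  ub_pos : 0 < ub

/-- On a short interval [p, q] the bounds h are affine in r, while δ is quadratic. Enclosing δ by
its chord from above and by tangents at p, q and the midpoint from below makes all but one of the
conditions linear; `le_zero` is checked directly. The bound `ub` is the maximum of three affine
expressions, so H is asked for each. -/
theorem hockeyProfile_of_affine {r δ p q a₂ b₂ a₅ b₅ : ℝ} (hp : p ≤ r) (hq : r ≤ q)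
    (hδ : δ = 0.11157 * r ^ 2)
    (H : ∀ ub, δ ≤ 0.11157 * ((p + q) * r - p * q) → 0.11157 * (2 * p * r - p ^ 2) ≤ δ →
      0.11157 * (2 * q * r - q ^ 2) ≤ δ → 0.11157 * ((p + q) * r - ((p + q) / 2) ^ 2) ≤ δ →
      (ub = 2 * (0.39895 * r) + 5 * (a₂ + b₂ * r) - 7 * (a₅ + b₅ * r) ∨
        ub = 2 * (0.39895 * r) + 5 * (a₂ + b₂ * r) - 7 * (a₅ + b₅ * r) + 0.625 * (2 * (a₅ + b₅ * r)
            - (a₂ + b₂ * r)) ∨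
        ub = 2 * (0.39895 * r) + 5 * (a₂ + b₂ * r) - 7 * (a₅ + b₅ * r)
          + 0.625 * (2 * (a₅ + b₅ * r) - (a₂ + b₂ * r) + 0.17 *
              (7 * (a₅ + b₅ * r) - 5 * (a₂ + b₂ * r)))) →
      0 ≤ (a₅ + b₅ * r) ∧ (a₅ + b₅ * r) ≤ (a₂ + b₂ * r) ∧ (a₅ + b₅ * r) ≤ δ - 0.067 ∧ 0.39895 * r -
          (a₅ + b₅ * r) ≤ 0.435 ∧
      5 * (a₂ + b₂ * r) ≤ 3 * (0.39895 * r) + 2 * (a₅ + b₅ * r) ∧ 0.39895 * r - (a₂ + b₂ * r) ≤ 0.31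
          ∧
      (δ ≤ 0.39 → 7 * (a₅ + b₅ * r) ≤ 5 * (a₂ + b₂ * r)) ∧ (δ ≤ 0.34 → ub ≤ 0.92 + 2.6 * δ) ∧
      (0.33 ≤ δ → 2 * ub ≤ 1 + 6.9 * δ) ∧ 2 * ub ≤ 52 * (δ - (a₅ + b₅ * r)) ∧ ub ≤ 2.02 ∧ 0 < ub) :
    ∃ ub, HockeyProfile δ (0.39895 * r) (a₂ + b₂ * r) (a₅ + b₅ * r) ub := by
  have c1 : δ ≤ 0.11157 * ((p + q) * r - p * q) := by
    nlinarith [mul_nonneg (sub_nonneg.2 hp) (sub_nonneg.2 hq)]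
  have c2 : 0.11157 * (2 * p * r - p ^ 2) ≤ δ := by nlinarith [sq_nonneg (r - p)]
  have c3 : 0.11157 * (2 * q * r - q ^ 2) ≤ δ := by nlinarith [sq_nonneg (r - q)]
  have c4 : 0.11157 * ((p + q) * r - ((p + q) / 2) ^ 2) ≤ δ := by
    nlinarith [sq_nonneg (r - (p + q) / 2)]
  have key := fun ub => H ub c1 c2 c3 c4
  obtain ⟨k1, k2, k3, k4, k5, k6, k7, -⟩ := key _ (Or.inl rfl)
  set u₁ := 2 * (0.39895 * r) + 5 * (a₂ + b₂ * r) - 7 * (a₅ + b₅ * r)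
  set u₂ := u₁ + 0.625 * (2 * (a₅ + b₅ * r) - (a₂ + b₂ * r))
  set u₃ := u₁ + 0.625 * (2 * (a₅ + b₅ * r) - (a₂ + b₂ * r)
    + 0.17 * (7 * (a₅ + b₅ * r) - 5 * (a₂ + b₂ * r)))
  have hub : max (max u₁ u₂) u₃ = u₁ ∨ max (max u₁ u₂) u₃ = u₂ ∨ max (max u₁ u₂) u₃ = u₃ := by
    rcases max_choice (max u₁ u₂) u₃ with h | h
    · rcases max_choice u₁ u₂ with h' | h' <;> rw [h, h'] <;> simp
    · simp [h]
  obtain ⟨-, -, -, -, -, -, -, l1, l2, l3, l4, l5⟩ := key _ hub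
  exact ⟨max (max u₁ u₂) u₃, k1, k2, k3, k4, k5, k6, by rw [hδ]; nlinarith [sq_nonneg r], k7,
    le_max_of_le_left (le_max_left _ _), le_max_of_le_left (le_max_right _ _), le_max_right _ _,
    l1, l2, l3, l4, l5⟩

theorem normalDensity_zero_le : normalDensity 0 ≤ 0.39895 := by
  have := inv_sqrt_two_pi_bounds.2
  rw [normalDensity]
  simp only [ne_eq, OfNat.ofNat_ne_zero, not_false_eq_true, zero_pow, neg_zero, zero_div,
    Real.exp_zero, mul_one]
  norm_num at this ⊢
  linarith

-- The range of r is split into six intervals. On each, chords between anchors give affine upper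
-- bounds by convexity; beyond the last anchor the slope φ(0) ≤ 0.39895 is used instead.
set_option maxHeartbeats 4000000 in
theorem exists_hockeyProfile {r δ : ℝ} (h1 : 0.85 ≤ r) (h2 : r ≤ 3) (hδ : δ = 0.11157 * r ^ 2) :
    ∃ h₀ h₂ h₅ ub, hockeyMajorant (Real.log 1) r ≤ h₀ ∧ hockeyMajorant (Real.log 3) r ≤ h₂ ∧
      hockeyMajorant (Real.log 6) r ≤ h₅ ∧ HockeyProfile δ h₀ h₂ h₅ ub := by
  have n0 := normalDensity_zero_le
  have b0 : hockeyMajorant (Real.log 1) r ≤ 0.39895 * r := by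
    refine (hockeyMajorant_le_mul (by linarith)).trans ?_
    rw [mul_comm]; gcongr
  obtain ⟨s1, s2, s3, s4, s5, s6⟩ := hockeyMajorant_log_six_anchors
  obtain ⟨t1, t2, t3, t4⟩ := hockeyMajorant_log_three_anchors
  have chord : ∀ ℓ p q u v a b : ℝ, 0 ≤ ℓ → 0 < p → p < q → p ≤ r → r ≤ q →
      hockeyMajorant ℓ p ≤ u → hockeyMajorant ℓ q ≤ v → u ≤ a + b * p → v ≤ a + b * q →
      hockeyMajorant ℓ r ≤ a + b * r := by
    intro ℓ p q u v a b hℓ hp hpq hpr hrq hu hv hu' hv'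
    have := hockeyMajorant_le_chord hℓ hp hpr hrq
    have h1 := mul_le_mul_of_nonneg_left (hu.trans hu') (sub_nonneg.2 hrq)
    have h2 := mul_le_mul_of_nonneg_left (hv.trans hv') (sub_nonneg.2 hpr)
    have : (q - p) * hockeyMajorant ℓ r ≤ (q - p) * (a + b * r) := by linarith
    exact le_of_mul_le_mul_left this (by linarith)
  have slope : ∀ ℓ p u a : ℝ, p ≤ r → hockeyMajorant ℓ p ≤ u → u ≤ a + 0.39895 * p →
      hockeyMajorant ℓ r ≤ a + 0.39895 * r := by
    intro ℓ p u a hp hu hu'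
    have := hockeyMajorant_le_add (ℓ := ℓ) hp
    have : (r - p) * normalDensity 0 ≤ (r - p) * 0.39895 :=
      mul_le_mul_of_nonneg_left n0 (by linarith)
    linarith
  have hl3 : (0 : ℝ) ≤ Real.log 3 := Real.log_nonneg (by norm_num)
  have hl6 : (0 : ℝ) ≤ Real.log 6 := Real.log_nonneg (by norm_num)
  have piece : ∀ {p q a₂ b₂ a₅ b₅ : ℝ}, p ≤ r → r ≤ q →
      hockeyMajorant (Real.log 3) r ≤ a₂ + b₂ * r → hockeyMajorant (Real.log 6) r ≤ a₅ + b₅ * r →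
      (∃ ub, HockeyProfile δ (0.39895 * r) (a₂ + b₂ * r) (a₅ + b₅ * r) ub) →
      ∃ h₀ h₂ h₅ ub, hockeyMajorant (Real.log 1) r ≤ h₀ ∧ hockeyMajorant (Real.log 3) r ≤ h₂ ∧
      hockeyMajorant (Real.log 6) r ≤ h₅ ∧ HockeyProfile δ h₀ h₂ h₅ ub :=
    fun _ _ k2 k5 ⟨ub, H⟩ => ⟨_, _, _, ub, b0, k2, k5, H⟩
  rcases le_total r 1 with hq | hq'
  · have hp := h1
    refine piece hp hq
      (chord _ 0.85 1 _ _ (-0.1951) 0.305 hl3 (by norm_num) (by norm_num) hp hq t1 t2 (by norm_num)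
          (by norm_num))
      (chord _ 0.85 1 _ _ (-0.1024) 0.135 hl6 (by norm_num) (by norm_num) hp hq s1 s2 (by norm_num)
          (by norm_num))
      (hockeyProfile_of_affine hp hq hδ ?_)
    clear piece chord slope n0 b0 s1 s2 s3 s4 s5 s6 t1 t2 t3 t4 hl3 hl6 hδ h1 h2
    intro ub c1 c2 c3 c4 hub
    rcases hub with rfl | rfl | rfl <;> and_intros <;> intros <;> linarith
  have hp := hq'
  clear hq'
  rcases le_total r 1.25 with hq | hq'
  · refine piece hp hq
      (chord _ 1 1.25 _ _ (-0.254) 0.364 hl3 (by norm_num) (by norm_num) hp hq t2 t3 (by norm_num)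
          (by norm_num))
      (chord _ 1 1.25 _ _ (-0.2015) 0.234 hl6 (by norm_num) (by norm_num) hp hq s2 s3 (by norm_num)
          (by norm_num))
      (hockeyProfile_of_affine hp hq hδ ?_)
    clear piece chord slope n0 b0 s1 s2 s3 s4 s5 s6 t1 t2 t3 t4 hl3 hl6 hδ h1 h2
    intro ub c1 c2 c3 c4 hub
    rcases hub with rfl | rfl | rfl <;> and_intros <;> intros <;> linarith
  have hp := hq'
  clear hq'
  rcases le_total r 1.48 with hq | hq'
  · refine piece hp hq
      (chord _ 1.25 1.48 _ _ (-0.2927) 0.395 hl3 (by norm_num) (by norm_num) hp hq t3 t4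
          (by norm_num) (by norm_num))
      (chord _ 1.25 1.48 _ _ (-0.3153) 0.325 hl6 (by norm_num) (by norm_num) hp hq s3 s4
          (by norm_num) (by norm_num))
      (hockeyProfile_of_affine hp hq hδ ?_)
    clear piece chord slope n0 b0 s1 s2 s3 s4 s5 s6 t1 t2 t3 t4 hl3 hl6 hδ h1 h2
    intro ub c1 c2 c3 c4 hub
    rcases hub with rfl | rfl | rfl <;> and_intros <;> intros <;> linarith
  have hp := hq'
  clear hq'
  rcases le_total r 1.7 with hq | hq'
  · refine piece hp hq
      (slope _ 1.48 _ (-0.2986) (by linarith) t4 (by norm_num))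
      (chord _ 1.48 1.7 _ _ (-0.3907) 0.376 hl6 (by norm_num) (by norm_num) hp hq s4 s5
          (by norm_num) (by norm_num))
      (hockeyProfile_of_affine hp hq hδ ?_)
    clear piece chord slope n0 b0 s1 s2 s3 s4 s5 s6 t1 t2 t3 t4 hl3 hl6 hδ h1 h2
    intro ub c1 c2 c3 c4 hub
    rcases hub with rfl | rfl | rfl <;> and_intros <;> intros <;> linarith
  have hp := hq'
  clear hq'
  rcases le_total r 1.89 with hq | hq'
  · refine piece hp hq
      (slope _ 1.48 _ (-0.2986) (by linarith) t4 (by norm_num))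
      (chord _ 1.7 1.89 _ _ (-0.4246) 0.396 hl6 (by norm_num) (by norm_num) hp hq s5 s6
          (by norm_num) (by norm_num))
      (hockeyProfile_of_affine hp hq hδ ?_)
    clear piece chord slope n0 b0 s1 s2 s3 s4 s5 s6 t1 t2 t3 t4 hl3 hl6 hδ h1 h2
    intro ub c1 c2 c3 c4 hub
    rcases hub with rfl | rfl | rfl <;> and_intros <;> intros <;> linarith
  have hp := hq'
  clear hq'
  · have hq := h2
    refine piece hp hq
      (slope _ 1.48 _ (-0.2986) (by linarith) t4 (by norm_num))
      (slope _ 1.89 _ (-0.4302) (by linarith) s6 (by norm_num))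
      (hockeyProfile_of_affine hp hq hδ ?_)
    clear piece chord slope n0 b0 s1 s2 s3 s4 s5 s6 t1 t2 t3 t4 hl3 hl6 hδ h1 h2
    intro ub c1 c2 c3 c4 hub
    rcases hub with rfl | rfl | rfl <;> and_intros <;> intros <;> linarith

end Profile

/-! ### Elementary estimates for the second-moment bound -/

section Elementary

theorem convexOn_exp_chord {a c : ℝ} (ha : 0 ≤ a) (hac : a ≤ c) (hc : 0 < c) :
    (Real.exp a - 1) * c ≤ a * (Real.exp c - 1) := by
  have hac' : 0 ≤ 1 - a / c := by rw [sub_nonneg, div_le_one hc]; exact hac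
  have h := convexOn_exp.2 (Set.mem_univ 0) (Set.mem_univ c) hac' (div_nonneg ha hc.le)
    (sub_add_cancel 1 (a / c))
  simp only [smul_eq_mul, mul_zero, zero_add, Real.exp_zero, mul_one] at h
  rw [div_mul_cancel₀ _ hc.ne'] at h
  have e : (1 - a / c + a / c * Real.exp c) * c = c - a + a * Real.exp c := by
    field_simp
  nlinarith [mul_le_mul_of_nonneg_right h hc.le]

theorem exp_tenth_le : Real.exp (1 / 10) ≤ 1.105171 := by
  have := Real.exp_bound' (x := 1 / 10) (by norm_num) (by norm_num) (n := 6) (by norm_num)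
  norm_num [Finset.sum_range_succ, Nat.factorial] at this ⊢
  linarith

theorem exp_div_ten_le (n : ℕ) : Real.exp (n / 10) ≤ 1.105171 ^ n := by
  rw [show (n / 10 : ℝ) = n * (1 / 10) by ring, Real.exp_nat_mul]
  gcongr
  exact exp_tenth_le

theorem exp_mul_le_exp_mul {x y : ℝ} (hx : 1 ≤ x) (hxy : x ≤ y) :
    Real.exp x * y ≤ Real.exp y * x := by
  have h := Real.add_one_le_exp (y - x)
  have e : Real.exp y = Real.exp x * Real.exp (y - x) := by rw [← Real.exp_add]; ring_nf
  rw [e, mul_assoc]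
  refine mul_le_mul_of_nonneg_left ?_ (Real.exp_pos x).le
  nlinarith

/-- On p ≤ t ≤ q, the factor 1 - t is largest at p. Since e^y/y increases for y ≥ 1, it is bounded
by its value at n/10, which reduces the inequality to one numerical comparison per interval. -/
theorem one_sub_mul_exp_le {t y p q m X : ℝ} (n : ℕ) (hy : 1 ≤ y) (hX : 0 ≤ X) (hyt : y ≤ X * t ^ 2)
    (ht : 0 ≤ t) (hpt : p ≤ t) (htq : t ≤ q) (hp : p ≤ 1) (hq : X * q ^ 2 ≤ n / 10)
    (hm : (1 - p) * 1.105171 ^ n ≤ m * (n / 10)) : (1 - t) * Real.exp y ≤ m * y := by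
  have hyn : y ≤ n / 10 := hyt.trans (le_trans (by gcongr) hq)
  have h1 := exp_mul_le_exp_mul hy hyn
  have h2 := exp_div_ten_le n
  have hn : (0 : ℝ) < n / 10 := by linarith
  refine le_of_mul_le_mul_right ?_ hn
  calc (1 - t) * Real.exp y * (n / 10) = (1 - t) * (Real.exp y * (n / 10)) := by ring
    _ ≤ (1 - p) * (Real.exp y * (n / 10)) := by gcongr
    _ ≤ (1 - p) * (1.105171 ^ n * y) := by
        refine mul_le_mul_of_nonneg_left (h1.trans ?_) (by linarith)
        gcongr
    _ ≤ m * y * (n / 10) := by nlinarith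

theorem one_sub_mul_exp_le_of_le_one {t y : ℝ} (ht : 0 ≤ t) (hy : 1.386 ≤ y)
    (hyt : y ≤ 3.875 ^ 2 / 2 * t ^ 2) (ht1 : t ≤ 1) : (1 - t) * Real.exp y ≤ 10.43 * y := by
  have h1 : (1 : ℝ) ≤ y := by linarith
  have h0 : 0.4296 ≤ t := by nlinarith
  rcases le_total t 0.75 with h | h
  · exact one_sub_mul_exp_le 43 h1 (by norm_num) hyt ht h0 h (by norm_num) (by norm_num) (by
        norm_num)
  rcases le_total t 0.845 with h' | h'
  · exact one_sub_mul_exp_le 54 h1 (by norm_num) hyt ht h h' (by norm_num) (by norm_num) (by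
        norm_num)
  clear h
  rcases le_total t 0.893 with h | h
  · exact one_sub_mul_exp_le 60 h1 (by norm_num) hyt ht h' h (by norm_num) (by norm_num) (by
        norm_num)
  clear h'
  rcases le_total t 0.923 with h' | h'
  · exact one_sub_mul_exp_le 64 h1 (by norm_num) hyt ht h h' (by norm_num) (by norm_num) (by
        norm_num)
  clear h
  rcases le_total t 0.951 with h | h
  · exact one_sub_mul_exp_le 68 h1 (by norm_num) hyt ht h' h (by norm_num) (by norm_num) (by
        norm_num)
  clear h'
  rcases le_total t 0.979 with h' | h'
  · exact one_sub_mul_exp_le 72 h1 (by norm_num) hyt ht h h' (by norm_num) (by norm_num) (by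
        norm_num)
  exact one_sub_mul_exp_le 76 h1 (by norm_num) hyt ht h' ht1 (by norm_num) (by norm_num) (by
      norm_num)

theorem one_sub_mul_exp_le_of_le_sixteenth {t y : ℝ} (ht : 0 ≤ t) (hy : 1.386 ≤ y)
    (hyt : y ≤ 13 ^ 2 / 32 * t ^ 2) (ht1 : t ≤ 1) : (1 - t) * Real.exp y ≤ 4.71 * y := by
  have h1 : (1 : ℝ) ≤ y := by linarith
  have h0 : 0.512 ≤ t := by nlinarith
  rcases le_total t 0.8 with h | h
  · exact one_sub_mul_exp_le 34 h1 (by norm_num) hyt ht h0 h (by norm_num) (by norm_num) (by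
        norm_num)
  rcases le_total t 0.93 with h' | h'
  · exact one_sub_mul_exp_le 46 h1 (by norm_num) hyt ht h h' (by norm_num) (by norm_num) (by
        norm_num)
  exact one_sub_mul_exp_le 53 h1 (by norm_num) hyt ht h' ht1 (by norm_num) (by norm_num) (by
      norm_num)

theorem mul_exp_neg_mul_le {a x : ℝ} (ha : 0 < a) :
    x * Real.exp (-(a * x)) ≤ 1 / (Real.exp 1 * a) := by
  have h := Real.add_one_le_exp (a * x - 1)
  have e : Real.exp (a * x - 1) = Real.exp (a * x) / Real.exp 1 := Real.exp_sub _ _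
  rw [le_div_iff₀ (by positivity), Real.exp_neg, ← div_eq_mul_inv, div_mul_eq_mul_div,
    div_le_one (Real.exp_pos _)]
  rw [e, le_div_iff₀ (Real.exp_pos 1)] at h
  linarith

/-- The second-moment bound is at most `T g Δ + exp (-(T s ^ 2 / 2))`. -/
theorem chi_bound_le {T : ℕ} {g v V b s S Δ k m : ℝ} (hT : 1 ≤ T) (hg : 0 < g) (hv : 0 < v)
    (hvV : v ≤ V) (hV : 1 ≤ V) (hs : 0 ≤ s) (hS : s + g ≤ S) (hgS : g * v ≤ S)
    (hb : 0 < b) (hvΔ : v ≤ 4 * b * Δ) (hk : k = 2 / V - 1 / V ^ 2) (hk0 : 0 < k)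
    (hm : m ≤ 4 * Real.exp 1 * k)
    (hnum : ∀ t y : ℝ, 0 ≤ t → 1.386 ≤ y → y ≤ b ^ 2 / (2 * T) * t ^ 2 → t ≤ 1 →
      (1 - t) * Real.exp y ≤ m * y) :
    ((1 + g ^ 2 * v) ^ T - 1) / (4 * (Real.exp (T * g * S) - 1))
      ≤ T * g * Δ + Real.exp (-(T * s ^ 2 / 2)) := by
  have hT0 : (0 : ℝ) < T := by exact_mod_cast hT
  have hS0 : 0 < S := by linarith
  set l := g * v / S with hl
  have hl0 : 0 < l := by positivity
  have hl1 : l ≤ 1 := by rw [hl, div_le_one hS0]; exact hgS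
  -- By convexity, (e^x - 1)/x is increasing, so the quotient of exponentials is at most the
  -- quotient of exponents, l.
  have step1 : ((1 + g ^ 2 * v) ^ T - 1) / (4 * (Real.exp (T * g * S) - 1)) ≤ l / 4 := by
    have hc : 0 < T * g * S := by positivity
    have h1 : (1 + g ^ 2 * v) ^ T ≤ Real.exp (T * (g ^ 2 * v)) := by
      rw [Real.exp_nat_mul]
      gcongr
      linarith [Real.add_one_le_exp (g ^ 2 * v)]
    have h2 := convexOn_exp_chord (a := T * (g ^ 2 * v)) (c := T * g * S) (by positivity)
      (by nlinarith [mul_le_mul_of_nonneg_left hgS (mul_pos hT0 hg).le]) hc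
    have h3 : 0 < Real.exp (T * g * S) - 1 := by linarith [Real.add_one_lt_exp hc.ne']
    rw [div_le_div_iff₀ (by positivity) (by norm_num)]
    have h4 : (Real.exp (T * (g ^ 2 * v)) - 1) ≤ l * (Real.exp (T * g * S) - 1) := by
      refine le_of_mul_le_mul_right (h2.trans (le_of_eq ?_)) hc
      rw [hl]; field_simp
    linarith
  refine step1.trans ?_
  set z := T * S with hz
  have hz0 : 0 < z := by positivity
  have step2 : l * z / (4 * b) ≤ T * g * Δ := by
    rw [div_le_iff₀ (by positivity)]
    have : l * z = T * g * v := by rw [hl, hz]; field_simp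
    rw [this]
    nlinarith [mul_le_mul_of_nonneg_left hvΔ (mul_pos hT0 hg).le]
  -- The budget TgΔ pays for the part l z/(4b); the rest must fit under e^(-Ts²/2), and is not
  -- positive once z ≥ b.
  suffices h : l / 4 * (1 - z / b) ≤ Real.exp (-(T * s ^ 2 / 2)) by
    have : l / 4 * (1 - z / b) = l / 4 - l * z / (4 * b) := by field_simp
    linarith
  rcases le_total 1 (z / b) with hzb | hzb
  · have : l / 4 * (1 - z / b) ≤ 0 := mul_nonpos_of_nonneg_of_nonpos (by positivity) (by linarith)
    exact this.trans (Real.exp_pos _).le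
  set y := z ^ 2 / (2 * T) with hy
  have hy0 : 0 ≤ y := by positivity
  -- S exceeds s by at least g ≥ gv/V = S l/V. Thus a large l forces s well below S, and the
  -- exponential term gains the factor e^(kyl).
  have hsle : s ≤ S * (1 - l / V) := by
    have : S * (l / V) = g * (v / V) := by rw [hl]; field_simp
    have h2 : g * (v / V) ≤ g := by
      refine mul_le_of_le_one_right hg.le ?_
      rw [div_le_one (by linarith)]; exact hvV
    nlinarith
  have hE : T * s ^ 2 / 2 ≤ y * (1 - k * l) := by
    have h1 : s ^ 2 ≤ (S * (1 - l / V)) ^ 2 := by gcongr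
    have h2 : (1 - l / V) ^ 2 ≤ 1 - k * l := by
      have e : 1 - k * l - (1 - l / V) ^ 2 = l * (1 - l) / V ^ 2 := by
        rw [hk]; field_simp; ring
      have : 0 ≤ l * (1 - l) / V ^ 2 := by
        have := sub_nonneg.2 hl1
        positivity
      linarith
    have e : y = T * S ^ 2 / 2 := by rw [hy, hz]; field_simp
    rw [e]
    have h3 : s ^ 2 ≤ S ^ 2 * (1 - k * l) := by
      rw [mul_pow] at h1
      exact h1.trans (by gcongr)
    nlinarith
  refine le_trans ?_ (Real.exp_le_exp.2 (neg_le_neg hE))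
  have e : Real.exp (-(y * (1 - k * l))) = Real.exp (k * y * l) / Real.exp y := by
    rw [← Real.exp_sub]; congr 1; ring
  rw [e, le_div_iff₀ (Real.exp_pos y)]
  have hzb0 : 0 ≤ z / b := by positivity
  -- 1.386 < 2 log 2, so e^y ≤ 4 absorbs the factor 1/4 below this point; above it, `hnum` is
  -- combined with l e^(-kyl) ≤ 1/(e k y).
  rcases le_total y 1.386 with h | h
  · have h4 : Real.exp y ≤ 4 := by
      rw [← Real.le_log_iff_exp_le (by norm_num), show (4 : ℝ) = 2 ^ 2 by norm_num, Real.log_pow]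
      have := Real.log_two_gt_d9
      norm_num at this h ⊢
      linarith
    have h5 : 1 ≤ Real.exp (k * y * l) := Real.one_le_exp (by positivity)
    have h6 : l * (1 - z / b) ≤ 1 := mul_le_one₀ hl1 (by linarith) (by linarith)
    calc l / 4 * (1 - z / b) * Real.exp y = l * (1 - z / b) * (Real.exp y / 4) := by ring
      _ ≤ 1 * 1 := by gcongr; linarith
      _ ≤ _ := by linarith
  · have hy1 : 0 < y := by linarith
    have h1 := hnum (z / b) y hzb0 h (le_of_eq (by rw [hy]; field_simp)) hzb
    have h2 := mul_exp_neg_mul_le (a := k * y) (x := l) (by positivity)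
    rw [Real.exp_neg, ← div_eq_mul_inv, div_le_iff₀ (Real.exp_pos _)] at h2
    have h3 : 0 ≤ 1 - z / b := by linarith
    calc l / 4 * (1 - z / b) * Real.exp y = l / 4 * ((1 - z / b) * Real.exp y) := by ring
      _ ≤ l / 4 * (m * y) := by gcongr
      _ ≤ l / 4 * (4 * Real.exp 1 * k * y) := by gcongr
      _ = l * (Real.exp 1 * (k * y)) := by ring
      _ ≤ (1 / (Real.exp 1 * (k * y)) * Real.exp (k * y * l)) * (Real.exp 1 * (k * y)) := by
          gcongr
      _ = Real.exp (k * y * l) := by field_simp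

/-- This is -log(1 - x) ≥ x + x²/2: a nontrivial budget forces the deviation parameter to be large
compared with the additive error already spent. -/
theorem sq_ge_of_exp_neg_lt {T x s : ℝ} (hx : 0 ≤ x) (h : x + Real.exp (-(T * s ^ 2 / 2)) ≤ 1) :
    2 * x + x ^ 2 ≤ T * s ^ 2 := by
  have hx1 : x < 1 := by linarith [Real.exp_pos (-(T * s ^ 2 / 2))]
  set u := T * s ^ 2 / 2
  have h1 : Real.exp (-u) ≤ 1 - x := by linarith
  have h2 : 1 ≤ (1 - x) * Real.exp u := by
    have := mul_le_mul_of_nonneg_right h1 (Real.exp_pos u).le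
    rwa [← Real.exp_add, neg_add_cancel, Real.exp_zero] at this
  have h3 : (1 - x) * Real.exp (x + x ^ 2 / 2) ≤ 1 := by
    have hd : ∀ y : ℝ, HasDerivAt (fun y => (1 - y) * Real.exp (y + y ^ 2 / 2))
        (-(y ^ 2) * Real.exp (y + y ^ 2 / 2)) y := by
      intro y
      have a1 : HasDerivAt (fun y : ℝ => 1 - y) (-1) y := by
        simpa using (hasDerivAt_id y).const_sub 1
      have a2 : HasDerivAt (fun y : ℝ => y + y ^ 2 / 2) (1 + y) y := by
        refine ((hasDerivAt_id y).add ((hasDerivAt_pow 2 y).div_const 2)).congr_deriv ?_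
        push_cast; ring
      refine (a1.mul a2.exp).congr_deriv ?_
      ring
    have hanti : Antitone (fun y : ℝ => (1 - y) * Real.exp (y + y ^ 2 / 2)) :=
      antitone_of_hasDerivAt_nonpos hd fun y => by
        exact mul_nonpos_of_nonpos_of_nonneg (neg_nonpos.2 (sq_nonneg y)) (Real.exp_pos _).le
    simpa using hanti hx
  have h4 : Real.exp (x + x ^ 2 / 2) ≤ Real.exp u :=
    le_of_mul_le_mul_left (h3.trans h2) (by linarith)
  have := Real.exp_le_exp.1 h4
  simp only [u] at this
  linarith

/-- Factor out e^(y/2) and use the chord of exp up to 0.36125 = 0.85²/2. The constant becomes 15.5 δ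
when y = r², which is the v of `chi_bound_le`. -/
theorem two_mul_exp_sub_le {y : ℝ} (hy : 0 ≤ y) (hy1 : y ≤ 0.7225) :
    2 * Real.exp y - 2 * Real.exp (y / 2) ≤ 15.5 * 0.11157 * y := by
  have e : Real.exp y = Real.exp (y / 2) * Real.exp (y / 2) := by
    rw [← Real.exp_add]; ring_nf
  have hy2 : y / 2 ≤ 0.36125 := by norm_num at *; linarith
  have h1 := convexOn_exp_chord (a := y / 2) (c := 0.36125) (by linarith) hy2 (by norm_num)
  have h2 : Real.exp (y / 2) ≤ Real.exp 0.36125 :=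
    Real.exp_le_exp.2 hy2
  have h3 : Real.exp 0.36125 ≤ 1.435123 := by
    have := Real.exp_bound' (x := 0.36125) (by norm_num) (by norm_num) (n := 8) (by norm_num)
    norm_num [Finset.sum_range_succ, Nat.factorial] at this ⊢
    linarith
  set c := Real.exp 0.36125
  set w := Real.exp (y / 2)
  have hw : 1 ≤ w := Real.one_le_exp (by linarith)
  have h4 : (w - 1) * 0.36125 ≤ y / 2 * 0.435123 := by
    refine h1.trans ?_
    gcongr; norm_num at h3 ⊢; linarith
  have h5 : w ≤ 1.435123 := h2.trans h3
  rw [e]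
  have h6 : w * ((w - 1) * 0.36125) ≤ 1.435123 * (y / 2 * 0.435123) :=
    mul_le_mul h5 h4 (mul_nonneg (by linarith) (by norm_num)) (by norm_num)
  norm_num at h6 ⊢
  linarith

end Elementary

/-! ### Privacy of the trajectory from second moments -/

theorem add_pow_sub_pow_le {x V : ℝ} (hx : 0 ≤ x) (hx1 : x ≤ 1) (hV : 0 ≤ V) (T : ℕ) :
    (x + V) ^ T - x ^ T ≤ (1 + V) ^ T - 1 := by
  induction T with
  | zero => simp
  | succ T ih =>
    have h1 : (x + V) ^ (T + 1) - x ^ (T + 1) = (x + V) * ((x + V) ^ T - x ^ T) + V * x ^ T := by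
      ring
    have h2 : (1 + V) ^ (T + 1) - 1 = (1 + V) * ((1 + V) ^ T - 1) + V * 1 := by ring
    rw [h1, h2]
    have h3 : 0 ≤ (x + V) ^ T - x ^ T := by
      rw [sub_nonneg]; gcongr; linarith
    have h4 : (x + V) * ((x + V) ^ T - x ^ T) ≤ (1 + V) * ((1 + V) ^ T - 1) := by gcongr
    have h5 : V * x ^ T ≤ V * 1 := by gcongr; exact pow_le_one₀ hx hx1
    linarith

section SecondMoment

variable {N w s l d m : ℕ}

/-- Composition when the likelihood ratio of each round is dominated by a finite law with mean at
most one and second moment about one at most `V`. -/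
theorem trajectory_real_le_of_secondMoment (A : Config (w + s + l) d m) (hBN : A.batchSize ≤ N)
    {D D' : OPFDataset N w s l m} {K c V : ℝ} (hK : 1 < K) {ι : Type*} [Fintype ι]
    (p v : ι → ℝ) (hp : ∀ j, 0 ≤ p j) (hv : ∀ j, 0 ≤ v j) (hc : 0 ≤ c) (hp1 : ∑ j, p j = 1)
    (hpv : ∑ j, p j * v j ≤ 1) (hV : ∑ j, p j * (v j - 1) ^ 2 ≤ V)
    (hstep : ∀ θ, ∀ X : Set (Params d), MeasurableSet X → ∀ y, 0 ≤ y →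
      ((batchLaw N A.batchSize).prod (noiseLaw A)).real {p | update A D θ p.1 p.2 ∈ X}
        ≤ y * ((batchLaw N A.batchSize).prod (noiseLaw A)).real {p | update A D' θ p.1 p.2 ∈ X}
          + (∑ j, p j * max (v j - y) 0 + c)) (T : ℕ)
    {X : Set (Fin (T + 1) → Params d)} (hX : MeasurableSet X) :
    (trajectoryLaw A D T).real X ≤ K * (trajectoryLaw A D' T).real X
      + (T * c + ((1 + V) ^ T - 1) / (4 * (K - 1))) := by
  set m₁ := ∑ j, p j * v j with hm1
  set m₂ := ∑ j, p j * v j ^ 2 with hm2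
  have hm10 : 0 ≤ m₁ := Finset.sum_nonneg fun j _ => mul_nonneg (hp j) (hv j)
  have hV' : m₂ - 2 * m₁ + 1 ≤ V := by
    refine le_trans (le_of_eq ?_) hV
    have e : ∀ j, p j * (v j - 1) ^ 2 = p j * v j ^ 2 - 2 * (p j * v j) + p j := fun j => by ring
    simp only [e, Finset.sum_add_distrib, Finset.sum_sub_distrib, ← Finset.mul_sum, hp1]
    rw [← hm1, ← hm2]
  have hvar : 0 ≤ m₂ - m₁ ^ 2 := by
    have : ∑ j, p j * (v j - m₁) ^ 2 = m₂ - m₁ ^ 2 := by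
      have e : ∀ j, p j * (v j - m₁) ^ 2 = p j * v j ^ 2 - 2 * m₁ * (p j * v j) + m₁ ^ 2 * p j :=
        fun j => by ring
      simp only [e, Finset.sum_add_distrib, Finset.sum_sub_distrib, ← Finset.mul_sum, hp1]
      rw [← hm1, ← hm2]; ring
    rw [← this]
    exact Finset.sum_nonneg fun j _ => mul_nonneg (hp j) (sq_nonneg _)
  set a := m₁ ^ T with ha
  have ha1 : a ≤ 1 := pow_le_one₀ hm10 hpv
  have hKa : 0 < K - a := by linarith
  -- The quadratic majorant (x - K)₊ ≤ (x - a)²/(4(K - a)) is used, with a = m₁^T the mean of the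
  -- product of T atoms. Its expectation depends only on the two moments, and at T and z = 1 the
  -- numerator is the variance of the product.
  have h := trajectory_hockeyBound A hBN (K := K) (by linarith) p v hp hv hc hpv hstep
    (fun t z => (m₂ ^ t * z ^ 2 - 2 * a * m₁ ^ t * z + a ^ 2) / (4 * (K - a)))
    (fun z hz => by
      refine max_le ?_ ?_
      · rw [le_div_iff₀ (by positivity)]
        nlinarith [sq_nonneg (z - K - (K - a))]
      · refine div_nonneg ?_ (by positivity)
        nlinarith [sq_nonneg (z - a)])
    (fun t z hz => by
      refine le_of_eq ?_
      have e : ∀ j, p j * ((m₂ ^ t * (z * v j) ^ 2 - 2 * a * m₁ ^ t * (z * v j) + a ^ 2)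
          / (4 * (K - a))) = (m₂ ^ t * z ^ 2 * (p j * v j ^ 2) - 2 * a * m₁ ^ t * z * (p j * v j)
          + a ^ 2 * p j) / (4 * (K - a)) := fun j => by ring
      simp only [e, ← Finset.sum_div, Finset.sum_add_distrib, Finset.sum_sub_distrib,
        ← Finset.mul_sum, hp1]
      rw [← hm1, ← hm2]; ring) T
  have h1 := h 1 zero_le_one X hX
  have h2 : (m₂ ^ T * 1 ^ 2 - 2 * a * m₁ ^ T * 1 + a ^ 2) / (4 * (K - a))
      ≤ ((1 + V) ^ T - 1) / (4 * (K - 1)) := by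
    have h3 := add_pow_sub_pow_le (sq_nonneg m₁) (pow_le_one₀ hm10 hpv) hvar T
    have h4 : (1 + (m₂ - m₁ ^ 2)) ^ T ≤ (1 + V) ^ T := by
      gcongr
      nlinarith [sq_nonneg (m₁ - 1)]
    have h5 : m₂ ^ T * 1 ^ 2 - 2 * a * m₁ ^ T * 1 + a ^ 2
        = (m₁ ^ 2 + (m₂ - m₁ ^ 2)) ^ T - (m₁ ^ 2) ^ T := by
      rw [add_sub_cancel, ha]; ring
    rw [h5]
    have h6 : 0 ≤ (m₁ ^ 2 + (m₂ - m₁ ^ 2)) ^ T - (m₁ ^ 2) ^ T := by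
      rw [sub_nonneg]
      exact pow_le_pow_left₀ (sq_nonneg m₁) (by linarith) T
    exact div_le_div₀ (by linarith) (by linarith) (by linarith) (by linarith)
  simp only [one_mul, mul_one] at h1 h2
  linarith

/-- The regime of large noise, by the `χ²` comparison. -/
theorem trajectory_real_le_of_le (A : Config (w + s + l) d m) (hB : 1 ≤ A.batchSize)
    (hBN : A.batchSize ≤ N) (hC : 0 < A.C) (hσ : 0 < A.σ) {μ : ℝ} {D D' : OPFDataset N w s l m}
    (hadj : OPFDataset.Adjacent μ D D') {ε r δ g σ' S : ℝ} {T : ℕ} (hT : 1 ≤ T)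
    (hε : 0 < ε) (hε1 : ε ≤ 1) (hr : 0 < r) (hr1 : r ≤ 0.85) (hδ : δ = 0.11157 * r ^ 2)
    (hr' : 2 / A.σ ≤ ε * r) (hg : g = A.batchSize / N * ε) (hg0 : 0 < g) (hg1 : g ≤ 1)
    (hs : 0 ≤ σ') (hS : σ' + g + g ^ 2 / 2 ≤ S)
    (htriv : T * g * δ + Real.exp (-(T * σ' ^ 2 / 2)) ≤ 1)
    {X : Set (Fin (T + 1) → Params d)} (hX : MeasurableSet X) :
    (trajectoryLaw A D T).real X ≤ Real.exp (T * g * S) * (trajectoryLaw A D' T).real X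
      + (T * g * δ + Real.exp (-(T * σ' ^ 2 / 2))) := by
  have hT0 : (1 : ℝ) ≤ T := by exact_mod_cast hT
  have hδ0 : 0 < δ := by rw [hδ]; positivity
  have hy : (2 / A.σ) ^ 2 ≤ (ε * r) ^ 2 := by gcongr
  have hM : 1 + (A.batchSize / N : ℝ) ^ 2 * (2 * Real.exp ((ε * r) ^ 2)
      - 2 * Real.exp ((ε * r) ^ 2 / 2)) ≤ 1 + g ^ 2 * (15.5 * δ) := by
    have h1 : (ε * r) ^ 2 ≤ 0.7225 := by
      have : (ε * r) ^ 2 ≤ (1 * 0.85) ^ 2 := by gcongr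
      norm_num at this ⊢; linarith
    have h2 := two_mul_exp_sub_le (sq_nonneg (ε * r)) h1
    have h3 := mul_le_mul_of_nonneg_left h2 (sq_nonneg (A.batchSize / N : ℝ))
    rw [hδ, hg]
    linarith
  have := isProbabilityMeasure_trajectoryLaw A D hBN T
  have := isProbabilityMeasure_trajectoryLaw A D' hBN T
  have chi := trajectory_chiBound A hBN (D := D) (D' := D') (M := 1 + g ^ 2 * (15.5 * δ))
    (by positivity) (fun θ f hf hb => (round_chi A hB hBN hC hσ hadj θ hy hf hb).trans
      (mul_le_mul_of_nonneg_right hM (integral_nonneg fun _ => sq_nonneg _))) T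
  have hS0 : 0 < S := by nlinarith
  have hK : 1 < Real.exp (T * g * S) := by
    rw [Real.one_lt_exp_iff]; positivity
  refine (chi.measureReal_le (one_le_pow₀ (by nlinarith [sq_nonneg g])) hK hX).trans ?_
  gcongr
  have hδ1 : 15.5 * δ ≤ 1.25 := by
    have : r ^ 2 ≤ 0.85 ^ 2 := by gcongr
    rw [hδ]; norm_num at this ⊢; linarith
  -- If 15.5 δ ≤ 1, the summand g of S suffices. Otherwise the nontrivial budget gives σ' ≥ g/4,
  -- matching 15.5 δ ≤ 1.25.
  have hgS : g * (15.5 * δ) ≤ S := by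
    rcases le_total (15.5 * δ) 1 with h | h
    · nlinarith
    · have h1 := sq_ge_of_exp_neg_lt (by positivity) htriv
      have h2 : 2 * (g * δ) ≤ σ' ^ 2 := by
        have : (T : ℝ) * (2 * (g * δ)) ≤ T * σ' ^ 2 := by nlinarith [sq_nonneg (T * g * δ)]
        exact le_of_mul_le_mul_left this (by linarith)
      have h3 : 0.25 * g ≤ σ' := by
        refine abs_le_of_sq_le_sq' ?_ hs |>.2
        have : 0.0625 * g ≤ 2 * δ := by norm_num at h ⊢; linarith
        nlinarith
      nlinarith
  -- Here 4b = 15.5, k = 2/V - 1/V² = 0.96, and m = 10.43 is just below 4ek.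
  refine chi_bound_le (V := 1.25) (b := 3.875) (k := 0.96) (m := 10.43) hT hg0 (by positivity) hδ1
    (by norm_num) hs (by nlinarith) hgS (by norm_num) (by linarith) (by norm_num) (by norm_num) ?_
        ?_
  · have := Real.exp_one_gt_d9
    norm_num at this ⊢; linarith
  · intro t y ht hy hyt ht1
    refine one_sub_mul_exp_le_of_le_one ht hy (hyt.trans ?_) ht1
    gcongr
    linarith

/-- The difference of the two sides is a quadratic in δ, convex for g ≤ 1, hence controlled by the
endpoints 0.08 and 0.34. The coefficient 12, smaller than the 16 available to
`HockeyProfile.mul_le`, preserves convexity up to g = 1. -/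
theorem sqrt_gap {g δ : ℝ} (hg : 0 ≤ g) (hg1 : g ≤ 1) (h1 : 0.08 ≤ δ) (h2 : δ ≤ 0.34) :
    g * ((0.92 + 2.6 * δ) * (2 + 2 * g) - (1 + g / 2) * (1 + 2 * g)) ^ 2
      ≤ (2 * δ + 12 * g * δ ^ 2) * (1 + 2 * g) ^ 2 := by
  have e1 : g * ((0.92 + 2.6 * 0.08) * (2 + 2 * g) - (1 + g / 2) * (1 + 2 * g)) ^ 2
      ≤ (2 * 0.08 + 12 * g * 0.08 ^ 2) * (1 + 2 * g) ^ 2 := by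
    have a1 : ((0.92 + 2.6 * 0.08) * (2 + 2 * g) - (1 + g / 2) * (1 + 2 * g)) ^ 2
        ≤ (1.256 - 0.244 * g) ^ 2 := by
      apply pow_le_pow_left₀ <;> nlinarith
    nlinarith [mul_le_mul_of_nonneg_left a1 hg, mul_nonneg hg hg, mul_nonneg hg (sub_nonneg.2 hg1),
      sq_nonneg (g - 0.3), mul_nonneg hg (mul_nonneg hg hg)]
  have e2 : g * ((0.92 + 2.6 * 0.34) * (2 + 2 * g) - (1 + g / 2) * (1 + 2 * g)) ^ 2
      ≤ (2 * 0.34 + 12 * g * 0.34 ^ 2) * (1 + 2 * g) ^ 2 := by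
    have a1 : ((0.92 + 2.6 * 0.34) * (2 + 2 * g) - (1 + g / 2) * (1 + 2 * g)) ^ 2
        ≤ 2.916 ^ 2 := by
      apply pow_le_pow_left₀ <;> nlinarith [sq_nonneg (g - 0.554)]
    nlinarith [mul_le_mul_of_nonneg_left a1 hg, mul_nonneg hg hg, mul_nonneg hg (sub_nonneg.2 hg1),
      sq_nonneg (g - 0.2), mul_nonneg hg (mul_nonneg hg hg)]
  have e3 : 0 ≤ g * ((2.6 * (2 + 2 * g)) ^ 2 - 12 * (1 + 2 * g) ^ 2)
      * ((δ - 0.08) * (0.34 - δ)) := by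
    refine mul_nonneg (mul_nonneg hg ?_) (mul_nonneg (by linarith) (by linarith))
    nlinarith
  nlinarith [mul_le_mul_of_nonneg_left e1 (sub_nonneg.2 h2),
    mul_le_mul_of_nonneg_left e2 (sub_nonneg.2 h1)]

/-- Supplies the condition g v ≤ S of `chi_bound_le`. Nontriviality with T ≥ 16 gives σ'² ≥ 2gδ +
16(gδ)² and 16gδ ≤ 1; the profile bounds `ub` linearly in δ, with different lines for small and
large δ. -/
theorem HockeyProfile.mul_le {δ h₀ h₂ h₅ ub g σ' S T : ℝ} (H : HockeyProfile δ h₀ h₂ h₅ ub)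
    (hδ : 0.08 ≤ δ) (hg : 0 < g) (hg1 : g ≤ 1) (hT : 16 ≤ T) (hs : 0 ≤ σ')
    (hS : σ' + g + g ^ 2 / 2 ≤ S) (htriv : T * g * δ + Real.exp (-(T * σ' ^ 2 / 2)) ≤ 1) :
    g * (ub * (1 + (1 + 2 * g)⁻¹)) ≤ S := by
  have hx : 0 ≤ T * g * δ := by positivity
  have h1 := sq_ge_of_exp_neg_lt hx htriv
  have h2 : 2 * (g * δ) + 16 * (g * δ) ^ 2 ≤ σ' ^ 2 := by
    have h0 : T * (2 * (g * δ) + 16 * (g * δ) ^ 2) ≤ T * σ' ^ 2 := by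
      nlinarith [mul_nonneg (sub_nonneg.2 hT) (mul_nonneg (by linarith : 0 ≤ T)
          (sq_nonneg (g * δ)))]
    exact le_of_mul_le_mul_left h0 (by linarith)
  have h3 : 16 * (g * δ) ≤ 1 := by
    have := Real.exp_pos (-(T * σ' ^ 2 / 2))
    nlinarith [mul_le_mul_of_nonneg_right hT (by positivity : 0 ≤ g * δ)]
  have g2 : 0 < 1 + 2 * g := by linarith
  have hub := H.ub_pos
  suffices h : g * (ub * (1 + (1 + 2 * g)⁻¹) - 1 - g / 2) ≤ σ' by linarith
  rcases le_total δ 0.34 with h | h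
  · have hu := H.small h
    have e : ub * (1 + (1 + 2 * g)⁻¹) - 1 - g / 2
        ≤ ((0.92 + 2.6 * δ) * (2 + 2 * g) - (1 + g / 2) * (1 + 2 * g)) / (1 + 2 * g) := by
      have : ((0.92 + 2.6 * δ) * (2 + 2 * g) - (1 + g / 2) * (1 + 2 * g)) / (1 + 2 * g)
          = (0.92 + 2.6 * δ) * (1 + (1 + 2 * g)⁻¹) - 1 - g / 2 := by field_simp; ring
      rw [this]
      gcongr
    refine (mul_le_mul_of_nonneg_left e hg.le).trans ?_
    refine abs_le_of_sq_le_sq' ?_ hs |>.2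
    refine le_trans ?_ h2
    rw [← mul_div_assoc, div_pow, div_le_iff₀ (by positivity)]
    have := mul_le_mul_of_nonneg_left (sqrt_gap hg.le hg1 hδ h) hg.le
    nlinarith
  · have hu := H.large (by linarith)
    have h4 : ub * (1 + (1 + 2 * g)⁻¹) ≤ 2 * ub := by
      have : (1 + 2 * g)⁻¹ ≤ 1 := inv_le_one_of_one_le₀ (by linarith)
      nlinarith
    have h5 : 6.9 * (g * δ) ≤ σ' := by
      refine abs_le_of_sq_le_sq' ?_ hs |>.2
      nlinarith [mul_pos hg (by linarith : 0 < δ)]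
    nlinarith

end SecondMoment

/-! ### Many rounds: five atoms and their second moment -/

section Profiles

variable {N w s l d m : ℕ}

theorem HockeyProfile.secondMoment_le {δ h₀ h₂ h₅ ub g : ℝ} (H : HockeyProfile δ h₀ h₂ h₅ ub)
    (hg : 0 < g) (hgδ : 16 * (g * δ) ≤ 1) :
    (h₂ - h₅) / 3 * (1 + 5 * g - 1) ^ 2 + ((h₀ - h₂) / 2 - (h₂ - h₅) / 3) * (1 + 2 * g - 1) ^ 2
      + ((h₀ - h₂) / 2 + g * h₀ - ((1 + 5 * g) * h₂ - (1 + 2 * g) * h₅) / 3)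
        * ((1 + 2 * g)⁻¹ - 1) ^ 2
      + ((1 + 5 * g) * h₂ - (1 + 2 * g) * h₅) / 3 * ((1 + 5 * g)⁻¹ - 1) ^ 2
      ≤ g ^ 2 * (ub * (1 + (1 + 2 * g)⁻¹)) := by
  set u := 2 * h₀ + 5 * h₂ - 7 * h₅ with hu
  set w := 2 * h₅ - h₂ + g * (7 * h₅ - 5 * h₂) with hw
  have e : (h₂ - h₅) / 3 * (1 + 5 * g - 1) ^ 2
      + ((h₀ - h₂) / 2 - (h₂ - h₅) / 3) * (1 + 2 * g - 1) ^ 2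
      + ((h₀ - h₂) / 2 + g * h₀ - ((1 + 5 * g) * h₂ - (1 + 2 * g) * h₅) / 3)
        * ((1 + 2 * g)⁻¹ - 1) ^ 2
      + ((1 + 5 * g) * h₂ - (1 + 2 * g) * h₅) / 3 * ((1 + 5 * g)⁻¹ - 1) ^ 2
      = g ^ 2 * (u + (u + 25 * g / (1 + 5 * g) ^ 2 * w) * (1 + 2 * g)⁻¹) := by
    rw [hu, hw]; field_simp; ring
  rw [e]
  refine mul_le_mul_of_nonneg_left ?_ (sq_nonneg g)
  have hi0 : 0 < (1 + 2 * g)⁻¹ := by positivity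
  have hi1 : (1 + 2 * g)⁻¹ ≤ 1 := inv_le_one_of_one_le₀ (by linarith)
  set i := (1 + 2 * g)⁻¹
  have hc0 : 0 ≤ 25 * g / (1 + 5 * g) ^ 2 := by positivity
  have hc1 : 25 * g / (1 + 5 * g) ^ 2 ≤ 1.25 := by
    rw [div_le_iff₀ (by positivity)]
    nlinarith [sq_nonneg (1 - 5 * g)]
  set c := 25 * g / (1 + 5 * g) ^ 2
  have h1 := H.ub₁
  have h2 : u + 0.625 * w ≤ ub := by
    have a2 := H.ub₂
    have a3 := H.ub₃
    -- The expression is affine in g. For δ ≤ 0.39 its slope is not positive, so g = 0 is the worst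
    -- case; otherwise 16gδ ≤ 1 gives g ≤ 0.17, the value built into `ub₃`.
    rcases le_total δ 0.39 with h | h
    · have := mul_nonneg hg.le (sub_nonneg.2 (H.second_order h))
      rw [hw]; linarith
    · have hg17 : g ≤ 0.17 := by norm_num at h ⊢; nlinarith
      rcases le_total (7 * h₅ - 5 * h₂) 0 with h' | h'
      · have := mul_nonneg hg.le (neg_nonneg.2 h')
        rw [hw]; linarith
      · have := mul_le_mul_of_nonneg_right hg17 h'
        rw [hw]; linarith
  rcases le_total w 0 with h | h
  · have h3 : c * w ≤ 0 := mul_nonpos_of_nonneg_of_nonpos hc0 h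
    have h4 : (u + c * w) * i ≤ ub * i := by gcongr; linarith
    linarith
  · have h3 : c * w ≤ 1.25 * w := by gcongr
    have h4 : (u + c * w) * i ≤ (u + 1.25 * w) * i := by gcongr
    have h5 : (u + 0.625 * w) * (1 + i) ≤ ub * (1 + i) := by gcongr
    have h6 : w * i ≤ w * 1 := by gcongr
    norm_num at h4 h5 ⊢
    linarith

theorem five_atoms_mean {g h₀ h₂ h₅ : ℝ} (hg : 0 < g) (n5 : 0 ≤ h₅) :
    (h₂ - h₅) / 3 * (1 + 5 * g) + ((h₀ - h₂) / 2 - (h₂ - h₅) / 3) * (1 + 2 * g)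
      + (1 - (h₀ - h₂) - g * h₀)
      + ((h₀ - h₂) / 2 + g * h₀ - ((1 + 5 * g) * h₂ - (1 + 2 * g) * h₅) / 3) * (1 + 2 * g)⁻¹
      + ((1 + 5 * g) * h₂ - (1 + 2 * g) * h₅) / 3 * (1 + 5 * g)⁻¹ ≤ 1 := by
  have e2 : (1 + 2 * g) * (1 + 2 * g)⁻¹ = 1 := mul_inv_cancel₀ (by positivity)
  have e5 : (1 + 5 * g) * (1 + 5 * g)⁻¹ = 1 := mul_inv_cancel₀ (by positivity)
  have hi : (1 + 5 * g)⁻¹ ≤ 1 := inv_le_one_of_one_le₀ (by linarith)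
  have : 0 ≤ g * h₅ * (1 - (1 + 5 * g)⁻¹) :=
    mul_nonneg (mul_nonneg hg.le n5) (by linarith)
  generalize (1 + 2 * g)⁻¹ = i at *
  generalize (1 + 5 * g)⁻¹ = j at *
  have : (h₂ - h₅) / 3 * (1 + 5 * g) + ((h₀ - h₂) / 2 - (h₂ - h₅) / 3) * (1 + 2 * g)
      + (1 - (h₀ - h₂) - g * h₀)
      + ((h₀ - h₂) / 2 + g * h₀ - ((1 + 5 * g) * h₂ - (1 + 2 * g) * h₅) / 3) * i
      + ((1 + 5 * g) * h₂ - (1 + 2 * g) * h₅) / 3 * j = 1 - g * h₅ * (1 - j) := by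
    linear_combination (h₀ / 2 - 5 * h₂ / 6 + h₅ / 3) * e2 + ((h₂ - h₅) / 3) * e5
  linarith

/-- The levels are 1 + gt for t = 0, 2, 5. The two reversed bounds exchange the datasets and pass to
complements, since adjacency is symmetric. -/
theorem round_level_bounds (A : Config (w + s + l) d m) (hB : 1 ≤ A.batchSize)
    (hBN : A.batchSize ≤ N) (hC : 0 < A.C) (hσ : 0 < A.σ) {μ : ℝ} {D D' : OPFDataset N w s l m}
    (hadj : OPFDataset.Adjacent μ D D') (θ : Params d) {ε r g h₀ h₂ h₅ : ℝ}
    (hε : 0 < ε) (hε1 : ε ≤ 1) (hr : 0 < r) (hr' : 2 / A.σ ≤ ε * r)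
    (hg : g = A.batchSize / N * ε) (hg0 : 0 < g)
    (k0 : hockeyMajorant (Real.log 1) r ≤ h₀) (k2 : hockeyMajorant (Real.log 3) r ≤ h₂)
    (k5 : hockeyMajorant (Real.log 6) r ≤ h₅) {Y : Set (Params d)} (hY : MeasurableSet Y) :
    let P := ((batchLaw N A.batchSize).prod (noiseLaw A)).real {p | update A D θ p.1 p.2 ∈ Y}
    let Q := ((batchLaw N A.batchSize).prod (noiseLaw A)).real {p | update A D' θ p.1 p.2 ∈ Y}
    P ≤ Q + g * h₀ ∧ P ≤ (1 + 2 * g) * Q + g * h₂ ∧ P ≤ (1 + 5 * g) * Q + g * h₅ ∧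
      (1 + 2 * g) * P ≤ Q + 2 * g + g * h₂ ∧ (1 + 5 * g) * P ≤ Q + 5 * g + g * h₅ := by
  intro P Q
  have hmeas : ∀ E : OPFDataset N w s l m,
      MeasurableSet {p : Finset (Fin N) × Params d | update A E θ p.1 p.2 ∈ Y} := fun E =>
    ((measurable_update A E).comp (measurable_const.prodMk measurable_id)) hY
  have := isProbabilityMeasure_batchLaw hBN
  have main := fun {t : ℝ} (ht : 0 ≤ t) {E E' : OPFDataset N w s l m}
    (hE : OPFDataset.Adjacent μ E E') {Z : Set (Params d)} (hZ : MeasurableSet Z) =>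
    round_hockey A hB hBN hC hσ hE θ hε hε1 ht hr hr' hZ
  rw [← hg] at main
  have comp : ∀ E : OPFDataset N w s l m,
      ((batchLaw N A.batchSize).prod (noiseLaw A)).real {p | update A E θ p.1 p.2 ∈ Yᶜ}
      = 1 - ((batchLaw N A.batchSize).prod (noiseLaw A)).real
        {p | update A E θ p.1 p.2 ∈ Y} := fun E => probReal_compl_eq_one_sub (hmeas E)
  have b0 := main (t := 0) le_rfl hadj hY
  have b2 := main (t := 2) (by norm_num) hadj hY
  have b5 := main (t := 5) (by norm_num) hadj hY
  have d2 := main (t := 2) (by norm_num) hadj.symm hY.compl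
  have d5 := main (t := 5) (by norm_num) hadj.symm hY.compl
  rw [comp, comp] at d2 d5
  rw [show (1 : ℝ) + 0 = 1 by norm_num] at b0
  rw [show (1 : ℝ) + 2 = 3 by norm_num] at b2 d2
  rw [show (1 : ℝ) + 5 = 6 by norm_num] at b5 d5
  have g0 := mul_le_mul_of_nonneg_left k0 hg0.le
  have g2 := mul_le_mul_of_nonneg_left k2 hg0.le
  have g5 := mul_le_mul_of_nonneg_left k5 hg0.le
  refine ⟨?_, ?_, ?_, ?_, ?_⟩ <;> linarith

set_option maxHeartbeats 1000000 in
/-- Many rounds with small noise. -/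
theorem trajectory_real_le_of_sixteen_le (A : Config (w + s + l) d m) (hB : 1 ≤ A.batchSize)
    (hBN : A.batchSize ≤ N) (hC : 0 < A.C) (hσ : 0 < A.σ) {μ : ℝ} {D D' : OPFDataset N w s l m}
    (hadj : OPFDataset.Adjacent μ D D') {ε r δ g σ' S : ℝ} {T : ℕ} (hT : 16 ≤ T)
    (hε : 0 < ε) (hε1 : ε ≤ 1) (hr : 0.85 ≤ r) (hr3 : r ≤ 3) (hδ : δ = 0.11157 * r ^ 2)
    (hr' : 2 / A.σ ≤ ε * r) (hg : g = A.batchSize / N * ε) (hg0 : 0 < g) (hg1 : g ≤ 1)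
    (hs : 0 ≤ σ') (hS : σ' + g + g ^ 2 / 2 ≤ S)
    (htriv : T * g * δ + Real.exp (-(T * σ' ^ 2 / 2)) ≤ 1)
    {X : Set (Fin (T + 1) → Params d)} (hX : MeasurableSet X) :
    (trajectoryLaw A D T).real X ≤ Real.exp (T * g * S) * (trajectoryLaw A D' T).real X
      + (T * g * δ + Real.exp (-(T * σ' ^ 2 / 2))) := by
  obtain ⟨h₀, h₂, h₅, ub, k0, k2, k5, H⟩ := exists_hockeyProfile hr hr3 hδ
  have hT0 : (16 : ℝ) ≤ T := by exact_mod_cast hT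
  have hδ8 : 0.08 ≤ δ := by rw [hδ]; norm_num at hr ⊢; nlinarith
  have hδ0 : 0 < δ := by linarith
  have hgδ : 16 * (g * δ) ≤ 1 := by
    have := Real.exp_pos (-(T * σ' ^ 2 / 2))
    nlinarith [mul_le_mul_of_nonneg_right hT0 (by positivity : 0 ≤ g * δ)]
  have hS0 : 0 < S := by nlinarith
  have hK : 1 < Real.exp (T * g * S) := by
    rw [Real.one_lt_exp_iff]; positivity
  have n5 := H.nonneg
  have n25 := H.le
  have n3 := H.convex
  have n02 : h₂ ≤ h₀ := by linarith
  -- Together with h₀ - h₂ ≤ 0.31 this keeps the weight of the atom 1 nonnegative; the budget enters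
  -- through 16gδ ≤ 1.
  have gh : g * h₀ ≤ 0.3 := by
    refine abs_le_of_sq_le_sq' ?_ (by norm_num) |>.2
    have := H.le_zero
    have h1 : g ^ 2 * (h₀ * h₀) ≤ g ^ 2 * (1.43 * δ) := by gcongr
    have h2 : g * (g * δ) ≤ 1 * (1 / 16) := by
      refine mul_le_mul hg1 (by linarith) (by positivity) (by norm_num)
    norm_num at h1 ⊢
    nlinarith
  have key := trajectory_real_le_of_secondMoment A hBN (D := D) (D' := D')
    (K := Real.exp (T * g * S)) (c := g * h₅) (V := g ^ 2 * (ub * (1 + (1 + 2 * g)⁻¹))) hK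
    ![(h₂ - h₅) / 3, (h₀ - h₂) / 2 - (h₂ - h₅) / 3, 1 - (h₀ - h₂) - g * h₀,
      (h₀ - h₂) / 2 + g * h₀ - ((1 + 5 * g) * h₂ - (1 + 2 * g) * h₅) / 3,
      ((1 + 5 * g) * h₂ - (1 + 2 * g) * h₅) / 3]
    ![1 + 5 * g, 1 + 2 * g, 1, (1 + 2 * g)⁻¹, (1 + 5 * g)⁻¹]
    (by
      -- This product is exactly the weight of the atom (1 + 2g)⁻¹.
      have a4 : 0 ≤ (1 / 6 + g / 3) * (3 * h₀ + 2 * h₅ - 5 * h₂) :=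
        mul_nonneg (by positivity) (by linarith)
      have a3 := H.diff_two
      intro j
      fin_cases j <;> simp <;> nlinarith)
    (by
      intro j
      fin_cases j <;> simp <;> positivity)
    (by positivity)
    (by simp [Fin.sum_univ_five]; ring)
    (by
      have := five_atoms_mean (h₀ := h₀) (h₂ := h₂) hg0 n5
      simp only [Fin.sum_univ_five, Matrix.cons_val, mul_one]
      linarith)
    (by
      have := H.secondMoment_le hg0 hgδ
      simp only [Fin.sum_univ_five, Matrix.cons_val]
      linarith)
    (by
      intro θ Y hY y hy
      have := isProbabilityMeasure_batchLaw hBN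
      obtain ⟨b0, b2, b5, d2, d5⟩ := round_level_bounds A hB hBN hC hσ hadj θ hε hε1
        (by linarith : 0 < r) hr' hg hg0 k0 k2 k5 hY
      have := five_atoms_dominate hg0 measureReal_nonneg measureReal_le_one n5 b0 b2 b5 d2 d5 hy
      simp only [Fin.sum_univ_five, Matrix.cons_val]
      exact this) T hX
  refine key.trans ?_
  have hi0 : 0 < (1 + 2 * g)⁻¹ := by positivity
  have hi1 : (1 + 2 * g)⁻¹ ≤ 1 := inv_le_one_of_one_le₀ (by linarith)
  have hub := H.ub_pos
  have hvub : ub * (1 + (1 + 2 * g)⁻¹) ≤ 2 * ub := by nlinarith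
  -- V = 4.04 is twice the bound 2.02 on `ub`, 4b = 52 is the constant of `ub_le`, and Δ = δ - h₅ is
  -- what remains after the additive error h₅ of each round.
  have fin := chi_bound_le (V := 4.04) (b := 13) (k := 2 / 4.04 - 1 / 4.04 ^ 2) (m := 4.71)
    (Δ := δ - h₅) (by omega : 1 ≤ T) hg0 (mul_pos hub (by linarith : 0 < 1 + (1 + 2 * g)⁻¹))
    (by have := H.ub_le_two; norm_num at this ⊢; linarith) (by norm_num) hs
    (by nlinarith : σ' + g ≤ S) (H.mul_le hδ8 hg0 hg1 hT0 hs hS htriv) (by norm_num)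
    (by have := H.ub_le; linarith) rfl (by norm_num)
    (by have := Real.exp_one_gt_d9; norm_num at this ⊢; linarith)
    (fun t y ht hy hyt ht1 => one_sub_mul_exp_le_of_le_sixteenth ht hy (hyt.trans (by
      gcongr; linarith)) ht1)
  linarith

end Profiles

/-! ### A verified subdivision check -/

section Cells

/-- The hockey-stick value at `z` of `t` independent factors, each equal to `U` with probability
`p`, to `1` with probability `1 - p * U`, and to `0` otherwise. -/
def iterHockey (p U K : ℝ) : ℕ → ℝ → ℝ
  | 0, z => max (z - K) 0
  | t + 1, z => p * iterHockey p U K t (z * U) + (1 - p * U) * iterHockey p U K t z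

theorem iterHockey_nonpos {p U K : ℝ} (hp : 0 ≤ p) (hpU : p * U ≤ 1) (hU : 1 ≤ U) (t : ℕ) :
    ∀ {z : ℝ}, 0 ≤ z → z * U ^ t ≤ K → iterHockey p U K t z ≤ 0 := by
  induction t with
  | zero =>
    intro z hz h
    rw [iterHockey]
    exact max_le (by simpa using h) le_rfl
  | succ t ih =>
    intro z hz h
    rw [iterHockey]
    have h1 := ih (z := z * U) (by positivity) (by rw [mul_assoc, ← pow_succ']; exact h)
    have h2 := ih hz (le_trans (mul_le_mul_of_nonneg_left
      (pow_le_pow_right₀ hU (Nat.le_succ t)) hz) h)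
    have h3 := mul_nonpos_of_nonneg_of_nonpos hp h1
    have h4 := mul_nonpos_of_nonneg_of_nonpos (sub_nonneg.2 hpU) h2
    linarith

/-- The unit of the fixed-point arithmetic. -/
abbrev fixUnit : ℕ := 4294967296

/-- The real value of a fixed-point number. -/
def fixVal (x : ℕ) : ℝ := x / fixUnit

/-- Application with the argument evaluated first. -/
def force {α : Type} (n : ℕ) (f : ℕ → α) : α :=
  match n with
  | 0 => f 0
  | k + 1 => f (k + 1)

@[simp] theorem force_eq {α : Type} (n : ℕ) (f : ℕ → α) : force n f = f n := by
  cases n <;> rfl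

/-- `1 + x / 2 * (1 + x / 3 * (⋯))` with `n` nested factors around `h`, rounded down. -/
def expSeries (x : ℕ) : ℕ → ℕ → ℕ
  | 0, h => h
  | n + 1, h => force (fixUnit + x * h / fixUnit / (n + 2)) fun h' => expSeries x n h'

/-- Repeated squaring, rounded down. -/
def sqIter : ℕ → ℕ → ℕ
  | 0, x => x
  | n + 1, x => force (x * x / fixUnit) fun y => sqIter n y

/-- The values `a_i - κ` for the recursion `a_{i + 1} = U a_i + 5`, rounded up. -/
def cellBase (U κ : ℕ) : ℕ → ℕ → List ℕ
  | 0, a => [a - κ]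
  | n + 1, a =>
      force (a - κ) fun x => x :: force (U * a / fixUnit + 1 + 5 * fixUnit) fun b =>
        cellBase U κ n b

/-- One averaging step, rounded up. -/
def cellStep (q : ℕ) : ℕ → List ℕ → List ℕ
  | _, [] => []
  | x, y :: L => force (87 * y / 1000 + q * x / fixUnit + 2) fun v => v :: cellStep q y L

/-- Iterated averaging. -/
def cellSteps (q : ℕ) : ℕ → List ℕ → List ℕ
  | 0, L => L
  | _ + 1, [] => []
  | n + 1, x :: L => cellSteps q n (cellStep q x L)

/-- The check on one cell. -/
def cellLeaf (T g₁ g₂ s₁ s₂ : ℕ) : Bool :=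
  force (s₁ + g₁ + g₁ * g₁ / fixUnit / 2) fun S =>
  force (T * (g₁ * S / fixUnit)) fun X =>
  force (expSeries X 8 fixUnit) fun h =>
  force (T * (S * h / fixUnit)) fun κ =>
  force (fixUnit + 5 * g₂) fun U =>
  force (fixUnit - 87 * (fixUnit + 5 * g₁) / 1000) fun q =>
  force (T * (s₂ * s₂ / fixUnit + 1) / 2 + 1) fun y =>
  force (sqIter 12 (fixUnit - (y / 4096 + 1))) fun E =>
  match cellSteps q T (cellBase U κ T 0) with
  | [] => false
  | v :: _ => Nat.ble (g₂ * v / fixUnit + 1) (67 * T * g₂ / 1000 + E)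

/-- The check on a cell, with at most `n` bisections in a row. -/
def cellCheck (T : ℕ) : ℕ → ℕ → ℕ → ℕ → ℕ → Bool
  | 0, g₁, g₂, s₁, s₂ => cellLeaf T g₁ g₂ s₁ s₂
  | n + 1, g₁, g₂, s₁, s₂ =>
    match cellLeaf T g₁ g₂ s₁ s₂ with
    | true => true
    | false =>
      match Nat.ble (s₂ - s₁) (4 * (g₂ - g₁)) with
      | true => force ((g₁ + g₂) / 2) fun c =>
          match cellCheck T n g₁ c s₁ s₂ with
          | true => cellCheck T n c g₂ s₁ s₂
          | false => false
      | false => force ((s₁ + s₂) / 2) fun c =>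
          match cellCheck T n g₁ g₂ s₁ c with
          | true => cellCheck T n g₁ g₂ c s₂
          | false => false

theorem fixVal_nonneg (x : ℕ) : 0 ≤ fixVal x := by unfold fixVal; positivity

theorem fixVal_unit : fixVal fixUnit = 1 := div_self (by norm_num [fixUnit])

theorem fixVal_add (x y : ℕ) : fixVal (x + y) = fixVal x + fixVal y := by
  unfold fixVal; push_cast; ring

theorem fixVal_mul_nat (n x : ℕ) : fixVal (n * x) = n * fixVal x := by
  unfold fixVal; push_cast; ring

theorem fixVal_mono {x y : ℕ} (h : x ≤ y) : fixVal x ≤ fixVal y := by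
  unfold fixVal; gcongr

theorem le_fixVal_sub (x y : ℕ) : fixVal x - fixVal y ≤ fixVal (x - y) := by
  have : fixVal x ≤ fixVal (x - y + y) := fixVal_mono (by omega)
  rw [fixVal_add] at this
  linarith

theorem fixVal_sub_le {x y : ℕ} (h : 0 < x - y) : fixVal (x - y) = fixVal x - fixVal y := by
  have : fixVal (x - y + y) = fixVal x := by congr 1; omega
  rw [fixVal_add] at this
  linarith

theorem fixVal_div_le (x n : ℕ) : fixVal (x / n) ≤ fixVal x / n := by
  unfold fixVal
  rw [div_right_comm]
  gcongr
  exact Nat.cast_div_le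

theorem le_fixVal_div (x : ℕ) {n : ℕ} (hn : 0 < n) : fixVal x / n ≤ fixVal (x / n + 1) := by
  unfold fixVal
  rw [div_right_comm]
  gcongr
  rw [div_le_iff₀ (by positivity)]
  have := Nat.lt_div_mul_add (a := x) hn
  have h : x ≤ (x / n + 1) * n := by rw [add_mul]; omega
  exact_mod_cast h

theorem fixVal_mul_le (x y : ℕ) : fixVal (x * y / fixUnit) ≤ fixVal x * fixVal y := by
  refine (fixVal_div_le _ _).trans (le_of_eq ?_)
  unfold fixVal; push_cast; ring

theorem le_fixVal_mul (x y : ℕ) : fixVal x * fixVal y ≤ fixVal (x * y / fixUnit + 1) := by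
  refine le_trans (le_of_eq ?_) (le_fixVal_div _ (by norm_num [fixUnit]))
  unfold fixVal; push_cast; ring

/-- The nested series approximates (e^x - 1)/x from below. Factoring out t avoids the division by g
that would be ill-conditioned for small g. -/
theorem expSeries_mul_le (x : ℕ) {t : ℝ} (hxt : fixVal x ≤ t) :
    fixVal (expSeries x 8 fixUnit) * t ≤ Real.exp t - 1 := by
  have ht : 0 ≤ t := (fixVal_nonneg x).trans hxt
  have step : ∀ (n h : ℕ) (c : ℝ), fixVal h ≤ c →
      fixVal (fixUnit + x * h / fixUnit / (n + 2)) ≤ 1 + t * c / (n + 2) := by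
    intro n h c hc
    rw [fixVal_add, fixVal_unit]
    have h1 := fixVal_div_le (x * h / fixUnit) (n + 2)
    have h2 : fixVal (x * h / fixUnit) / ((n + 2 : ℕ) : ℝ) ≤ t * c / (n + 2) := by
      push_cast
      gcongr
      exact (fixVal_mul_le x h).trans
        (mul_le_mul hxt hc (fixVal_nonneg h) ht)
    linarith
  have key := step 0 _ _ <| step 1 _ _ <| step 2 _ _ <| step 3 _ _ <| step 4 _ _ <|
    step 5 _ _ <| step 6 _ _ <| step 7 fixUnit 1 fixVal_unit.le
  have h1 := Real.sum_le_exp_of_nonneg ht 10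
  simp only [Finset.sum_range_succ, Finset.sum_range_zero, Nat.factorial] at h1
  simp only [expSeries, force_eq]
  refine (mul_le_mul_of_nonneg_right key ht).trans ?_
  norm_num at h1 ⊢
  linarith

theorem sqIter_le (n : ℕ) : ∀ {x : ℕ} {c : ℝ}, fixVal x ≤ c →
    fixVal (sqIter n x) ≤ c ^ 2 ^ n := by
  induction n with
  | zero => intro x c h; simpa [sqIter] using h
  | succ n ih =>
    intro x c h
    rw [sqIter, force_eq, pow_succ', pow_mul]
    refine ih ((fixVal_mul_le x x).trans ?_)
    rw [sq]
    exact mul_le_mul h h (fixVal_nonneg x) ((fixVal_nonneg x).trans h)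

/-- e^(-u) ≥ (1 - u/4096)^4096, with twelve squarings rounded down; if the truncated difference is 0
the bound is trivial. -/
theorem sqIter_le_exp {y : ℕ} {u : ℝ} (h : u ≤ fixVal y) :
    fixVal (sqIter 12 (fixUnit - (y / 4096 + 1))) ≤ Real.exp (-u) := by
  have h0 : fixVal (fixUnit - (y / 4096 + 1)) ≤ Real.exp (-u / 4096) := by
    rcases Nat.eq_zero_or_pos (fixUnit - (y / 4096 + 1)) with h' | h'
    · rw [h']; simp [fixVal, (Real.exp_pos _).le]
    · rw [fixVal_sub_le h', fixVal_unit]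
      have h1 := le_fixVal_div y (n := 4096) (by norm_num)
      have h2 := Real.add_one_le_exp (-u / 4096)
      have h3 : u / 4096 ≤ fixVal y / ((4096 : ℕ) : ℝ) := by push_cast; gcongr
      linarith
  refine (sqIter_le 12 h0).trans (le_of_eq ?_)
  rw [← Real.exp_nat_mul]
  congr 1
  push_cast
  ring

/-- The values of `F` at `z`, `z * U`, … are bounded by `g` times the entries of the list. -/
def ListBounds (F : ℝ → ℝ) (g U : ℝ) : ℝ → List ℕ → Prop
  | _, [] => True
  | z, x :: L => F z ≤ g * fixVal x ∧ ListBounds F g U (z * U) L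

theorem listBounds_cellStep {K g U : ℝ} (hg : 0 ≤ g) (hpU : 0.087 * U ≤ 1) {q : ℕ}
    (hq : 1 - 0.087 * U ≤ fixVal q) (t : ℕ) (L : List ℕ) : ∀ {z : ℝ} {x : ℕ},
    ListBounds (iterHockey 0.087 U K t) g U z (x :: L) →
      ListBounds (iterHockey 0.087 U K (t + 1)) g U z (cellStep q x L) := by
  induction L with
  | nil => intro z x _; trivial
  | cons y L ih =>
    intro z x h
    obtain ⟨h1, h2⟩ := h
    rw [cellStep, force_eq]
    refine ⟨?_, ih h2⟩
    have h3 := h2.1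
    rw [iterHockey]
    have a1 := le_fixVal_div (87 * y) (n := 1000) (by norm_num)
    have a2 := le_fixVal_mul q x
    have e : fixVal (87 * y / 1000 + q * x / fixUnit + 2)
        = fixVal (87 * y / 1000 + 1) + fixVal (q * x / fixUnit + 1) := by
      rw [← fixVal_add]; congr 1; ring
    rw [e]
    rw [fixVal_mul_nat] at a1
    have a3 : 0.087 * iterHockey 0.087 U K t (z * U) ≤ g * fixVal (87 * y / 1000 + 1) := by
      have : 0.087 * (g * fixVal y) ≤ g * fixVal (87 * y / 1000 + 1) := by
        push_cast at a1
        have := mul_le_mul_of_nonneg_left a1 hg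
        norm_num at this ⊢
        linarith
      exact (mul_le_mul_of_nonneg_left h3 (by norm_num)).trans this
    have a4 : (1 - 0.087 * U) * iterHockey 0.087 U K t z ≤ g * fixVal (q * x / fixUnit + 1) := by
      calc (1 - 0.087 * U) * iterHockey 0.087 U K t z
          ≤ (1 - 0.087 * U) * (g * fixVal x) :=
            mul_le_mul_of_nonneg_left h1 (sub_nonneg.2 hpU)
        _ ≤ fixVal q * (g * fixVal x) :=
            mul_le_mul_of_nonneg_right hq (mul_nonneg hg (fixVal_nonneg x))
        _ = g * (fixVal q * fixVal x) := by ring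
        _ ≤ _ := mul_le_mul_of_nonneg_left a2 hg
    linarith

theorem listBounds_cellSteps {K g U : ℝ} (hg : 0 ≤ g) (hpU : 0.087 * U ≤ 1) {q : ℕ}
    (hq : 1 - 0.087 * U ≤ fixVal q) (n : ℕ) : ∀ {t : ℕ} {z : ℝ} {L : List ℕ},
    ListBounds (iterHockey 0.087 U K t) g U z L →
      ListBounds (iterHockey 0.087 U K (t + n)) g U z (cellSteps q n L) := by
  induction n with
  | zero => intro t z L h; exact h
  | succ n ih =>
    intro t z L h
    cases L with
    | nil => trivial
    | cons x L =>
      rw [cellSteps, show t + (n + 1) = (t + 1) + n by ring]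
      exact ih (listBounds_cellStep hg hpU hq t L h)

/-- Writing (1 + 5g)^i = 1 + g a_i and K ≥ 1 + gκ, all hockey-stick values become g times numbers
that stay bounded as g tends to 0. Hence cells touching g = 0 can be checked. -/
theorem listBounds_cellBase {K g : ℝ} (hg : 0 ≤ g) {U κ : ℕ} (hU : 1 + 5 * g ≤ fixVal U)
    (hK : 1 + g * fixVal κ ≤ K) (n : ℕ) : ∀ {a : ℕ} {α : ℝ}, 0 ≤ α → α ≤ fixVal a →
    ListBounds (iterHockey 0.087 (1 + 5 * g) K 0) g (1 + 5 * g) (1 + g * α)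
      (cellBase U κ n a) := by
  have head : ∀ {a : ℕ} {α : ℝ}, 0 ≤ α → α ≤ fixVal a →
      iterHockey 0.087 (1 + 5 * g) K 0 (1 + g * α) ≤ g * fixVal (a - κ) := by
    intro a α h0 ha
    rw [iterHockey]
    refine max_le ?_ (mul_nonneg hg (fixVal_nonneg _))
    have h1 := mul_le_mul_of_nonneg_left (le_fixVal_sub a κ) hg
    have h2 := mul_le_mul_of_nonneg_left ha hg
    linarith
  induction n with
  | zero => intro a α h0 ha; exact ⟨head h0 ha, trivial⟩
  | succ n ih =>
    intro a α h0 ha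
    rw [cellBase, force_eq, force_eq]
    refine ⟨head h0 ha, ?_⟩
    have e : (1 + g * α) * (1 + 5 * g) = 1 + g * ((1 + 5 * g) * α + 5) := by ring
    rw [e]
    refine ih (by positivity) ?_
    have h1 := le_fixVal_mul U a
    have h2 : (1 + 5 * g) * α ≤ fixVal U * fixVal a :=
      mul_le_mul hU ha h0 (fixVal_nonneg U)
    rw [fixVal_add, fixVal_mul_nat 5, fixVal_unit]
    push_cast
    linarith

/-- Monotone endpoints are used: S, X and κ are rounded down from g₁, s₁, U is taken at g₂, q is
rounded up from g₁, and E is rounded down from s₂. Each averaging step shortens the list by one,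
leaving the value at z = 1 after T steps. -/
theorem cellLeaf_sound {T g₁ g₂ s₁ s₂ : ℕ} {g σ K : ℝ} (h : cellLeaf T g₁ g₂ s₁ s₂ = true)
    (hg₁ : fixVal g₁ ≤ g) (hg₂ : g ≤ fixVal g₂) (hs₁ : fixVal s₁ ≤ σ) (hs₂ : σ ≤ fixVal s₂)
    (hg : 0 < g) (hg1 : g ≤ 1) (hK : Real.exp (T * g * (σ + g + g ^ 2 / 2)) ≤ K) :
    iterHockey 0.087 (1 + 5 * g) K T 1 ≤ 0.067 * T * g + Real.exp (-(T * σ ^ 2 / 2)) := by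
  simp only [cellLeaf, force_eq] at h
  set S := s₁ + g₁ + g₁ * g₁ / fixUnit / 2 with hS
  set X := T * (g₁ * S / fixUnit) with hX
  set H := expSeries X 8 fixUnit with hH
  set κ := T * (S * H / fixUnit) with hκ
  set U := fixUnit + 5 * g₂ with hU
  set q := fixUnit - 87 * (fixUnit + 5 * g₁) / 1000 with hq
  set y := T * (s₂ * s₂ / fixUnit + 1) / 2 + 1 with hy
  set E := sqIter 12 (fixUnit - (y / 4096 + 1)) with hE
  have hσ : 0 ≤ σ := (fixVal_nonneg s₁).trans hs₁
  have bS : fixVal S ≤ σ + g + g ^ 2 / 2 := by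
    rw [hS, fixVal_add, fixVal_add]
    have h1 := fixVal_div_le (g₁ * g₁ / fixUnit) 2
    have h2 := fixVal_mul_le g₁ g₁
    have h3 : fixVal g₁ * fixVal g₁ ≤ g * g := mul_le_mul hg₁ hg₁ (fixVal_nonneg _) hg.le
    push_cast at h1
    linarith
  have bX : fixVal X ≤ T * g * fixVal S := by
    rw [hX, fixVal_mul_nat, mul_assoc]
    have h2 := fixVal_mul_le g₁ S
    have h3 : fixVal g₁ * fixVal S ≤ g * fixVal S :=
      mul_le_mul_of_nonneg_right hg₁ (fixVal_nonneg _)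
    gcongr
    linarith
  have bκ : 1 + g * fixVal κ ≤ K := by
    refine le_trans ?_ hK
    have h1 := expSeries_mul_le X bX
    have h2 : fixVal κ ≤ T * (fixVal S * fixVal H) := by
      rw [hκ, fixVal_mul_nat]
      gcongr
      exact fixVal_mul_le S H
    have h3 := mul_le_mul_of_nonneg_left h2 hg.le
    have h4 : Real.exp (T * g * fixVal S) ≤ Real.exp (T * g * (σ + g + g ^ 2 / 2)) := by
      gcongr
    linarith
  have bU : 1 + 5 * g ≤ fixVal U := by
    rw [hU, fixVal_add, fixVal_mul_nat, fixVal_unit]; push_cast; linarith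
  have bq : 1 - 0.087 * (1 + 5 * g) ≤ fixVal q := by
    have h1 := le_fixVal_sub fixUnit (87 * (fixUnit + 5 * g₁) / 1000)
    have h2 := fixVal_div_le (87 * (fixUnit + 5 * g₁)) 1000
    rw [fixVal_mul_nat, fixVal_add, fixVal_mul_nat, fixVal_unit] at h2
    rw [fixVal_unit] at h1
    push_cast at h2
    norm_num at h2 ⊢
    linarith
  have bE : fixVal E ≤ Real.exp (-(T * σ ^ 2 / 2)) := by
    refine sqIter_le_exp ?_
    have h1 := le_fixVal_div (T * (s₂ * s₂ / fixUnit + 1)) (n := 2) (by norm_num)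
    have h2 := le_fixVal_mul s₂ s₂
    have h3 : σ * σ ≤ fixVal s₂ * fixVal s₂ := mul_le_mul hs₂ hs₂ hσ (fixVal_nonneg _)
    rw [fixVal_mul_nat] at h1
    refine le_trans ?_ h1
    push_cast
    rw [sq]
    gcongr
    linarith
  have bounds := listBounds_cellSteps hg.le (by norm_num; linarith) bq T
    (listBounds_cellBase hg.le bU bκ T (a := 0) (α := 0) le_rfl (fixVal_nonneg 0))
  rw [mul_zero, add_zero, zero_add] at bounds
  cases hL : cellSteps q T (cellBase U κ T 0) with
  | nil => simp [hL] at h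
  | cons v L =>
    rw [hL] at bounds h
    have h1 := fixVal_mono (Nat.le_of_ble_eq_true h)
    rw [fixVal_add] at h1
    have h2 := le_fixVal_mul g₂ v
    rw [fixVal_add] at h2
    have h3 := fixVal_div_le (67 * T * g₂) 1000
    rw [fixVal_mul_nat] at h3
    rw [fixVal_add] at h1
    have h4 := bounds.1
    push_cast at h3
    have h5 : fixVal g₂ * (fixVal v - 0.067 * T) ≤ Real.exp (-(T * σ ^ 2 / 2)) := by
      norm_num at h3 ⊢
      linarith
    have h6 := Real.exp_pos (-(T * σ ^ 2 / 2))
    -- The test is made at g₂ only; the inequality is linear in g with nonnegative right side, so it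
    -- passes to every smaller positive g.
    rcases le_total (fixVal v - 0.067 * T) 0 with h7 | h7
    · nlinarith
    · nlinarith

theorem cellCheck_sound {T : ℕ} (n : ℕ) : ∀ {g₁ g₂ s₁ s₂ : ℕ} {g σ K : ℝ},
    cellCheck T n g₁ g₂ s₁ s₂ = true →
    fixVal g₁ ≤ g → g ≤ fixVal g₂ → fixVal s₁ ≤ σ → σ ≤ fixVal s₂ →
    0 < g → g ≤ 1 → Real.exp (T * g * (σ + g + g ^ 2 / 2)) ≤ K →
    iterHockey 0.087 (1 + 5 * g) K T 1 ≤ 0.067 * T * g + Real.exp (-(T * σ ^ 2 / 2)) := by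
  induction n with
  | zero => intro g₁ g₂ s₁ s₂ g σ K h; exact cellLeaf_sound h
  | succ n ih =>
    intro g₁ g₂ s₁ s₂ g σ K h hg₁ hg₂ hs₁ hs₂ hg hg1 hK
    rw [cellCheck] at h
    split at h
    · next h' => exact cellLeaf_sound h' hg₁ hg₂ hs₁ hs₂ hg hg1 hK
    · split at h
      · rw [force_eq] at h
        split at h
        · next h' =>
          rcases le_total g (fixVal ((g₁ + g₂) / 2)) with hc | hc
          · exact ih h' hg₁ hc hs₁ hs₂ hg hg1 hK
          · exact ih h hc hg₂ hs₁ hs₂ hg hg1 hK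
        · simp at h
      · rw [force_eq] at h
        split at h
        · next h' =>
          rcases le_total σ (fixVal ((s₁ + s₂) / 2)) with hc | hc
          · exact ih h' hg₁ hg₂ hs₁ hc hg hg1 hK
          · exact ih h hg₁ hg₂ hc hs₂ hg hg1 hK
        · simp at h

set_option maxRecDepth 10000 in
theorem cellCheck_eq_true : ∀ T ∈ List.range 16,
    cellCheck T 24 0 fixUnit 0 (5 * fixUnit) = true := by
  decide +kernel

theorem iterHockey_le {T : ℕ} (hT : T < 16) {g σ K : ℝ} (hg : 0 < g) (hg1 : g ≤ 1) (hσ : 0 ≤ σ)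
    (hK : Real.exp (T * g * (σ + g + g ^ 2 / 2)) ≤ K) :
    iterHockey 0.087 (1 + 5 * g) K T 1 ≤ 0.067 * T * g + Real.exp (-(T * σ ^ 2 / 2)) := by
  -- For σ ≥ 5, K is at least (1 + 5g)^T, the largest value of the product, so the hockey-stick
  -- value is not positive.
  rcases le_total σ 5 with h | h
  · refine cellCheck_sound 24 (cellCheck_eq_true T (List.mem_range.2 hT)) ?_ ?_ ?_ ?_ hg hg1 hK
    · simpa [fixVal] using hg.le
    · rwa [fixVal_unit]
    · simpa [fixVal] using hσ
    · rw [fixVal_mul_nat, fixVal_unit]; norm_num; exact h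
  · refine (iterHockey_nonpos (by norm_num) (by norm_num; linarith) (by linarith) T zero_le_one
      (le_trans ?_ hK)).trans (by positivity)
    rw [one_mul, mul_assoc, Real.exp_nat_mul]
    gcongr
    have := Real.add_one_le_exp (g * (σ + g + g ^ 2 / 2))
    nlinarith [mul_le_mul_of_nonneg_left h hg.le, mul_pos hg hg, mul_pos hg (mul_pos hg hg)]

end Cells

/-! ### Few rounds: three atoms and the cell computation -/

section FewRounds

variable {N w s l d m : ℕ}

/-- Few rounds with small noise. -/
theorem trajectory_real_le_of_lt_sixteen (A : Config (w + s + l) d m) (hB : 1 ≤ A.batchSize)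
    (hBN : A.batchSize ≤ N) (hC : 0 < A.C) (hσ : 0 < A.σ) {μ : ℝ} {D D' : OPFDataset N w s l m}
    (hadj : OPFDataset.Adjacent μ D D') {ε r δ g σ' S : ℝ} {T : ℕ} (hT : T < 16)
    (hε : 0 < ε) (hε1 : ε ≤ 1) (hr : 0.85 ≤ r) (hr3 : r ≤ 3) (hδ : δ = 0.11157 * r ^ 2)
    (hr' : 2 / A.σ ≤ ε * r) (hg : g = A.batchSize / N * ε) (hg0 : 0 < g) (hg1 : g ≤ 1)
    (hs : 0 ≤ σ') (hS : σ' + g + g ^ 2 / 2 ≤ S)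
    {X : Set (Fin (T + 1) → Params d)} (hX : MeasurableSet X) :
    (trajectoryLaw A D T).real X ≤ Real.exp (T * g * S) * (trajectoryLaw A D' T).real X
      + (T * g * δ + Real.exp (-(T * σ' ^ 2 / 2))) := by
  obtain ⟨h₀, h₂, h₅, ub, k0, k2, k5, H⟩ := exists_hockeyProfile hr hr3 hδ
  have n5 := H.nonneg
  have hsum : ∀ F : ℝ → ℝ → ℝ,
      ∑ j, F ((![0.087, 1 - 0.087 * (1 + 5 * g), 5 * g * 0.087] : Fin 3 → ℝ) j)
      ((![1 + 5 * g, 1, 0] : Fin 3 → ℝ) j) = F 0.087 (1 + 5 * g) + F (1 - 0.087 * (1 + 5 * g)) 1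
        + F (5 * g * 0.087) 0 := fun F => by
    simp only [Fin.sum_univ_three, Matrix.cons_val]
  have hzero : ∀ K t, 0 ≤ K → iterHockey 0.087 (1 + 5 * g) K t 0 ≤ 0 := fun K t hK =>
    iterHockey_nonpos (by norm_num) (by norm_num; linarith) (by linarith) t le_rfl (by simpa)
  have key := trajectory_hockeyBound A hBN (D := D) (D' := D') (K := Real.exp (T * g * S))
    (c := g * h₅) (Real.exp_pos _).le ![0.087, 1 - 0.087 * (1 + 5 * g), 5 * g * 0.087]
    ![1 + 5 * g, 1, 0]
    (by
      intro j
      fin_cases j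
      · norm_num
      · simp only [Fin.mk_one, Matrix.cons_val]; norm_num; linarith
      · simp only [Fin.reduceFinMk, Matrix.cons_val]; positivity)
    (by
      intro j
      fin_cases j <;> simp
      positivity)
    (by positivity)
    (by rw [hsum fun a b => a * b]; linarith)
    (by
      intro θ Y hY y hy
      have := isProbabilityMeasure_batchLaw hBN
      obtain ⟨b0, -, b5, -, -⟩ := round_level_bounds A hB hBN hC hσ hadj θ hε hε1
        (by linarith : 0 < r) hr' hg hg0 k0 k2 k5 hY
      -- 5 · 0.087 = 0.435 is the bound on h₀ - h₅, and 0.067 is the slack δ - h₅ left for the cell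
      -- computation.
      have := three_atoms_dominate (u := 0.087) hg0 measureReal_nonneg measureReal_le_one n5
        (by have := H.diff_five; norm_num at this ⊢; linarith) b0 b5 hy
      rw [hsum fun a b => a * max (b - y) 0]
      linarith)
    (iterHockey 0.087 (1 + 5 * g) (Real.exp (T * g * S))) (fun z hz => le_rfl)
    (fun t z hz => by
      rw [hsum fun a b => a * iterHockey 0.087 (1 + 5 * g) (Real.exp (T * g * S)) t (z * b),
        mul_one, mul_zero, iterHockey]
      have := mul_nonpos_of_nonneg_of_nonpos (by positivity : 0 ≤ 5 * g * 0.087)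
        (hzero _ t (Real.exp_pos (T * g * S)).le)
      linarith) T
  have h1 := key 1 zero_le_one X hX
  have h2 := iterHockey_le hT (K := Real.exp (T * g * S)) hg0 hg1 hs (by gcongr)
  have h3 := mul_le_mul_of_nonneg_left H.slack (by positivity : (0 : ℝ) ≤ T * g)
  simp only [one_mul, mul_one] at h1
  linarith

end FewRounds

/-! ### Assembly of the privacy guarantee -/

section Privacy

variable {N w s l d m : ℕ}

/-- The privacy of the trajectory in terms of `σ' = √(2 log (1 / δ') / T)`. -/
theorem trajectory_real_le (A : Config (w + s + l) d m) (hB : 1 ≤ A.batchSize)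
    (hBN : A.batchSize ≤ N) (hC : 0 < A.C) {μ : ℝ} {D D' : OPFDataset N w s l m}
    (hadj : OPFDataset.Adjacent μ D D') {ε δ g σ' S : ℝ} {T : ℕ} (hT : 1 ≤ T)
    (hε : 0 < ε) (hε1 : ε ≤ 1) (hδ : 0 < δ) (hδ1 : δ < 1)
    (hσ : Real.sqrt (2 * Real.log 1.25 / δ) / ε ≤ A.σ)
    (hg : g = A.batchSize / N * ε) (hs : 0 ≤ σ') (hS : σ' + g + g ^ 2 / 2 ≤ S)
    {X : Set (Fin (T + 1) → Params d)} (hX : MeasurableSet X) :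
    (trajectoryLaw A D T).real X ≤ Real.exp (T * g * S) * (trajectoryLaw A D' T).real X
      + (T * g * δ + Real.exp (-(T * σ' ^ 2 / 2))) := by
  have hl := log_five_quarters_ge
  have hB0 : (1 : ℝ) ≤ A.batchSize := by exact_mod_cast hB
  have hN0 : (A.batchSize : ℝ) ≤ N := by exact_mod_cast hBN
  have hq : (A.batchSize : ℝ) / N ≤ 1 := (div_le_one (by linarith)).2 hN0
  have hq0 : 0 < (A.batchSize : ℝ) / N := div_pos (by linarith) (by linarith)
  have hg0 : 0 < g := by rw [hg]; positivity
  have hg1 : g ≤ 1 := by rw [hg]; exact mul_le_one₀ hq hε.le hε1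
  have := isProbabilityMeasure_trajectoryLaw A D hBN T
  rcases lt_or_ge 1 (T * g * δ + Real.exp (-(T * σ' ^ 2 / 2))) with htriv | htriv
  · have h1 : (trajectoryLaw A D T).real X ≤ 1 := measureReal_le_one
    have h2 : 0 ≤ Real.exp (T * g * S) * (trajectoryLaw A D' T).real X :=
      mul_nonneg (Real.exp_pos _).le measureReal_nonneg
    linarith
  -- 0.11157 is a lower bound for log(1.25)/2, so the noise hypothesis becomes 2/σ ≤ εr, where 2 is
  -- the sensitivity in units of C. Since δ < 1, r ≤ 3.
  set r := Real.sqrt (δ / 0.11157) with hrdef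
  have hr0 : 0 < r := Real.sqrt_pos.2 (by positivity)
  have hr2 : r ^ 2 = δ / 0.11157 := Real.sq_sqrt (by positivity)
  have hδr : δ = 0.11157 * r ^ 2 := by rw [hr2]; field_simp
  have hr3 : r ≤ 3 := by
    refine abs_le_of_sq_le_sq' ?_ (by norm_num) |>.2
    rw [hr2, div_le_iff₀ (by norm_num)]
    norm_num; linarith
  have hsq : 2 / r ≤ Real.sqrt (2 * Real.log 1.25 / δ) := by
    apply Real.le_sqrt_of_sq_le
    rw [div_pow, hr2, div_div_eq_mul_div, div_le_div_iff_of_pos_right hδ]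
    norm_num at hl ⊢
    linarith
  have hσr : 2 / (ε * r) ≤ A.σ := by
    refine le_trans ?_ hσ
    rw [mul_comm, ← div_div]
    gcongr
  have hσ0 : 0 < A.σ := lt_of_lt_of_le (by positivity) hσr
  have hr' : 2 / A.σ ≤ ε * r := by
    rw [div_le_iff₀ hσ0]
    rwa [div_le_iff₀ (by positivity), mul_comm] at hσr
  rcases le_total r 0.85 with h | h
  · exact trajectory_real_le_of_le A hB hBN hC hσ0 hadj hT hε hε1 hr0 h hδr hr' hg hg0 hg1 hs hS
      htriv hX
  rcases lt_or_ge T 16 with hT' | hT'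
  · exact trajectory_real_le_of_lt_sixteen A hB hBN hC hσ0 hadj hT' hε hε1 h hr3 hδr hr' hg hg0 hg1
      hs hS hX
  · exact trajectory_real_le_of_sixteen_le A hB hBN hC hσ0 hadj hT' hε hε1 h hr3 hδr hr' hg hg0 hg1
      hs hS htriv hX

theorem isDifferentiallyPrivate_trajectoryLaw (A : Config (w + s + l) d m)
    (hB : 1 ≤ A.batchSize) (hBN : A.batchSize ≤ N) (hC : 0 < A.C) (T : ℕ) (μ ε δ δ' : ℝ)
    (hε : ε ∈ Set.Ioo (0 : ℝ) 1) (hδ : δ ∈ Set.Ioo (0 : ℝ) 1) (hδ' : 0 < δ')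
    (hσ : Real.sqrt (2 * Real.log 1.25 / δ) / ε ≤ A.σ) :
    IsDifferentiallyPrivate (OPFDataset.Adjacent μ)
        (fun D : OPFDataset N w s l m => trajectoryLaw A D T)
        (Real.sqrt (2 * T * Real.log (1 / δ')) * (A.batchSize * ε / N)
          + T * A.batchSize * ε / N * (Real.exp (A.batchSize * ε / N) - 1))
        (T * A.batchSize / N * δ + δ') := by
  intro D D' hadj X hX
  have := isProbabilityMeasure_trajectoryLaw A D hBN T
  have := isProbabilityMeasure_trajectoryLaw A D' hBN T
  have hq0 : 0 ≤ (A.batchSize : ℝ) / N := by positivity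
  have hδ0 := hδ.1
  rcases le_total 1 δ' with h1 | h1
  · have h2 : (trajectoryLaw A D T).real X ≤ 1 := measureReal_le_one
    have h3 : 0 ≤ T * A.batchSize / N * δ := by positivity
    have h4 : 0 ≤ Real.exp (Real.sqrt (2 * T * Real.log (1 / δ')) * (A.batchSize * ε / N)
        + T * A.batchSize * ε / N * (Real.exp (A.batchSize * ε / N) - 1))
        * (trajectoryLaw A D' T).real X := mul_nonneg (Real.exp_pos _).le measureReal_nonneg
    linarith
  rcases Nat.eq_zero_or_pos T with rfl | hT
  · have h2 : trajectoryLaw A D 0 = trajectoryLaw A D' 0 := rfl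
    simp only [Nat.cast_zero, mul_zero, zero_mul, Real.sqrt_zero, zero_div, add_zero,
      Real.exp_zero, one_mul, zero_add, h2]
    linarith
  have hT0 : (0 : ℝ) < T := by exact_mod_cast hT
  set g := (A.batchSize : ℝ) / N * ε with hg
  have hg0 : 0 ≤ g := mul_nonneg hq0 hε.1.le
  have hlog : 0 ≤ Real.log (1 / δ') := Real.log_nonneg (by rw [le_div_iff₀ hδ']; linarith)
  set σ' := Real.sqrt (2 * Real.log (1 / δ') / T) with hσ'
  have hexp : g + g ^ 2 / 2 ≤ Real.exp g - 1 := by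
    have := Real.quadratic_le_exp_of_nonneg hg0
    linarith
  have key := trajectory_real_le A hB hBN hC hadj hT hε.1 hε.2.le hδ.1 hδ.2 hσ hg
    (σ' := σ') (Real.sqrt_nonneg _) (S := σ' + (Real.exp g - 1)) (by linarith) hX
  have e1 : T * σ' ^ 2 / 2 = Real.log (1 / δ') := by
    rw [hσ', Real.sq_sqrt (by positivity)]; field_simp
  have e2 : Real.sqrt (2 * T * Real.log (1 / δ')) = T * σ' := by
    rw [hσ', Real.sqrt_eq_iff_mul_self_eq (by positivity) (by positivity), mul_mul_mul_comm,
      Real.mul_self_sqrt (by positivity)]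
    field_simp
  have e3 : (A.batchSize : ℝ) * ε / N = g := by rw [hg]; ring
  have e4 : (T : ℝ) * A.batchSize * ε / N = T * g := by rw [hg]; ring
  rw [e1, one_div, Real.log_inv, neg_neg, Real.exp_log hδ'] at key
  rw [e2, e3, e4]
  refine key.trans ?_
  have e5 : T * σ' * g + T * g * (Real.exp g - 1) = T * g * (σ' + (Real.exp g - 1)) := by ring
  rw [e5]
  -- The estimate obtained has an extra factor ε ≤ 1 in the additive term, which is dropped here.
  have e6 : T * g * δ ≤ T * A.batchSize / N * δ := by
    have : T * g * δ = T * A.batchSize / N * δ * ε := by rw [hg]; ring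
    rw [this]
    exact mul_le_of_le_one_right (by positivity) hε.2.le
  linarith

theorem IsDifferentiallyPrivate.map {𝒟 𝒮 𝒯 : Type*} [MeasurableSpace 𝒮] [MeasurableSpace 𝒯]
    {adj : 𝒟 → 𝒟 → Prop} {M : 𝒟 → Measure 𝒮} {ε δ : ℝ} (h : IsDifferentiallyPrivate adj M ε δ)
    {f : 𝒮 → 𝒯} (hf : Measurable f) :
    IsDifferentiallyPrivate adj (fun D => (M D).map f) ε δ := by
  intro D D' hadj X hX
  rw [map_measureReal_apply hf hX, map_measureReal_apply hf hX]
  exact h D D' hadj _ (hf hX)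

end Privacy

end PrivateVQC

end

theorem mainTheorem1 {N w s l d m : ℕ} (A : PrivateVQC.Config (w + s + l) d m)
    (hloss : ∀ y : PrivateVQC.Output m,
      Differentiable ℝ fun p : PrivateVQC.Params d × PrivateVQC.Output m => A.loss p.1 p.2 y)
    (hB : 1 ≤ A.batchSize) (hBN : A.batchSize ≤ N) (hC : 0 < A.C) (hη : 0 < A.η)
    (T : ℕ) (μ ε δ δ' : ℝ)
    (hε : ε ∈ Set.Ioo (0 : ℝ) 1) (hδ : δ ∈ Set.Ioo (0 : ℝ) 1) (hδ' : 0 < δ')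
    (hσ : Real.sqrt (2 * Real.log 1.25 / δ) / ε ≤ A.σ) :
    PrivateVQC.IsDifferentiallyPrivate (PrivateVQC.OPFDataset.Adjacent μ)
        (fun D : PrivateVQC.OPFDataset N w s l m => PrivateVQC.trajectoryLaw A D T)
        (Real.sqrt (2 * T * Real.log (1 / δ')) * (A.batchSize * ε / N)
          + T * A.batchSize * ε / N * (Real.exp (A.batchSize * ε / N) - 1))
        (T * A.batchSize / N * δ + δ') ∧
      PrivateVQC.IsDifferentiallyPrivate (PrivateVQC.OPFDataset.Adjacent μ)
        (fun D : PrivateVQC.OPFDataset N w s l m => PrivateVQC.trainedLaw A D T)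
        (Real.sqrt (2 * T * Real.log (1 / δ')) * (A.batchSize * ε / N)
          + T * A.batchSize * ε / N * (Real.exp (A.batchSize * ε / N) - 1))
        (T * A.batchSize / N * δ + δ') := by
  have h := PrivateVQC.isDifferentiallyPrivate_trajectoryLaw (s := s) A hB hBN hC T μ ε δ δ' hε hδ
    hδ' hσ
  exact ⟨h, h.map (measurable_pi_apply (Fin.last T))⟩
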